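/- **Grids.** Let $(I,\mathbb A,m)$ be a probability space, $|A|=m(A)$. A *grid* is a sequence $\mathcal G=(\mathcal G^k)_{k\ge 0}$ of finite families of measurable sets of positive measure, at least one nonempty, such that for all $k$ and $Q\in\mathcal G^k$ the number of $R\in\mathcal G^k$ meeting $Q$ is bounded by a constant. Write $k_0(\Omega,\mathcal G)=\min\{k: \exists Q\in \mathcal G^k,\ Q\subset\Omega\}$. A *good grid* is a grid $\mathcal P$ with $\mathcal P^0=\{I\}$ such that each $\mathcal P^k$ is a partition of $I$ up to a null set, each $Q\in\mathcal P^{k+1}$ lies in some $P\in\mathcal P^k$ and then $\lambda_1\le |Q|/|P|\le\lambda_2$ for fixed $0<\lambda_1<\lambda_2<1$, and $\bigcup_k\mathcal P^k$ generates $\mathbb A$. Fix a good grid $\mathcal P$ on $(I,m)$. **Exponents.** Let $p\in[1,\infty)$, $q\in[1,\infty]$, $\epsilon>0$, $\gamma\in[0,1]$, $s,\beta,\delta_0>0$ with $s+\epsilon\le 1/p$, $s<\beta<1/p$, $\delta_0<\max\{s,\epsilon\}$, and let $t_0=p/(1-sp+\delta_0p)$. **Besov spaces.** For a grid $\mathcal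 G$ let $a_Q=|Q|^{s-1/p}1_Q$. A $\mathcal B^s_{p,q}(\mathcal G)$-*representation* of $f\in L^p$ is a series $f=\sum_k\sum_{Q\in\mathcal G^k}c_Qa_Q$, $c_Q\in\mathbb C$, with $\sum_k|\sum_{Q\in\mathcal G^k}c_Qa_Q|_p<\infty$, convergent to $f$ in $L^p$, and of finite *cost* $\|c\|=(\sum_k(\sum_{Q\in\mathcal G^k}|c_Q|^p)^{q/p})^{1/q}$ (a supremum over $k$ if $q=\infty$). $\mathcal B^s_{p,q}$ is the space of functions with a $\mathcal B^s_{p,q}(\mathcal P)$-representation, modulo a.e. equality, normed by the infimum of the costs. $|\cdot|_{\mathcal B^\beta_{p,q}(W)}$ is the same infimum (with $\beta$ in place of $s$) over representations that only use sets $Q\subset W$ ($\infty$ if there are none). A *Besov atom* on $Q$ is a function $b$ with $|b|_{\mathcal B^\beta_{p,q}(Q)}\le|Q|^{s-\beta}$. Let $C_{GBS}$ be the infimum of the $C$ such that every $g=\sum_k\sum_{Q\in\mathcal P^k}d_Qb_Q$ (with Besov atoms $b_Q$ on $Q$, absolutely convergent in $L^p$ in the above sense, $\|d\|<\infty$) has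 a $\mathcal B^s_{p,q}(\mathcal P)$-representation of cost $\le C\|d\|$. Let $C_{GC}$ be the infimum of the $C\ge1$ for which there are bounded linear functionals $k_P$ on $L^1(m)$, $P\in\mathcal P$, such that for all $f\in\mathcal B^s_{p,q}$ the series $\sum_P k_P(f)a_P$ is a $\mathcal B^s_{p,q}$-representation of $f$ of cost $\le C|f|_{\mathcal B^s_{p,q}}$. **Branches.** Let $\Lambda\subset\mathbb N$. For $r\in\Lambda$ let $h_r:J_r\to I_r$ be a bijection between measurable subsets of $I$, measurable together with its inverse, and let $\mathcal G_r$ be a grid consisting of subsets of $I_r$ such that the sets of each $\mathcal G_r^k$ are pairwise disjoint and $k_0(Q,\mathcal G_r)=k$ for all $Q\in\mathcal G^k_r$. Let $a_r\ge0$, $\epsilon_r=\pm\epsilon$, $C_1^r,C_2^r,C_3^r>0$, $\lambda_1^r,\lambda_2^r\in(0,1)$, and assume: * $m(Q)=0\iff m(h_r^{-1}Q)=0$ for measurable $Q\subset I_r$. * For all $Q\in\mathcal G_r$, with $\Omega=h_r^{-1}Q$, there are families $\mathcal F^k\subset\mathcal P^k$, $k\ge k_0(\Omega,\mathcal P)$,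 of pairwise disjoint sets (also across different $k$) with union $\Omega$ and $\sum_{W\in\mathcal F^k}|W|^{1-sp}\le C_1^r(\lambda_1^r)^{k-k_0(\Omega,\mathcal P)}|\Omega|^{1-sp}$. * For all $Q\in\mathcal G_r$, with $\Delta=|k_0(Q,\mathcal G_r)-k_0(h_r^{-1}Q,\mathcal P)|$: $\Delta\ge a_r$ and $(|Q|/|h_r^{-1}Q|)^{\epsilon_r/|\epsilon_r|}\le C_2^r(\lambda_2^r)^{\Delta}$. * Up to null sets, $I_r$ and all the sets $h_r^{-1}W$, $W\in\mathcal G_r$, are countable unions of elements of $\mathcal P$. * The sets of $\bigcup_r\mathcal G_r$, together with the $Q\in\mathcal P$ that are disjoint from all $I_r$, generate $\mathbb A$. **Potentials.** Let $g_r:J_r\to\mathbb C$ be measurable (up to null sets) with $$|g_r1_W|_{\mathcal B^\beta_{p,q}(W)}\le C_3^r\Big(\frac{|Q|}{|h_r^{-1}Q|}\Big)^{\frac1p-s+\epsilon_r}|W|^{\frac1p-\beta}$$ for all $W\in\mathcal P$, $Q\in\mathcal G_r$ with $W\subset J_r$ and $h_r(W)\subset Q$. Let $\Lambda_r=\max\{(\lambda_2^r)^\epsilon,(\lambda_1^r)^{1/p}\}$,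 $\bar\lambda=\sup_r\Lambda_r$, and assume $\bar\lambda<1$. Put $\Theta_r=(C_2^r)^\epsilon C_3^r(C_1^r)^{1/p}\Lambda_r^{a_r(1-\gamma)}$, $N=\sup_{W\in\mathcal P}\#\{r:W\subset J_r\}$, and $D=2/(1-\bar\lambda^\gamma)$ (which is $\infty$ if $\gamma=0$). **Transfer operator.** Let $\Phi_rf=g_r\cdot(f\circ h_r)$ on $J_r$, $\Phi_rf=0$ elsewhere, and $\Phi f=\sum_r\Phi_rf$. Assume there is $C$ with $|\Phi f|_1\le\sum_r|\Phi_rf|_1\le C|f|_{t_0}$ for all $f\in L^{t_0}(m)$. **Slicing.** Coefficients $d=(d_Q)_{Q\in\mathcal P}$ have a *$C$-regular slicing* if they represent some $f\in\mathcal B^s_{p,q}$ and there are $\mathcal B^s_{p,q}(\mathcal G_r)$-representations $f1_{I_r}=\sum_{Q\in\mathcal G_r}c_Q^ra_Q$, $r\in\Lambda$, with nonnegative coefficients if all $d_Q\ge0$, such that $$\Big(\sum_j\Big(\sum_r\Theta_r\Big(\sum_{Q\in\mathcal G_r^j}|c^r_Q|^p\Big)^{1/p}\Big)^q\Big)^{1/q}\le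 C\|d\|\quad\text{or}\quad N^{1-\frac1p}\Big(\sum_j\Big(\sum_r\Theta_r^p\sum_{Q\in\mathcal G_r^j}|c^r_Q|^p\Big)^{q/p}\Big)^{1/q}\le C\|d\|$$ (suprema over $j$ if $q=\infty$; $N^0=1$). Assume there are $C_{FR},C_{ES}\ge0$ and a finite $\mathcal P'\subset\mathcal P$ such that, for every $\mathcal B^s_{p,q}(\mathcal P)$-representation $d$ of any function, the coefficients $d\,1_{\mathcal P\setminus\mathcal P'}$ have a $C_{ES}$-regular slicing and $d\,1_{\mathcal P'}$ have a $C_{FR}$-regular slicing. **Last assumptions.** Assume $6\,C_{GBS}\,D\,C_{ES}\,C_{GC}<1$, $g_r\ge0$ a.e. on $J_r$ for all $r$, and $\int\Phi f\,dm=\int f\,dm$ for all $f\in\mathcal B^s_{p,q}$. **Conclusion.** $\Phi$ is a bounded operator on $\mathcal B^s_{p,q}$; $\mathcal B^s_{p,q}$ is dense in $L^1(m)$ and $\Phi$ extends to a bounded operator on $L^1(m)$, again denoted by $\Phi$. Moreover: * **A.** There is $\delta\in(0,1)$ such that $E=\sigma_{\mathcal B^s_{p,q}}(\Phi)\cap\{|z|\ge\delta\}$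 is finite, nonempty and contained in $\mathbb S^1$. Every $\lambda\in E$ is an eigenvalue with finite-dimensional eigenspace, and $(\Phi-\lambda)^2f=0$ implies $(\Phi-\lambda)f=0$ for $f\in\mathcal B^s_{p,q}$. * **B.** There are bounded projections $\pi_\lambda$, $\lambda\in E$, and a bounded operator $\tilde\Theta$ on $\mathcal B^s_{p,q}$ with $\|\tilde\Theta^n\|\le K\theta^n$ for all $n$, for some $K$ and $\theta\in(0,1)$, such that $\Phi^n=\sum_{\lambda\in E}\lambda^n\pi_\lambda+\tilde\Theta^n$ for all $n\ge1$, and $\Phi\pi_\lambda=\lambda\pi_\lambda$, $\pi_{\lambda'}\pi_\lambda=0$ for $\lambda\ne\lambda'$, $\tilde\Theta\pi_\lambda=\pi_\lambda\tilde\Theta=0$. In particular $\sup_n|\Phi^n|_{\mathcal B^s_{p,q}}<\infty$. * **C.** There is $\rho\in\mathcal B^s_{p,q}$ with $\rho\ge0$, $\int\rho\,dm=1$ and $\Phi\rho=\rho$. * **D.** If $|\lambda|=1$ and $u\in L^1(m)$ satisfies $\Phi u=\lambda u$, then $u\in\mathcal B^s_{p,q}$, $\Phi|u|=|u|$, and $u_k=(\operatorname{sgn}u)^k|u|$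 satisfies $\Phi u_k=\lambda^ku_k$ for all $k\in\mathbb Z$, where $\operatorname{sgn}u=u/|u|$ and $u_k=0$ where $u=0$. * **E.** Every $\lambda\in E$ is a root of unity: $\lambda^n=1$ for some $n\ge1$. -/

import Mathlib

open MeasureTheory Filter Topology
open scoped ENNReal NNReal

noncomputable section

namespace BesovGrid

/-! ## Grids -/

/-- A grid on (a part of) a measure space: a sequence of finite families of measurable sets of
positive measure, at least one of them nonempty, with uniformly bounded overlaps. -/
structure Grid {X : Type*} [MeasurableSpace X] (m : Measure X) where
  level : ℕ → Finset (Set X)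
  measurableSet : ∀ k, ∀ Q ∈ level k, MeasurableSet Q
  pos : ∀ k, ∀ Q ∈ level k, 0 < m Q
  exists_nonempty : ∃ k, (level k).Nonempty
  overlap : ∃ C : ℕ, ∀ k, ∀ Q ∈ level k,
    {R : Set X | R ∈ level k ∧ (R ∩ Q).Nonempty}.ncard ≤ C

/-- A `(lam₁, lam₂)`-good grid on a measure space: a nested sequence of finite partitions (up to
null sets) with uniformly comparable children, which generates the σ-algebra. -/
structure GoodGrid {X : Type*} [mX : MeasurableSpace X] (m : Measure X) extends Grid m where
  lam₁ : ℝ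
  lam₂ : ℝ
  lam₁_pos : 0 < lam₁
  lam₁_lt_lam₂ : lam₁ < lam₂
  lam₂_lt_one : lam₂ < 1
  level_zero : level 0 = {Set.univ}
  cover : ∀ k, m (⋃ Q ∈ level k, Q)ᶜ = 0
  disjoint : ∀ k, ∀ P ∈ level k, ∀ Q ∈ level k, P ≠ Q → Disjoint P Q
  nested : ∀ k, ∀ Q ∈ level (k + 1), ∃ P ∈ level k, Q ⊆ P
  ratio : ∀ k, ∀ Q ∈ level (k + 1), ∀ P ∈ level k, Q ⊆ P →
    lam₁ ≤ m.real Q / m.real P ∧ m.real Q / m.real P ≤ lam₂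
  generates : MeasurableSpace.generateFrom {Q | ∃ k, Q ∈ level k} = mX

/-- Families of complex coefficients, indexed by the level and the set. Only the values at
sets of the corresponding level of the grid under consideration matter. -/
abbrev Coeff (X : Type*) := ℕ → Set X → ℂ

/-- The `ℓ^q`-norm of a sequence, `1 ≤ q ≤ ∞`. -/
def ellNorm (q : ℝ≥0∞) (u : ℕ → ℝ≥0∞) : ℝ≥0∞ :=
  if q = ∞ then ⨆ k, u k else (∑' k, u k ^ q.toReal) ^ (1 / q.toReal)

namespace Grid

variable {X : Type*} [MeasurableSpace X] {m : Measure X}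

/-- `k₀(Ω)`: the least `k` such that some element of level `k` is contained in `Ω`. -/
def k₀ (G : Grid m) (Ω : Set X) : ℕ := sInf {k | ∃ P ∈ G.level k, P ⊆ Ω}

/-- Souza's canonical atom `|Q|^{s - 1/p} 1_Q`. -/
def atom (_G : Grid m) (s p : ℝ) (Q : Set X) : X → ℂ :=
  Q.indicator fun _ => ((m.real Q ^ (s - 1 / p) : ℝ) : ℂ)

/-- The `k`-th layer `∑_{Q ∈ P^k} c_Q a_Q` of a series of atoms. -/
def layer (G : Grid m) (s p : ℝ) (c : Coeff X) (k : ℕ) : X → ℂ :=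
  fun x => ∑ Q ∈ G.level k, c k Q * G.atom s p Q x

/-- `(∑_{Q ∈ P^k} |c_Q|^p)^{1/p}`. -/
def levelNorm (G : Grid m) (p : ℝ) (c : Coeff X) (k : ℕ) : ℝ≥0∞ :=
  (∑ Q ∈ G.level k, ‖c k Q‖ₑ ^ p) ^ (1 / p)

/-- `(∑_k (∑_{Q ∈ P^k} |c_Q|^p)^{q/p})^{1/q}`, with a supremum over `k` if `q = ∞`. -/
def cost (G : Grid m) (p : ℝ) (q : ℝ≥0∞) (c : Coeff X) : ℝ≥0∞ :=
  ellNorm q (G.levelNorm p c)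

/-- `∑_k F_k = f`, with absolute convergence of the series in `L^p`. -/
def SumsTo (m : Measure X) (p : ℝ) (F : ℕ → X → ℂ) (f : X → ℂ) : Prop :=
  MemLp f (ENNReal.ofReal p) m ∧
  ∑' k, eLpNorm (F k) (ENNReal.ofReal p) m < ∞ ∧
  Tendsto (fun n => eLpNorm (fun x => f x - ∑ k ∈ Finset.range n, F k x) (ENNReal.ofReal p) m)
    atTop (𝓝 0)

/-- `∑_k ∑_{Q ∈ P^k} c_Q a_Q` is a `B^s_{p,q}`-representation of `f`. -/
def IsRep (G : Grid m) (s p : ℝ) (q : ℝ≥0∞) (c : Coeff X) (f : X → ℂ) : Prop :=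
  SumsTo m p (G.layer s p c) f ∧ G.cost p q c < ∞

/-- The norm of `B^s_{p,q}`, with value `∞` for functions outside the space. -/
def eBesovNorm (G : Grid m) (s p : ℝ) (q : ℝ≥0∞) (f : X → ℂ) : ℝ≥0∞ :=
  ⨅ (c : Coeff X) (_ : G.IsRep s p q c f), G.cost p q c

/-- The norm of `B^s_{p,q}(W)`: the infimum is taken over the representations that only use
atoms supported in `W`; it is `∞` if there are none. -/
def eBesovNormOn (G : Grid m) (s p : ℝ) (q : ℝ≥0∞) (W : Set X) (f : X → ℂ) : ℝ≥0∞ :=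
  ⨅ (c : Coeff X) (_ : G.IsRep s p q c f ∧ ∀ k, ∀ Q ∈ G.level k, ¬ Q ⊆ W → c k Q = 0),
    G.cost p q c

/-- An `(s, β, p, q)`-Besov atom supported on `Q`. The normalising constant is `1`, for which
Souza's canonical atoms are Besov atoms. -/
def IsBesovAtom (G : Grid m) (s β p : ℝ) (q : ℝ≥0∞) (Q : Set X) (b : X → ℂ) : Prop :=
  G.eBesovNormOn β p q Q b ≤ ENNReal.ofReal (m.real Q ^ (s - β))

/-- `∑_k ∑_{Q ∈ P^k} d_Q b_Q` is a representation of `f` by Besov atoms. -/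
def IsBesovAtomRep (G : Grid m) (s β p : ℝ) (q : ℝ≥0∞) (d : Coeff X) (b : ℕ → Set X → X → ℂ)
    (f : X → ℂ) : Prop :=
  (∀ k, ∀ Q ∈ G.level k, G.IsBesovAtom s β p q Q (b k Q)) ∧
  SumsTo m p (fun k x => ∑ Q ∈ G.level k, d k Q * b k Q x) f ∧
  G.cost p q d < ∞

/-- The optimal constant in the conversion of representations by Besov atoms to
representations by Souza's atoms. -/
def convConst (G : Grid m) (s β p : ℝ) (q : ℝ≥0∞) : ℝ≥0∞ :=
  sInf {C | ∀ d b f, G.IsBesovAtomRep s β p q d b f →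
    ∃ z, G.IsRep s p q z f ∧ G.cost p q z ≤ C * G.cost p q d}

/-- The optimal constant `C ≥ 1` of a canonical representation `f = ∑_P k_P(f) a_P` whose
coefficients are continuous linear functionals on `L^1`. -/
def canConst (G : Grid m) (s p : ℝ) (q : ℝ≥0∞) : ℝ≥0∞ :=
  sInf {C | 1 ≤ C ∧ ∃ κ : ℕ → Set X → (Lp ℂ 1 m →L[ℂ] ℂ),
    ∀ (f : X → ℂ) (hf : Integrable f m), G.eBesovNorm s p q f < ∞ →
      G.IsRep s p q (fun k P => κ k P (hf.toL1 f)) f ∧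
      G.cost p q (fun k P => κ k P (hf.toL1 f)) ≤ C * G.eBesovNorm s p q f}

end Grid

/-! ## The normed space `B^s_{p,q}` -/

section Helpers

lemma ellNorm_mono {q : ℝ≥0∞} {u v : ℕ → ℝ≥0∞} (h : ∀ k, u k ≤ v k) :
    ellNorm q u ≤ ellNorm q v := by
  unfold ellNorm
  split_ifs
  · exact iSup_mono h
  · exact ENNReal.rpow_le_rpow
      (ENNReal.tsum_le_tsum fun k => ENNReal.rpow_le_rpow (h k) ENNReal.toReal_nonneg)
      (by positivity)

lemma toReal_ge_one {q : ℝ≥0∞} (hq : 1 ≤ q) (h : q ≠ ∞) : 1 ≤ q.toReal := by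
  have := (ENNReal.toReal_le_toReal ENNReal.one_ne_top h).2 hq
  simpa using this

lemma ellNorm_add_le {q : ℝ≥0∞} (hq : 1 ≤ q) (u v : ℕ → ℝ≥0∞) :
    ellNorm q (fun k => u k + v k) ≤ ellNorm q u + ellNorm q v := by
  unfold ellNorm
  split_ifs with h
  · exact iSup_le fun k => add_le_add (le_iSup u k) (le_iSup v k)
  · have := ENNReal.lintegral_Lp_add_le (μ := (Measure.count : Measure ℕ)) (f := u) (g := v)
      (measurable_of_countable u).aemeasurable (measurable_of_countable v).aemeasurable
      (toReal_ge_one hq h)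
    simpa [lintegral_count] using this

lemma ellNorm_const_mul {q : ℝ≥0∞} (hq : 1 ≤ q) (a : ℝ≥0∞) (u : ℕ → ℝ≥0∞) :
    ellNorm q (fun k => a * u k) = a * ellNorm q u := by
  unfold ellNorm
  split_ifs with h
  · rw [ENNReal.mul_iSup]
  · have h1 := toReal_ge_one hq h
    have h0 : 0 < q.toReal := by linarith
    simp_rw [ENNReal.mul_rpow_of_nonneg _ _ h0.le, ENNReal.tsum_mul_left]
    rw [ENNReal.mul_rpow_of_nonneg _ _ (by positivity), ← ENNReal.rpow_mul,
      mul_one_div_cancel h0.ne', ENNReal.rpow_one]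

lemma le_ellNorm {q : ℝ≥0∞} (hq : 1 ≤ q) (u : ℕ → ℝ≥0∞) (k : ℕ) : u k ≤ ellNorm q u := by
  unfold ellNorm
  split_ifs with h
  · exact le_iSup u k
  · have h1 := toReal_ge_one hq h
    have h0 : 0 < q.toReal := by linarith
    calc u k = (u k ^ q.toReal) ^ (1 / q.toReal) := by
          rw [← ENNReal.rpow_mul, mul_one_div_cancel h0.ne', ENNReal.rpow_one]
      _ ≤ _ := ENNReal.rpow_le_rpow (ENNReal.le_tsum k) (by positivity)

namespace Grid

variable {X : Type*} [MeasurableSpace X] {m : Measure X} (G : Grid m)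

lemma measurable_layer (s p : ℝ) (c : Coeff X) (k : ℕ) : Measurable (G.layer s p c k) := by
  unfold layer
  refine Finset.measurable_sum _ fun Q hQ => ?_
  exact (measurable_const.indicator (G.measurableSet k Q hQ)).const_mul _

lemma layer_add (s p : ℝ) (c d : Coeff X) (k : ℕ) :
    G.layer s p (c + d) k = G.layer s p c k + G.layer s p d k := by
  funext x
  simp [layer, add_mul, Finset.sum_add_distrib]

lemma layer_smul (s p : ℝ) (a : ℂ) (c : Coeff X) (k : ℕ) :
    G.layer s p (a • c) k = a • G.layer s p c k := by
  funext x
  simp [layer, Finset.mul_sum, mul_assoc]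

lemma levelNorm_add_le {p : ℝ} (hp : 1 ≤ p) (c d : Coeff X) (k : ℕ) :
    G.levelNorm p (c + d) k ≤ G.levelNorm p c k + G.levelNorm p d k := by
  unfold levelNorm
  refine le_trans ?_ (ENNReal.Lp_add_le (G.level k) (fun Q => ‖c k Q‖ₑ) (fun Q => ‖d k Q‖ₑ) hp)
  refine ENNReal.rpow_le_rpow (Finset.sum_le_sum fun Q _ => ?_) (by positivity)
  exact ENNReal.rpow_le_rpow (enorm_add_le _ _) (by positivity)

lemma levelNorm_smul {p : ℝ} (hp : 1 ≤ p) (a : ℂ) (c : Coeff X) (k : ℕ) :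
    G.levelNorm p (a • c) k = ‖a‖ₑ * G.levelNorm p c k := by
  have h0 : 0 < p := by linarith
  unfold levelNorm
  have : ∀ Q, ‖(a • c) k Q‖ₑ ^ p = ‖a‖ₑ ^ p * ‖c k Q‖ₑ ^ p := fun Q => by
    rw [← ENNReal.mul_rpow_of_nonneg _ _ h0.le]
    simp [enorm_mul]
  simp_rw [this, ← Finset.mul_sum]
  rw [ENNReal.mul_rpow_of_nonneg _ _ (by positivity), ← ENNReal.rpow_mul,
    mul_one_div_cancel h0.ne', ENNReal.rpow_one]

lemma cost_add_le {p : ℝ} (hp : 1 ≤ p) {q : ℝ≥0∞} (hq : 1 ≤ q) (c d : Coeff X) :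
    G.cost p q (c + d) ≤ G.cost p q c + G.cost p q d :=
  (ellNorm_mono fun k => G.levelNorm_add_le hp c d k).trans (ellNorm_add_le hq _ _)

lemma cost_smul {p : ℝ} (hp : 1 ≤ p) {q : ℝ≥0∞} (hq : 1 ≤ q) (a : ℂ) (c : Coeff X) :
    G.cost p q (a • c) = ‖a‖ₑ * G.cost p q c := by
  unfold cost
  rw [← ellNorm_const_mul hq]
  congr 1
  funext k
  exact G.levelNorm_smul hp a c k

lemma SumsTo.congr {p : ℝ} {F : ℕ → X → ℂ} {f g : X → ℂ} (h : SumsTo m p F f) (hfg : f =ᵐ[m] g) :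
    SumsTo m p F g := by
  refine ⟨(memLp_congr_ae hfg).1 h.1, h.2.1, ?_⟩
  refine h.2.2.congr fun n => eLpNorm_congr_ae ?_
  filter_upwards [hfg] with x hx
  rw [hx]

lemma IsRep.congr {s p : ℝ} {q : ℝ≥0∞} {c : Coeff X} {f g : X → ℂ} (h : G.IsRep s p q c f)
    (hfg : f =ᵐ[m] g) : G.IsRep s p q c g := ⟨h.1.congr hfg, h.2⟩

lemma eBesovNorm_congr {s p : ℝ} {q : ℝ≥0∞} {f g : X → ℂ} (hfg : f =ᵐ[m] g) :
    G.eBesovNorm s p q f = G.eBesovNorm s p q g := by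
  unfold eBesovNorm
  congr 1
  funext c
  have : G.IsRep s p q c f ↔ G.IsRep s p q c g :=
    ⟨fun h => IsRep.congr G h hfg, fun h => IsRep.congr G h hfg.symm⟩
  simp only [this]

lemma IsRep.add {s p : ℝ} (hp : 1 ≤ p) {q : ℝ≥0∞} (hq : 1 ≤ q) {c d : Coeff X} {f g : X → ℂ}
    (hf : G.IsRep s p q c f) (hg : G.IsRep s p q d g) : G.IsRep s p q (c + d) (f + g) := by
  have hp' : 1 ≤ ENNReal.ofReal p := by simpa using ENNReal.ofReal_le_ofReal hp
  have hm : ∀ (c : Coeff X) (n : ℕ),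
      Measurable fun x => ∑ k ∈ Finset.range n, G.layer s p c k x := fun c n =>
    Finset.measurable_sum _ fun k _ => G.measurable_layer s p c k
  refine ⟨⟨hf.1.1.add hg.1.1, ?_, ?_⟩, ?_⟩
  · refine lt_of_le_of_lt (ENNReal.tsum_le_tsum fun k => ?_)
      (lt_of_eq_of_lt ENNReal.tsum_add (ENNReal.add_lt_top.2 ⟨hf.1.2.1, hg.1.2.1⟩))
    rw [layer_add]
    exact eLpNorm_add_le (G.measurable_layer s p c k).aestronglyMeasurable
      (G.measurable_layer s p d k).aestronglyMeasurable hp'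
  · have hlim := hf.1.2.2.add hg.1.2.2
    rw [add_zero] at hlim
    refine tendsto_of_tendsto_of_tendsto_of_le_of_le tendsto_const_nhds hlim
      (fun _ => zero_le) fun n => ?_
    refine le_trans (le_of_eq ?_) (eLpNorm_add_le
      (hf.1.1.1.sub (hm c n).aestronglyMeasurable)
      (hg.1.1.1.sub (hm d n).aestronglyMeasurable) hp')
    congr 1
    funext x
    simp only [layer_add, Pi.add_apply, Finset.sum_add_distrib]
    ring
  · exact lt_of_le_of_lt (G.cost_add_le hp hq c d) (ENNReal.add_lt_top.2 ⟨hf.2, hg.2⟩)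

lemma IsRep.smul {s p : ℝ} (hp : 1 ≤ p) {q : ℝ≥0∞} (hq : 1 ≤ q) (a : ℂ) {c : Coeff X} {f : X → ℂ}
    (hf : G.IsRep s p q c f) : G.IsRep s p q (a • c) (a • f) := by
  refine ⟨⟨hf.1.1.const_smul a, ?_, ?_⟩, ?_⟩
  · simp_rw [layer_smul, eLpNorm_const_smul, ENNReal.tsum_mul_left]
    exact ENNReal.mul_lt_top enorm_lt_top hf.1.2.1
  · have hlim := ENNReal.Tendsto.const_mul (a := ‖a‖ₑ) hf.1.2.2 (Or.inr enorm_ne_top)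
    rw [mul_zero] at hlim
    refine hlim.congr fun n => ?_
    rw [← eLpNorm_const_smul]
    congr 1
    funext x
    simp only [layer_smul, Pi.smul_apply, smul_eq_mul, ← Finset.mul_sum]
    ring
  · rw [G.cost_smul hp hq]
    exact ENNReal.mul_lt_top enorm_lt_top hf.2

lemma IsRep.zero {s p : ℝ} (hp : 1 ≤ p) {q : ℝ≥0∞} (hq : 1 ≤ q) :
    G.IsRep s p q 0 (0 : X → ℂ) := by
  have hl : ∀ k, G.layer s p 0 k = 0 := fun k => by funext x; simp [layer]
  have hc : G.cost p q 0 = 0 := by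
    simpa using G.cost_smul hp hq 0 0
  refine ⟨⟨MemLp.zero, by simp [hl], ?_⟩, by simp [hc]⟩
  simp [hl]

lemma eBesovNorm_le {s p : ℝ} {q : ℝ≥0∞} {c : Coeff X} {f : X → ℂ} (h : G.IsRep s p q c f) :
    G.eBesovNorm s p q f ≤ G.cost p q c := iInf₂_le c h

lemma eBesovNorm_add_le {s p : ℝ} (hp : 1 ≤ p) {q : ℝ≥0∞} (hq : 1 ≤ q) (f g : X → ℂ) :
    G.eBesovNorm s p q (f + g) ≤ G.eBesovNorm s p q f + G.eBesovNorm s p q g := by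
  conv_rhs => unfold eBesovNorm
  simp only [ENNReal.iInf_add, ENNReal.add_iInf]
  refine le_iInf fun d => le_iInf fun hd => le_iInf fun c => le_iInf fun hc => ?_
  exact (G.eBesovNorm_le (IsRep.add G hp hq hc hd)).trans (G.cost_add_le hp hq c d)

lemma eBesovNorm_smul_le {s p : ℝ} (hp : 1 ≤ p) {q : ℝ≥0∞} (hq : 1 ≤ q) (a : ℂ) (f : X → ℂ)
    (hf : G.eBesovNorm s p q f ≠ ∞) :
    G.eBesovNorm s p q (a • f) ≤ ‖a‖ₑ * G.eBesovNorm s p q f := by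
  refine ENNReal.le_of_forall_pos_le_add fun ε hε _ => ?_
  by_cases ha : ‖a‖ₑ = 0
  · have ha' : a = 0 := by simpa using ha
    subst ha'
    have : G.eBesovNorm s p q ((0 : ℂ) • f) ≤ G.cost p q 0 := by
      rw [zero_smul]
      exact G.eBesovNorm_le (IsRep.zero G hp hq)
    refine this.trans ?_
    have hc : G.cost p q 0 = 0 := by simpa using G.cost_smul hp hq 0 0
    simp [hc]
  · have hε' : (0 : ℝ≥0∞) < ε / ‖a‖ₑ :=
      ENNReal.div_pos (by exact_mod_cast hε.ne') enorm_ne_top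
    have hlt : G.eBesovNorm s p q f < G.eBesovNorm s p q f + ε / ‖a‖ₑ :=
      ENNReal.lt_add_right hf hε'.ne'
    conv_lhs at hlt => unfold eBesovNorm
    simp only [iInf_lt_iff] at hlt
    obtain ⟨c, hc, hlt⟩ := hlt
    calc G.eBesovNorm s p q (a • f) ≤ G.cost p q (a • c) :=
          G.eBesovNorm_le (IsRep.smul G hp hq a hc)
      _ = ‖a‖ₑ * G.cost p q c := G.cost_smul hp hq a c
      _ ≤ ‖a‖ₑ * (G.eBesovNorm s p q f + ε / ‖a‖ₑ) := by gcongr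
      _ = _ := by rw [mul_add, ENNReal.mul_div_cancel ha enorm_ne_top]

end Grid

namespace GoodGrid

variable {X : Type*} [MeasurableSpace X] {m : Measure X} (P : GoodGrid m)

lemma real_le [IsProbabilityMeasure m] (k : ℕ) : ∀ Q ∈ P.level k, m.real Q ≤ P.lam₂ ^ k := by
  induction k with
  | zero => intro Q _; simpa using measureReal_le_one
  | succ k ih =>
    intro Q hQ
    obtain ⟨R, hR, hQR⟩ := P.nested k Q hQ
    have h := (P.ratio k Q hQ R hR hQR).2
    have hR0 : 0 < m.real R := ENNReal.toReal_pos (P.pos k R hR).ne' (measure_ne_top _ _)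
    rw [div_le_iff₀ hR0] at h
    have h2 : 0 ≤ P.lam₂ := (P.lam₁_pos.trans P.lam₁_lt_lam₂).le
    calc m.real Q ≤ P.lam₂ * m.real R := h
      _ ≤ P.lam₂ * P.lam₂ ^ k := by gcongr; exact ih R hR
      _ = _ := by ring

lemma eLpNorm_layer_le [IsProbabilityMeasure m] {s p : ℝ} (hs : 0 < s) (hp : 1 ≤ p) (c : Coeff X)
    (k : ℕ) : eLpNorm (P.layer s p c k) (ENNReal.ofReal p) m ≤
      ENNReal.ofReal ((P.lam₂ ^ k) ^ s) * P.levelNorm p c k := by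
  have h0 : 0 < p := by linarith
  have hp0 : ENNReal.ofReal p ≠ 0 := by simpa using h0
  have hpt : (ENNReal.ofReal p).toReal = p := ENNReal.toReal_ofReal h0.le
  have h2 : 0 < P.lam₂ := P.lam₁_pos.trans P.lam₁_lt_lam₂
  rw [eLpNorm_eq_lintegral_rpow_enorm_toReal hp0 ENNReal.ofReal_ne_top, hpt]
  have hpt : ∀ x, ‖P.layer s p c k x‖ₑ ^ p ≤
      ∑ Q ∈ P.level k, Q.indicator
        (fun _ => ‖c k Q‖ₑ ^ p * ENNReal.ofReal (m.real Q ^ (s - 1 / p)) ^ p) x := by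
    intro x
    by_cases hx : ∃ Q ∈ P.level k, x ∈ Q
    · obtain ⟨Q, hQ, hxQ⟩ := hx
      have hother : ∀ R ∈ P.level k, R ≠ Q → x ∉ R := fun R hR hne hxR =>
        (Set.disjoint_left.1 (P.disjoint k R hR Q hQ hne)) hxR hxQ
      have : P.layer s p c k x = c k Q * ((m.real Q ^ (s - 1 / p) : ℝ) : ℂ) := by
        unfold Grid.layer Grid.atom
        rw [Finset.sum_eq_single_of_mem Q hQ]
        · simp [hxQ]
        · intro R hR hne
          simp [hother R hR hne]
      rw [this, enorm_mul, ENNReal.mul_rpow_of_nonneg _ _ h0.le]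
      refine le_trans (le_of_eq ?_) (Finset.single_le_sum (fun _ _ => zero_le) hQ)
      rw [Set.indicator_of_mem hxQ]
      congr 2
      rw [← ofReal_norm, Complex.norm_real, Real.norm_of_nonneg]
      positivity
    · push Not at hx
      have : P.layer s p c k x = 0 := by
        unfold Grid.layer Grid.atom
        exact Finset.sum_eq_zero fun Q hQ => by simp [hx Q hQ]
      rw [this]
      simp [h0]
  calc (∫⁻ x, ‖P.layer s p c k x‖ₑ ^ p ∂m) ^ (1 / p)
      ≤ (∑ Q ∈ P.level k, ‖c k Q‖ₑ ^ p * ENNReal.ofReal ((P.lam₂ ^ k) ^ s) ^ p) ^ (1 / p) := by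
        refine ENNReal.rpow_le_rpow ?_ (by positivity)
        refine (lintegral_mono hpt).trans ?_
        rw [lintegral_finsetSum _ fun Q hQ => measurable_const.indicator (P.measurableSet k Q hQ)]
        refine Finset.sum_le_sum fun Q hQ => ?_
        rw [lintegral_indicator_const (P.measurableSet k Q hQ), mul_assoc]
        gcongr
        have hQ0 : 0 < m.real Q := ENNReal.toReal_pos (P.pos k Q hQ).ne' (measure_ne_top _ _)
        have hmQ : m Q = ENNReal.ofReal (m.real Q) := by
          rw [Measure.real, ENNReal.ofReal_toReal (measure_ne_top _ _)]
        rw [hmQ, ENNReal.ofReal_rpow_of_nonneg (by positivity) h0.le,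
          ← ENNReal.ofReal_mul (by positivity),
          ENNReal.ofReal_rpow_of_nonneg (Real.rpow_nonneg (pow_nonneg h2.le _) _) h0.le]
        refine ENNReal.ofReal_le_ofReal ?_
        have e : (m.real Q ^ (s - 1 / p)) ^ p * m.real Q = (m.real Q ^ s) ^ p := by
          rw [← Real.rpow_mul hQ0.le, ← Real.rpow_mul hQ0.le, ← Real.rpow_add_one hQ0.ne']
          congr 1
          field_simp
          ring
        rw [e]
        gcongr
        exact P.real_le k Q hQ
    _ = _ := by
        rw [← Finset.sum_mul, ENNReal.mul_rpow_of_nonneg _ _ (by positivity), ← ENNReal.rpow_mul,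
          mul_one_div_cancel h0.ne', ENNReal.rpow_one, mul_comm]
        rfl

/-- The embedding of `B^s_{p,q}` into `L^p` is continuous. -/
lemma exists_eLpNorm_le [IsProbabilityMeasure m] {s p : ℝ} (hs : 0 < s) (hp : 1 ≤ p) {q : ℝ≥0∞}
    (hq : 1 ≤ q) : ∃ K : ℝ≥0∞, K ≠ ∞ ∧ ∀ (f : X → ℂ) (c : Coeff X), P.IsRep s p q c f →
      eLpNorm f (ENNReal.ofReal p) m ≤ K * P.cost p q c := by
  have h2 : 0 < P.lam₂ := P.lam₁_pos.trans P.lam₁_lt_lam₂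
  have hp' : 1 ≤ ENNReal.ofReal p := by simpa using ENNReal.ofReal_le_ofReal hp
  set K : ℝ≥0∞ := ∑' k : ℕ, ENNReal.ofReal ((P.lam₂ ^ k) ^ s) with hK
  have hKtop : K ≠ ∞ := by
    have hs' : Summable fun k : ℕ => (P.lam₂ ^ k) ^ s := by
      have : ∀ k : ℕ, (P.lam₂ ^ k) ^ s = (P.lam₂ ^ s) ^ k := fun k => by
        rw [← Real.rpow_natCast, ← Real.rpow_natCast, ← Real.rpow_mul h2.le,
          ← Real.rpow_mul h2.le, mul_comm]
      simp_rw [this]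
      exact summable_geometric_of_lt_one (by positivity)
        (Real.rpow_lt_one h2.le P.lam₂_lt_one hs)
    exact hs'.tsum_ofReal_ne_top
  refine ⟨K, hKtop, fun f c hc => ?_⟩
  have hbd : ∀ n : ℕ, eLpNorm (fun x => ∑ k ∈ Finset.range n, P.layer s p c k x)
      (ENNReal.ofReal p) m ≤ K * P.cost p q c := by
    intro n
    have e : (fun x => ∑ k ∈ Finset.range n, P.layer s p c k x)
        = ∑ k ∈ Finset.range n, P.layer s p c k := by
      funext x; simp
    rw [e]
    refine (eLpNorm_sum_le (fun k _ => (P.measurable_layer s p c k).aestronglyMeasurable)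
      hp').trans ?_
    calc ∑ k ∈ Finset.range n, eLpNorm (P.layer s p c k) (ENNReal.ofReal p) m
        ≤ ∑ k ∈ Finset.range n, ENNReal.ofReal ((P.lam₂ ^ k) ^ s) * P.cost p q c := by
          refine Finset.sum_le_sum fun k _ => (P.eLpNorm_layer_le hs hp c k).trans ?_
          gcongr
          exact le_ellNorm hq _ k
      _ = (∑ k ∈ Finset.range n, ENNReal.ofReal ((P.lam₂ ^ k) ^ s)) * P.cost p q c := by
          rw [Finset.sum_mul]
      _ ≤ _ := by gcongr; exact ENNReal.sum_le_tsum _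
  have hm : ∀ n : ℕ, Measurable fun x => ∑ k ∈ Finset.range n, P.layer s p c k x := fun n =>
    Finset.measurable_sum _ fun k _ => P.measurable_layer s p c k
  have hle : ∀ n : ℕ, eLpNorm f (ENNReal.ofReal p) m ≤
      eLpNorm (fun x => f x - ∑ k ∈ Finset.range n, P.layer s p c k x) (ENNReal.ofReal p) m
        + K * P.cost p q c := by
    intro n
    refine le_trans (le_of_eq ?_) ((eLpNorm_add_le
      (f := fun x => f x - ∑ k ∈ Finset.range n, P.layer s p c k x)
      (g := fun x => ∑ k ∈ Finset.range n, P.layer s p c k x)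
      (hc.1.1.1.sub (hm n).aestronglyMeasurable)
      (hm n).aestronglyMeasurable hp').trans (add_le_add le_rfl (hbd n)))
    congr 1
    funext x
    simp
  have hlim := hc.1.2.2.add_const (K * P.cost p q c)
  rw [zero_add] at hlim
  exact ge_of_tendsto' hlim hle

lemma eLpNorm_eq_zero_of_eBesovNorm [IsProbabilityMeasure m] {s p : ℝ} (hs : 0 < s) (hp : 1 ≤ p)
    {q : ℝ≥0∞} (hq : 1 ≤ q) (f : X → ℂ) (hf : P.eBesovNorm s p q f = 0) :
    eLpNorm f (ENNReal.ofReal p) m = 0 := by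
  obtain ⟨K, hK, h⟩ := P.exists_eLpNorm_le hs hp hq
  rw [← nonpos_iff_eq_zero]
  have hlim : Tendsto (fun ε : ℝ≥0∞ => K * ε) (𝓝[>] 0) (𝓝 0) := by
    have := ENNReal.Tendsto.const_mul (a := K) (tendsto_id (α := ℝ≥0∞) (x := 𝓝 0)) (Or.inr hK)
    simpa using this.mono_left nhdsWithin_le_nhds
  refine ge_of_tendsto hlim ?_
  filter_upwards [self_mem_nhdsWithin] with ε hε
  have hlt : P.eBesovNorm s p q f < ε := hf ▸ hε
  unfold Grid.eBesovNorm at hlt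
  simp only [iInf_lt_iff] at hlt
  obtain ⟨c, hc, hlt⟩ := hlt
  exact (h f c hc).trans (by gcongr)

end GoodGrid

end Helpers

/-- The exponents of a space `B^s_{p,q}`. -/
structure BesovIndex where
  s : ℝ
  p : ℝ
  q : ℝ≥0∞
  s_pos : 0 < s
  one_le_p : 1 ≤ p
  one_le_q : 1 ≤ q

variable {X : Type*} [MeasurableSpace X] {m : Measure X}

/-- The functions of `L^p` that have a `B^s_{p,q}`-representation, as a subspace of `L^p`. -/
def besovSubmodule (P : GoodGrid m) (e : BesovIndex) :
    Submodule ℂ (Lp ℂ (ENNReal.ofReal e.p) m) where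
  carrier := {f | ∃ c, P.IsRep e.s e.p e.q c f}
  zero_mem' := ⟨0, Grid.IsRep.congr _ (Grid.IsRep.zero _ e.one_le_p e.one_le_q)
    (Lp.coeFn_zero _ _ _).symm⟩
  add_mem' := by
    rintro f g ⟨c, hc⟩ ⟨d, hd⟩
    exact ⟨c + d, Grid.IsRep.congr _ (Grid.IsRep.add _ e.one_le_p e.one_le_q hc hd)
      (Lp.coeFn_add f g).symm⟩
  smul_mem' := by
    rintro a f ⟨c, hc⟩
    exact ⟨a • c, Grid.IsRep.congr _ (Grid.IsRep.smul _ e.one_le_p e.one_le_q a hc)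
      (Lp.coeFn_smul a f).symm⟩

/-- The space `B^s_{p,q}`; its elements are classes of functions modulo almost everywhere
equality, and it carries the norm `|·|_{B^s_{p,q}}` (not the one of `L^p`). -/
def BesovSpace (P : GoodGrid m) (e : BesovIndex) : Type _ := ↥(besovSubmodule P e)

namespace BesovSpace

variable {P : GoodGrid m} {e : BesovIndex}

instance : AddCommGroup (BesovSpace P e) := inferInstanceAs (AddCommGroup ↥(besovSubmodule P e))

instance : Module ℂ (BesovSpace P e) := inferInstanceAs (Module ℂ ↥(besovSubmodule P e))

/-- The underlying element of `L^p`. -/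
def toLp (f : BesovSpace P e) : Lp ℂ (ENNReal.ofReal e.p) m := Subtype.val f

/-- A representative of the class of functions `f`. -/
instance : CoeFun (BesovSpace P e) (fun _ => X → ℂ) := ⟨fun f => (f.toLp : X → ℂ)⟩

instance : Norm (BesovSpace P e) := ⟨fun f => (P.eBesovNorm e.s e.p e.q f).toReal⟩

lemma norm_def (f : BesovSpace P e) : ‖f‖ = (P.eBesovNorm e.s e.p e.q f).toReal := rfl

lemma eBesovNorm_ne_top (f : BesovSpace P e) : P.eBesovNorm e.s e.p e.q f ≠ ∞ := by
  obtain ⟨c, hc⟩ : ∃ c, P.IsRep e.s e.p e.q c f := Subtype.property f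
  exact ((P.eBesovNorm_le hc).trans_lt hc.2).ne

lemma coeFn_add (f g : BesovSpace P e) : ⇑(f + g) =ᵐ[m] ⇑f + ⇑g := Lp.coeFn_add f.toLp g.toLp

lemma coeFn_smul (a : ℂ) (f : BesovSpace P e) : ⇑(a • f) =ᵐ[m] a • ⇑f := Lp.coeFn_smul a f.toLp

lemma norm_smul_le' (a : ℂ) (f : BesovSpace P e) : ‖a • f‖ ≤ ‖a‖ * ‖f‖ := by
  rw [norm_def, norm_def, P.eBesovNorm_congr (coeFn_smul a f)]
  refine (ENNReal.toReal_mono (ENNReal.mul_ne_top enorm_ne_top f.eBesovNorm_ne_top)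
    (P.eBesovNorm_smul_le e.one_le_p e.one_le_q a f f.eBesovNorm_ne_top)).trans ?_
  simp [ENNReal.toReal_mul]

lemma core [IsProbabilityMeasure m] : NormedSpace.Core ℂ (BesovSpace P e) where
  norm_nonneg f := ENNReal.toReal_nonneg
  norm_smul a f := by
    refine le_antisymm (norm_smul_le' a f) ?_
    by_cases ha : a = 0
    · subst ha
      rw [norm_zero, zero_mul]
      exact ENNReal.toReal_nonneg
    · have h := norm_smul_le' a⁻¹ (a • f)
      rw [inv_smul_smul₀ ha, norm_inv] at h
      have ha' : 0 < ‖a‖ := norm_pos_iff.2 ha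
      calc ‖a‖ * ‖f‖ ≤ ‖a‖ * (‖a‖⁻¹ * ‖a • f‖) := by gcongr
        _ = ‖a • f‖ := by field_simp
  norm_triangle f g := by
    rw [norm_def, norm_def, norm_def, P.eBesovNorm_congr (coeFn_add f g),
      ← ENNReal.toReal_add f.eBesovNorm_ne_top g.eBesovNorm_ne_top]
    exact ENNReal.toReal_mono (ENNReal.add_ne_top.2 ⟨f.eBesovNorm_ne_top, g.eBesovNorm_ne_top⟩)
      (P.eBesovNorm_add_le e.one_le_p e.one_le_q f g)
  norm_eq_zero_iff f := by
    constructor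
    · intro h
      rw [norm_def, ENNReal.toReal_eq_zero_iff, or_iff_left f.eBesovNorm_ne_top] at h
      have h0 := P.eLpNorm_eq_zero_of_eBesovNorm e.s_pos e.one_le_p e.one_le_q f h
      have hp0 : ENNReal.ofReal e.p ≠ 0 := by
        have := e.one_le_p
        simp only [ne_eq, ENNReal.ofReal_eq_zero, not_le]
        linarith
      rw [eLpNorm_eq_zero_iff (Lp.aestronglyMeasurable f.toLp) hp0] at h0
      exact Subtype.ext (Lp.eq_zero_iff_ae_eq_zero.2 h0)
    · rintro rfl
      have := norm_smul_le' (0 : ℂ) (0 : BesovSpace P e)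
      rw [zero_smul, norm_zero, zero_mul] at this
      exact le_antisymm this ENNReal.toReal_nonneg

instance [IsProbabilityMeasure m] : NormedAddCommGroup (BesovSpace P e) :=
  NormedAddCommGroup.ofCore core

instance [IsProbabilityMeasure m] : NormedSpace ℂ (BesovSpace P e) := NormedSpace.ofCore core

end BesovSpace

/-! ## Regular domains, branches and potentials -/

variable {I J : Type*} [MeasurableSpace I] [MeasurableSpace J] {m : Measure I} {μ : Measure J}

/-- `Ω` is an `(α, C, lam)`-regular domain of `(J, H)`. -/
def IsRegularDomain (H : GoodGrid μ) (α C lam : ℝ) (Ω : Set J) : Prop :=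
  ∃ F : ℕ → Finset (Set J),
    (∀ k ≥ H.k₀ Ω, F k ⊆ H.level k) ∧
    Ω = ⋃ k ≥ H.k₀ Ω, ⋃ Q ∈ F k, Q ∧
    (∀ k ≥ H.k₀ Ω, ∀ l ≥ H.k₀ Ω, ∀ Q ∈ F k, ∀ R ∈ F l, Q ≠ R → Disjoint Q R) ∧
    ∀ k ≥ H.k₀ Ω, ∑ Q ∈ F k, μ.real Q ^ α ≤ C * lam ^ (k - H.k₀ Ω) * μ.real Ω ^ α

/-- `h⁻¹(Q)`, for a map `h : dom → ran` between subsets of `J` and `I`. -/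
def pullback {dom : Set J} {ran : Set I} (h : dom ≃ᵐ ran) (Q : Set I) : Set J :=
  {x | ∃ hx : x ∈ dom, (h ⟨x, hx⟩ : I) ∈ Q}

/-- An `(s, p, a, ε, cGD, lamGD, cC, lamC, G)`-branch `h : dom → ran`, with `dom ⊆ J` and
`ran ⊆ I`. The sets of each level of the local grid `G` on `ran` are pairwise disjoint, and
`k₀(Q, G) = k` for every set `Q` of level `k`. -/
structure Branch (P : GoodGrid m) (H : GoodGrid μ) (s p : ℝ) where
  dom : Set J
  ran : Set I
  measurableSet_dom : MeasurableSet dom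
  measurableSet_ran : MeasurableSet ran
  G : Grid m
  G_subset : ∀ k, ∀ Q ∈ G.level k, Q ⊆ ran
  G_disjoint : ∀ k, ∀ Q ∈ G.level k, ∀ R ∈ G.level k, Q ≠ R → Disjoint Q R
  G_k₀ : ∀ k, ∀ Q ∈ G.level k, G.k₀ Q = k
  h : dom ≃ᵐ ran
  a : ℝ
  ε : ℝ
  cGD : ℝ
  lamGD : ℝ
  cC : ℝ
  lamC : ℝ
  a_nonneg : 0 ≤ a
  cGD_pos : 0 < cGD
  lamGD_pos : 0 < lamGD
  lamGD_lt_one : lamGD < 1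
  cC_pos : 0 < cC
  lamC_pos : 0 < lamC
  lamC_lt_one : lamC < 1
  null_iff : ∀ Q, MeasurableSet Q → Q ⊆ ran →
    (m Q = 0 ↔ μ (pullback h Q) = 0)
  geometric_distortion : ∀ k, ∀ Q ∈ G.level k,
    IsRegularDomain H (1 - s * p) cGD lamGD (pullback h Q)
  scaling : ∀ k, ∀ Q ∈ G.level k,
    a ≤ |(G.k₀ Q : ℝ) - H.k₀ (pullback h Q)|
  scaling_ratio : ∀ k, ∀ Q ∈ G.level k,
    (m.real Q / μ.real (pullback h Q)) ^ (ε / |ε|) ≤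
      cC * lamC ^ |(G.k₀ Q : ℝ) - H.k₀ (pullback h Q)|
  ran_eq : ∃ 𝒞 : Set (Set I), 𝒞.Countable ∧ (∀ Q ∈ 𝒞, ∃ k, Q ∈ P.level k) ∧ ran =ᵐ[m] ⋃₀ 𝒞
  preimage_eq : ∀ k, ∀ W ∈ G.level k, ∃ 𝒞 : Set (Set J), 𝒞.Countable ∧
    (∀ Q ∈ 𝒞, ∃ j, Q ∈ H.level j) ∧
      pullback h W =ᵐ[μ] ⋃₀ 𝒞

namespace Branch

variable {P : GoodGrid m} {H : GoodGrid μ} {s p : ℝ}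

/-- `h⁻¹(Q)`. -/
def pre (B : Branch P H s p) (Q : Set I) : Set J := pullback B.h Q

open Classical in
/-- The function `g · f ∘ h` on the domain of the branch, extended by zero. -/
def apply (B : Branch P H s p) (g : J → ℂ) (f : I → ℂ) : J → ℂ :=
  fun x => if hx : x ∈ B.dom then g x * f (B.h ⟨x, hx⟩) else 0

/-- `g` is a `(c, β, ε)`-regular potential associated with the branch. Only the values of `g` on
the domain of the branch matter. -/
def IsRegularPotential (B : Branch P H s p) (β : ℝ) (q : ℝ≥0∞) (c : ℝ) (g : J → ℂ) : Prop :=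
  ∀ k, ∀ W ∈ H.level k, W ⊆ B.dom → ∀ j, ∀ Q ∈ B.G.level j, W ⊆ B.pre Q →
    H.eBesovNormOn β p q W (W.indicator g) ≤
      ENNReal.ofReal (c * (m.real Q / μ.real (B.pre Q)) ^ (1 / p - s + B.ε) *
        μ.real W ^ (1 / p - β))

end Branch

/-! ## Transfer transformations -/

/-- The data that define a transfer transformation `Φ f = ∑_{r ∈ Λ} g_r · f ∘ h_r`, together with
the exponents and the constants that measure its regularity. -/
structure TransferSystem (P : GoodGrid m) (H : GoodGrid μ) (e : BesovIndex) where
  β : ℝ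
  δ : ℝ
  ε : ℝ
  γ : ℝ
  Λ : Set ℕ
  branch : Λ → Branch P H e.s e.p
  g : Λ → J → ℂ
  cR : Λ → ℝ

namespace TransferSystem

variable {P : GoodGrid m} {H : GoodGrid μ} {e : BesovIndex} (S : TransferSystem P H e)

/-- `Φ_r f = g_r · f ∘ h_r`, extended by zero. -/
def part (r : S.Λ) (f : I → ℂ) : J → ℂ := (S.branch r).apply (S.g r) f

/-- The transfer transformation `Φ f = ∑_r Φ_r f`. -/
def transfer (f : I → ℂ) : J → ℂ := fun x => ∑' r, S.part r f x

/-- The contraction constant `max {lamC_r^ε, lamGD_r^{1/p}}` of the `r`-th branch. -/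
def lam (r : S.Λ) : ℝ := max ((S.branch r).lamC ^ S.ε) ((S.branch r).lamGD ^ (1 / e.p))

/-- The number `Θ_r` that measures the regularity of the `r`-th branch and potential. -/
def Θ (r : S.Λ) : ℝ :=
  (S.branch r).cC ^ S.ε * S.cR r * (S.branch r).cGD ^ (1 / e.p) *
    S.lam r ^ ((S.branch r).a * (1 - S.γ))

/-- `t₀ = p / (1 - sp + δp)`. -/
def t₀ : ℝ := e.p / (1 - e.s * e.p + S.δ * e.p)

/-- `N = sup_{Q ∈ H} #{r : Q ⊆ J_r}`. -/
def N : ℝ≥0∞ := ⨆ (k : ℕ) (Q ∈ H.level k), ({r | Q ⊆ (S.branch r).dom}.encard : ℝ≥0∞)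

/-- `D = 2 / (1 - (sup_r lam_r)^γ)`, which is `∞` if `γ = 0`. -/
def D : ℝ≥0∞ := 2 / (1 - ENNReal.ofReal ((⨆ r, S.lam r) ^ S.γ))

/-- The standing assumptions on the exponents. -/
structure ExponentsOK : Prop where
  ε_pos : 0 < S.ε
  γ_mem : S.γ ∈ Set.Icc (0 : ℝ) 1
  δ_pos : 0 < S.δ
  s_add_ε_le : e.s + S.ε ≤ 1 / e.p
  s_lt_β : e.s < S.β
  β_lt : S.β < 1 / e.p
  δ_lt : S.δ < max e.s S.ε

/-- The standing assumptions on the branches and the potentials. -/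
structure FamilyOK : Prop where
  abs_ε : ∀ r, |(S.branch r).ε| = S.ε
  generates : MeasurableSpace.generateFrom
    ({Q | ∃ r k, Q ∈ (S.branch r).G.level k} ∪
      {Q | (∃ k, Q ∈ P.level k) ∧ ∀ r, Q ∩ (S.branch r).ran = ∅}) = ‹MeasurableSpace I›
  cR_pos : ∀ r, 0 < S.cR r
  aestronglyMeasurable : ∀ r, AEStronglyMeasurable (S.g r) (μ.restrict (S.branch r).dom)
  regular : ∀ r, (S.branch r).IsRegularPotential S.β e.q (S.cR r) (S.g r)
  lam_lt_one : ∀ r, S.lam r < 1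
  iSup_lam_lt_one : ⨆ r, S.lam r < 1

/-- The series that defines `Φ` converges absolutely, and `Φ : L^{t₀} → L^1` is bounded. -/
def BoundedToL1 : Prop :=
  ∃ C : ℝ≥0, ∀ f : I → ℂ, MemLp f (ENNReal.ofReal S.t₀) m →
    eLpNorm (S.transfer f) 1 μ ≤ ∑' r, eLpNorm (S.part r f) 1 μ ∧
    ∑' r, eLpNorm (S.part r f) 1 μ ≤ C * eLpNorm f (ENNReal.ofReal S.t₀) m

/-- `(𝓘, ∑_Q d_Q a_Q)` has a `C`-regular slicing. -/
def HasRegularSlicing (C : ℝ≥0) (d : Coeff I) : Prop :=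
  ∃ f : I → ℂ, P.IsRep e.s e.p e.q d f ∧ ∃ c : S.Λ → Coeff I,
    (∀ r, (S.branch r).G.IsRep e.s e.p e.q (c r) ((S.branch r).ran.indicator f)) ∧
    (ellNorm e.q (fun j => ∑' r, ENNReal.ofReal (S.Θ r) *
        (∑ Q ∈ (S.branch r).G.level j, ‖c r j Q‖ₑ ^ e.p) ^ (1 / e.p)) ≤ C * P.cost e.p e.q d ∨
      S.N ^ (1 - 1 / e.p) * ellNorm e.q (fun j => (∑' r, ENNReal.ofReal (S.Θ r) ^ e.p *
        ∑ Q ∈ (S.branch r).G.level j, ‖c r j Q‖ₑ ^ e.p) ^ (1 / e.p)) ≤ C * P.cost e.p e.q d) ∧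
    ((∀ k, ∀ Q ∈ P.level k, 0 ≤ (d k Q).re ∧ (d k Q).im = 0) →
      ∀ r k, ∀ Q ∈ (S.branch r).G.level k, 0 ≤ (c r k Q).re ∧ (c r k Q).im = 0)

/-- `(B^s_{p,q}, 𝓘)` has a `(CFR, CES)`-essential slicing. -/
def HasEssentialSlicing (CFR CES : ℝ≥0) : Prop :=
  ∃ P' : Finset (Set I), (∀ Q ∈ P', ∃ k, Q ∈ P.level k) ∧
    ∀ (d : Coeff I) (f : I → ℂ), P.IsRep e.s e.p e.q d f →
      S.HasRegularSlicing CES (fun k => ((P' : Set (Set I))ᶜ).indicator (d k)) ∧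
      S.HasRegularSlicing CFR (fun k => (P' : Set (Set I)).indicator (d k))

end TransferSystem

end BesovGrid

end

open BesovGrid

noncomputable section

set_option linter.unusedSectionVars false

/-! ## Quasi-compact operators -/

namespace QuasiCompact

open Module.End

variable {X : Type*} [NormedAddCommGroup X] [NormedSpace ℂ X]

/-- `A` is the sum of an operator of norm at most `r` and a compact operator. -/
def IsQuasiCompact (r : ℝ) (A : X →L[ℂ] X) : Prop :=
  ∃ K F : X →L[ℂ] X, ‖K‖ ≤ r ∧ IsCompactOperator F ∧ A = K + F

lemma IsQuasiCompact.add_compact {r : ℝ} {A B : X →L[ℂ] X} (hA : IsQuasiCompact r A)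
    (hB : IsCompactOperator B) : IsQuasiCompact r (A + B) := by
  obtain ⟨K, F, hK, hF, rfl⟩ := hA
  exact ⟨K, F + B, hK, hF.add hB, add_assoc _ _ _⟩

lemma isCompactOperator_of_mapsTo_finiteDimensional {F : X →L[ℂ] X} (V : Submodule ℂ X)
    [FiniteDimensional ℂ V] (hV : ∀ x, F x ∈ V) : IsCompactOperator F := by
  have h1 : IsCompactOperator (F.codRestrict V hV) := by
    have : ProperSpace V := FiniteDimensional.proper ℂ V
    exact isCompactOperator_of_locallyCompactSpace_dom (F.codRestrict V hV)
  exact h1.clm_comp V.subtypeL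

lemma hasEigenvalue_iff {A : X →L[ℂ] X} {z : ℂ} :
    HasEigenvalue (A : Module.End ℂ X) z ↔ ∃ f ≠ 0, A f = z • f := by
  constructor
  · intro h
    obtain ⟨f, hf⟩ := h.exists_hasEigenvector
    exact ⟨f, hf.2, hf.apply_eq_smul⟩
  · rintro ⟨f, hf, h⟩
    exact hasEigenvalue_of_hasEigenvector ⟨mem_eigenspace_iff.2 h, hf⟩

lemma pow_apply_of_eigen {A : X →L[ℂ] X} {z : ℂ} {f : X} (h : A f = z • f) (n : ℕ) :
    (A ^ n) f = z ^ n • f := by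
  induction n with
  | zero => simp
  | succ n ih => rw [pow_succ', mul_apply_eq_comp, ih, map_smul, h, smul_smul, pow_succ]

lemma norm_le_one_of_eigen {A : X →L[ℂ] X} {M : ℝ} (hM : ∀ n, ‖A ^ n‖ ≤ M) {z : ℂ}
    {f : X} (hf0 : f ≠ 0) (hf : A f = z • f) : ‖z‖ ≤ 1 := by
  by_contra! h
  have hfp : 0 < ‖f‖ := norm_pos_iff.2 hf0
  obtain ⟨n, hn⟩ := pow_unbounded_of_one_lt M h
  have h1 := (A ^ n).le_of_opNorm_le (hM n) f
  rw [pow_apply_of_eigen hf, norm_smul, norm_pow] at h1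
  exact absurd (le_of_mul_le_mul_right h1 hfp) (not_le.2 hn)

lemma eq_zero_of_pow_bounded {A : X →L[ℂ] X} {M : ℝ} (hM : ∀ n, ‖A ^ n‖ ≤ M) {z : ℂ}
    (hz : ‖z‖ = 1) {f g : X} (hf : A f = z • f + g) (hg : A g = z • g) : g = 0 := by
  have hz0 : z ≠ 0 := by rintro rfl; simp at hz
  have key : ∀ n : ℕ, (A ^ n) f = z ^ n • f + (n * z ^ (n - 1)) • g := by
    intro n
    induction n with
    | zero => simp
    | succ n ih =>
      rw [pow_succ', mul_apply_eq_comp, ih, map_add, map_smul, map_smul, hf, hg]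
      have : (n : ℂ) * z ^ (n - 1) * z = n * z ^ n := by
        rcases n with _ | n
        · simp
        · simp [pow_succ]; ring
      rw [smul_add, smul_smul, smul_smul, this, add_assoc, ← add_smul, pow_succ]
      congr 2
      push_cast
      ring
  have hb : ∀ n : ℕ, n * ‖g‖ ≤ (M + 1) * ‖f‖ := by
    intro n
    have h1 : (n * z ^ (n - 1)) • g = (A ^ n) f - z ^ n • f := by rw [key]; abel
    have h2 : ‖(n * z ^ (n - 1) : ℂ) • g‖ = n * ‖g‖ := by
      rw [norm_smul, norm_mul, norm_pow, hz]; simp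
    rw [← h2, h1]
    refine (norm_sub_le _ _).trans ?_
    rw [norm_smul, norm_pow, hz, one_pow, add_mul]
    gcongr
    exact (A ^ n).le_of_opNorm_le (hM n) f
  by_contra hg0
  have hgp : 0 < ‖g‖ := norm_pos_iff.2 hg0
  obtain ⟨n, hn⟩ := exists_nat_gt ((M + 1) * ‖f‖ / ‖g‖)
  rw [div_lt_iff₀ hgp] at hn
  linarith [hb n]

variable [CompleteSpace X]

lemma IsQuasiCompact.exists_factor {r : ℝ} {A : X →L[ℂ] X} (hA : IsQuasiCompact r A) {z : ℂ}
    (hz : r < ‖z‖) : ∃ U T : X →L[ℂ] X, IsUnit U ∧ IsCompactOperator T ∧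
      z • 1 - A = U * (1 - T) := by
  obtain ⟨K, F, hK, hF, rfl⟩ := hA
  have hU : IsUnit (algebraMap ℂ (X →L[ℂ] X) z - K) := by
    refine spectrum.mem_resolventSet_of_norm_lt_mul ?_
    calc ‖K‖ * ‖(1 : X →L[ℂ] X)‖ ≤ ‖K‖ * 1 := by
          gcongr; exact ContinuousLinearMap.norm_id_le
      _ < ‖z‖ := by linarith
  obtain ⟨u, hu⟩ := hU
  refine ⟨u, ↑u⁻¹ * F, u.isUnit, hF.clm_comp _, ?_⟩
  rw [mul_sub, mul_one, ← mul_assoc, Units.mul_inv, one_mul, hu, Algebra.algebraMap_eq_smul_one]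
  abel

lemma IsQuasiCompact.isUnit_sub {r : ℝ} {A : X →L[ℂ] X} (hA : IsQuasiCompact r A) {z : ℂ}
    (hz : r < ‖z‖) (hinj : ∀ f, A f = z • f → f = 0) : IsUnit (z • 1 - A) := by
  obtain ⟨U, T, hU, hT, h⟩ := hA.exists_factor hz
  rw [h]
  refine hU.mul ?_
  rcases hT.hasEigenvalue_or_mem_resolventSet one_ne_zero with h1 | h1
  · obtain ⟨f, hf0, hf⟩ := hasEigenvalue_iff.1 h1
    refine absurd (hinj f ?_) hf0
    have h2 : (z • 1 - A) f = 0 := by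
      rw [h, mul_apply_eq_comp]
      simp [hf]
    exact (sub_eq_zero.1 (by simpa using h2)).symm
  · simpa [spectrum.mem_resolventSet_iff] using h1

lemma IsQuasiCompact.hasEigenvalue {r : ℝ} {A : X →L[ℂ] X} (hA : IsQuasiCompact r A) {z : ℂ}
    (hz : r < ‖z‖) (hmem : z ∈ spectrum ℂ A) : HasEigenvalue (A : Module.End ℂ X) z := by
  by_contra hne
  rw [hasEigenvalue_iff] at hne
  push Not at hne
  refine (spectrum.mem_iff.1 hmem) ?_
  rw [Algebra.algebraMap_eq_smul_one]
  exact hA.isUnit_sub hz fun f hf => by_contra fun h0 => hne f h0 hf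

lemma mem_spectrum_of_eigen {A : X →L[ℂ] X} {z : ℂ} {f : X} (hf : f ≠ 0) (h : A f = z • f) :
    z ∈ spectrum ℂ A := by
  rw [ContinuousLinearMap.spectrum_eq]
  exact (hasEigenvalue_iff.2 ⟨f, hf, h⟩).mem_spectrum

lemma IsQuasiCompact.finiteDimensional_eigenspace {r : ℝ} {A : X →L[ℂ] X}
    (hA : IsQuasiCompact r A) {z : ℂ} (hz : r < ‖z‖) :
    FiniteDimensional ℂ (eigenspace (A : Module.End ℂ X) z) := by
  obtain ⟨U, T, hU, hT, h⟩ := hA.exists_factor hz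
  set V := eigenspace (A : Module.End ℂ X) z
  have hfix : ∀ f ∈ V, T f = f := by
    intro f hf
    have hf' : A f = z • f := mem_eigenspace_iff.1 hf
    obtain ⟨u, rfl⟩ := hU
    have h1 : (↑u * (1 - T)) f = 0 := by
      rw [← h]; simp [hf']
    have h2 : (↑u⁻¹ * (↑u * (1 - T)) : X →L[ℂ] X) f = 0 := by
      rw [mul_apply_eq_comp, h1, map_zero]
    rw [← mul_assoc, Units.inv_mul, one_mul] at h2
    exact (sub_eq_zero.1 (by simpa using h2)).symm
  have hVc : IsClosed (V : Set X) := by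
    have : (V : Set X) = {f | A f = z • f} := by
      ext f; exact mem_eigenspace_iff
    rw [this]
    exact isClosed_eq A.continuous (continuous_const_smul z)
  have : CompleteSpace V := hVc.completeSpace_coe
  have hc := IsCompactOperator.restrict' (f := (T : X →ₗ[ℂ] X)) hT (V := V)
    (fun v hv => by simpa [hfix v hv] using hv)
  refine FiniteDimensional.of_isCompactOperator_id (𝕜 := ℂ) (E := V) ?_
  have hid : (id : V → V) = ((T : X →ₗ[ℂ] X).restrict
      (fun v hv => by simpa [hfix v hv] using hv) : V →ₗ[ℂ] V) := by
    funext v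
    exact Subtype.ext (hfix v v.2).symm
  rw [hid]
  exact hc

/-- At a point of the unit circle the space is the direct sum of the eigenspace and the range. -/
lemma IsQuasiCompact.exists_proj {r : ℝ} (hr : r < 1) {A : X →L[ℂ] X} (hA : IsQuasiCompact r A)
    {M : ℝ} (hM : ∀ n, ‖A ^ n‖ ≤ M) {z : ℂ} (hz : ‖z‖ = 1) :
    ∃ π : X →L[ℂ] X, IsCompactOperator π ∧ (∀ f, A (π f) = z • π f) ∧
      (∀ f, π (A f) = z • π f) ∧ (∀ f, A f = z • f → π f = f) ∧
      (∀ f, ∃ g, f = π f + (A g - z • g)) ∧ z ∉ spectrum ℂ (A + π) := by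
  have hrz : r < ‖z‖ := by rw [hz]; exact hr
  set V := eigenspace (A : Module.End ℂ X) z with hVdef
  have hVmem : ∀ f, f ∈ V ↔ A f = z • f := fun f => mem_eigenspace_iff
  have : FiniteDimensional ℂ V := hA.finiteDimensional_eigenspace hrz
  have hdisj : ∀ f, A f - z • f ∈ V → A f = z • f := by
    intro f hf
    have h2 := eq_zero_of_pow_bounded hM hz (f := f) (g := A f - z • f) (by abel)
      ((hVmem _).1 hf)
    exact sub_eq_zero.1 h2
  obtain ⟨p₀, hp₀⟩ := Submodule.ClosedComplemented.of_finiteDimensional V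
  set p : X →L[ℂ] X := V.subtypeL ∘L p₀ with hp
  have hpV : ∀ f, p f ∈ V := fun f => (p₀ f).2
  have hpid : ∀ f ∈ V, p f = f := fun f hf => congrArg Subtype.val (hp₀ ⟨f, hf⟩)
  have hpc : IsCompactOperator p := isCompactOperator_of_mapsTo_finiteDimensional V hpV
  have hinj : ∀ q : X →L[ℂ] X, (∀ f, q f ∈ V) → (∀ f ∈ V, q f = f) →
      ∀ f, (A + q) f = z • f → f = 0 := by
    intro q hqV hqid f hf
    have h1 : A f - z • f = -q f := by
      rw [add_apply] at hf
      rw [← hf]; abel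
    have h2 : A f = z • f := hdisj f (h1 ▸ V.neg_mem (hqV f))
    have h3 : q f = 0 := by
      rw [h2, sub_self] at h1
      exact neg_eq_zero.1 h1.symm
    rw [← hqid f ((hVmem f).2 h2), h3]
  obtain ⟨u, hu⟩ := (hA.add_compact hpc).isUnit_sub hrz (hinj p hpV hpid)
  set S : X →L[ℂ] X := -(↑u⁻¹ : X →L[ℂ] X) with hS
  have hdec : ∀ f, f = p (S f) + (A (S f) - z • S f) := by
    intro f
    have h1 : (↑u * ↑u⁻¹ : X →L[ℂ] X) f = f := by rw [Units.mul_inv]; rfl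
    rw [hu, mul_apply_eq_comp] at h1
    conv_lhs => rw [← h1]
    simp [hS]
    abel
  set π : X →L[ℂ] X := p * S with hπ
  have hπapp : ∀ f, π f = p (S f) := fun f => rfl
  have hπV : ∀ f, π f ∈ V := fun f => hpV _
  have huniq : ∀ v ∈ V, ∀ g, π (v + (A g - z • g)) = v := by
    intro v hv g
    have h1 := hdec (v + (A g - z • g))
    set w := S (v + (A g - z • g))
    have h2 : A (w - g) - z • (w - g) = v - p w := by
      rw [map_sub, smul_sub]
      have : v - p w = (A w - z • w) - (A g - z • g) := by
        rw [sub_eq_sub_iff_add_eq_add, h1]; abel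
      rw [this]; abel
    have h3 := hdisj (w - g) (h2 ▸ V.sub_mem hv (hpV w))
    rw [h3, sub_self] at h2
    exact (sub_eq_zero.1 h2.symm).symm
  have hπid : ∀ f ∈ V, π f = f := fun f hf => by simpa using huniq f hf 0
  refine ⟨π, isCompactOperator_of_mapsTo_finiteDimensional V hπV, fun f => (hVmem _).1 (hπV f),
    fun f => ?_, fun f hf => hπid f ((hVmem f).2 hf), fun f => ⟨S f, hdec f⟩, ?_⟩
  · have h1 := huniq 0 V.zero_mem f
    rw [zero_add, map_sub, map_smul] at h1
    exact sub_eq_zero.1 h1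
  · rw [spectrum.notMem_iff, Algebra.algebraMap_eq_smul_one]
    exact (hA.add_compact (isCompactOperator_of_mapsTo_finiteDimensional V hπV)).isUnit_sub hrz
      (hinj π hπV hπid)

/-- An operator with spectrum in the open unit disc has exponentially decaying powers. -/
lemma exists_pow_le_of_spectrum {R : X →L[ℂ] X} (h : ∀ z ∈ spectrum ℂ R, ‖z‖ < 1) :
    ∃ K θ : ℝ, 0 < θ ∧ θ < 1 ∧ ∀ n : ℕ, ‖R ^ n‖ ≤ K * θ ^ n := by
  rcases subsingleton_or_nontrivial X with hX | hX
  · refine ⟨0, 1 / 2, by norm_num, by norm_num, fun n => ?_⟩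
    rw [Subsingleton.elim (R ^ n) 0]; simp
  have h1 : spectralRadius ℂ R < (1 : ℝ≥0) :=
    spectrum.spectralRadius_lt_of_forall_lt R fun z hz => by exact_mod_cast h z hz
  obtain ⟨θ, hθ1, hθ2⟩ := ENNReal.lt_iff_exists_nnreal_btwn.1 h1
  have hθ1' : θ < 1 := by exact_mod_cast hθ2
  have hθ0 : 0 < θ := by exact_mod_cast (zero_le.trans_lt hθ1)
  have h2 := (spectrum.pow_nnnorm_pow_one_div_tendsto_nhds_spectralRadius R).eventually_lt_const hθ1
  obtain ⟨n₀, hn₀⟩ := eventually_atTop.1 h2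
  have h3 : ∀ n ≥ max n₀ 1, ‖R ^ n‖ ≤ θ ^ n := by
    intro n hn
    have hn0 : n ≠ 0 := by have := le_max_right n₀ 1; omega
    have := (hn₀ n ((le_max_left _ _).trans hn)).le
    have h4 := ENNReal.rpow_le_rpow this (z := n) (by positivity)
    rw [← ENNReal.rpow_mul, one_div_mul_cancel (by positivity), ENNReal.rpow_one,
      ENNReal.rpow_natCast] at h4
    have : ‖R ^ n‖₊ ≤ θ ^ n := by exact_mod_cast h4
    exact_mod_cast this
  set N := max n₀ 1
  refine ⟨1 + ∑ k ∈ Finset.range N, ‖R ^ k‖ / θ ^ k, θ, by exact_mod_cast hθ0,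
    by exact_mod_cast hθ1', fun n => ?_⟩
  have hθn : (0 : ℝ) < (θ : ℝ) ^ n := by positivity
  rcases lt_or_ge n N with hn | hn
  · have h5 : ‖R ^ n‖ / (θ : ℝ) ^ n ≤ ∑ k ∈ Finset.range N, ‖R ^ k‖ / (θ : ℝ) ^ k :=
      Finset.single_le_sum (f := fun k => ‖R ^ k‖ / (θ : ℝ) ^ k) (fun k _ => by positivity)
        (Finset.mem_range.2 hn)
    rw [div_le_iff₀ hθn] at h5
    nlinarith
  · have h5 : 0 ≤ ∑ k ∈ Finset.range N, ‖R ^ k‖ / (θ : ℝ) ^ k :=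
      Finset.sum_nonneg fun k _ => by positivity
    have := h3 n hn
    nlinarith

/-- The spectral decomposition of a power bounded quasi-compact operator. -/
theorem IsQuasiCompact.exists_decomposition {r : ℝ} (hr : r < 1) {A : X →L[ℂ] X}
    (hA : IsQuasiCompact r A) {M : ℝ} (hM : ∀ n, ‖A ^ n‖ ≤ M) :
    ∃ δ ∈ Set.Ioo (0 : ℝ) 1, ∃ E : Finset ℂ,
      (E : Set ℂ) = spectrum ℂ A ∩ {z | δ ≤ ‖z‖} ∧ (∀ z ∈ E, ‖z‖ = 1) ∧
      (∀ z, ‖z‖ = 1 → z ∈ spectrum ℂ A → z ∈ E) ∧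
      (∀ z ∈ E, HasEigenvalue (A : Module.End ℂ X) z ∧
        FiniteDimensional ℂ (eigenspace (A : Module.End ℂ X) z) ∧
        ∀ f : X, (A - z • 1) ((A - z • 1) f) = 0 → (A - z • 1) f = 0) ∧
      ∃ (π : ℂ → (X →L[ℂ] X)) (R : X →L[ℂ] X),
        (∀ z ∈ E, π z * π z = π z ∧ A * π z = z • π z ∧ R * π z = 0 ∧ π z * R = 0) ∧
        (∀ z ∈ E, ∀ w ∈ E, z ≠ w → π w * π z = 0) ∧
        (∀ n : ℕ, 1 ≤ n → A ^ n = ∑ z ∈ E, z ^ n • π z + R ^ n) ∧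
        (∃ K θ : ℝ, 0 < θ ∧ θ < 1 ∧ ∀ n : ℕ, ‖R ^ n‖ ≤ K * θ ^ n) := by
  classical
  choose! π hπc hπA hAπ hπid hπdec hπs using
    fun z (hz : ‖z‖ = 1) => hA.exists_proj hr hM hz
  -- near a point of the circle there is no other point of the spectrum
  have hiso : ∀ z, ‖z‖ = 1 → ∀ w ∈ spectrum ℂ A, r < ‖w‖ → w ∉ spectrum ℂ (A + π z) → w = z := by
    intro z hz w hw hrw hw'
    by_contra hne
    obtain ⟨f, hf0, hf⟩ := hasEigenvalue_iff.1 (hA.hasEigenvalue hrw hw)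
    have h1 : π z f = 0 := by
      have := hAπ z hz f
      rw [hf, map_smul, ← sub_eq_zero, ← sub_smul] at this
      exact (smul_eq_zero.1 this).resolve_left (sub_ne_zero.2 hne)
    exact hw' (mem_spectrum_of_eigen hf0 (by rw [add_apply, hf, h1, add_zero]))
  have hle1 : ∀ w ∈ spectrum ℂ A, ‖w‖ ≤ 1 := by
    intro w hw
    by_contra! h
    obtain ⟨f, hf0, hf⟩ := hasEigenvalue_iff.1 (hA.hasEigenvalue (hr.trans h) hw)
    exact absurd (norm_le_one_of_eigen hM hf0 hf) (not_le.2 h)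
  set U : ℂ → Set ℂ := fun z => (spectrum ℂ (A + π z))ᶜ ∩ {w | r < ‖w‖} with hU
  have hUo : ∀ z, IsOpen (U z) := fun z =>
    (spectrum.isClosed _).isOpen_compl.inter (isOpen_lt continuous_const continuous_norm)
  have hUz : ∀ z, ‖z‖ = 1 → z ∈ U z := fun z hz => ⟨hπs z hz, by simpa [hz] using hr⟩
  obtain ⟨t, htS, htc⟩ := (isCompact_sphere (0 : ℂ) 1).elim_nhds_subcover U
    (fun z hz => (hUo z).mem_nhds (hUz z (by simpa using hz)))
  have htS' : ∀ z ∈ t, ‖z‖ = 1 := fun z hz => by simpa using htS z hz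
  set σ' : Set ℂ := spectrum ℂ A \ ⋃ z ∈ t, U z with hσ'
  have hσc : IsCompact σ' := (spectrum.isCompact A).diff (isOpen_biUnion fun z _ => hUo z)
  have hσlt : ∀ w ∈ σ', ‖w‖ < 1 := by
    intro w hw
    refine lt_of_le_of_ne (hle1 w hw.1) fun h => hw.2 (htc (by simpa using h))
  obtain ⟨b, hb1, hb⟩ : ∃ b < 1, ∀ w ∈ σ', ‖w‖ ≤ b := by
    rcases σ'.eq_empty_or_nonempty with h0 | h0
    · exact ⟨0, one_pos, by simp [h0]⟩
    · obtain ⟨w, hw, hmax⟩ := hσc.exists_isMaxOn h0 continuous_norm.continuousOn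
      exact ⟨‖w‖, hσlt w hw, fun v hv => hmax hv⟩
  obtain ⟨δ, hδ1, hδ2⟩ := exists_between (show max 0 (max r b) < 1 by simp [hr, hb1])
  have hδ0 : 0 < δ := (le_max_left _ _).trans_lt hδ1
  have hδr : r < δ := ((le_max_left _ _).trans (le_max_right _ _)).trans_lt hδ1
  have hδb : b < δ := ((le_max_right _ _).trans (le_max_right _ _)).trans_lt hδ1
  set E : Finset ℂ := t.filter (· ∈ spectrum ℂ A) with hE
  have hEmem : ∀ z, z ∈ E ↔ z ∈ spectrum ℂ A ∧ δ ≤ ‖z‖ := by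
    intro z
    rw [hE, Finset.mem_filter]
    constructor
    · rintro ⟨h1, h2⟩
      exact ⟨h2, by rw [htS' z h1]; exact hδ2.le⟩
    · rintro ⟨h1, h2⟩
      refine ⟨?_, h1⟩
      by_cases h3 : z ∈ ⋃ w ∈ t, U w
      · simp only [Set.mem_iUnion] at h3
        obtain ⟨w, hw, h4⟩ := h3
        rwa [hiso w (htS' w hw) z h1 h4.2 h4.1]
      · exact absurd (hb z ⟨h1, h3⟩) (not_le.2 (hδb.trans_le h2))
  have hE1 : ∀ z ∈ E, ‖z‖ = 1 := fun z hz => htS' z (Finset.mem_filter.1 hz).1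
  have hEr : ∀ z ∈ E, r < ‖z‖ := fun z hz => by rw [hE1 z hz]; exact hr
  have hππ : ∀ z, ‖z‖ = 1 → π z * π z = π z := by
    intro z hz
    ext f
    exact hπid z hz _ (hπA z hz f)
  have hπA' : ∀ z, ‖z‖ = 1 → A * π z = z • π z := fun z hz => by ext f; exact hπA z hz f
  have hAπ' : ∀ z, ‖z‖ = 1 → π z * A = z • π z := fun z hz => by ext f; exact hAπ z hz f
  have horth : ∀ z, ‖z‖ = 1 → ∀ w, ‖w‖ = 1 → z ≠ w → π w * π z = 0 := by
    intro z hz w hw hne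
    ext f
    have h1 := hAπ w hw (π z f)
    rw [hπA z hz, map_smul, ← sub_eq_zero, ← sub_smul] at h1
    exact (smul_eq_zero.1 h1).resolve_left (sub_ne_zero.2 hne)
  set R : X →L[ℂ] X := A - ∑ z ∈ E, z • π z with hR
  have hRπ : ∀ z ∈ E, R * π z = 0 := by
    intro z hz
    rw [hR, sub_mul, Finset.sum_mul, Finset.sum_eq_single_of_mem z hz, hπA' z (hE1 z hz),
      smul_mul_assoc, hππ z (hE1 z hz), sub_self]
    intro w hw hne
    rw [smul_mul_assoc, horth z (hE1 z hz) w (hE1 w hw) hne.symm, smul_zero]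
  have hπR : ∀ z ∈ E, π z * R = 0 := by
    intro z hz
    rw [hR, mul_sub, Finset.mul_sum, Finset.sum_eq_single_of_mem z hz, hAπ' z (hE1 z hz),
      mul_smul_comm, hππ z (hE1 z hz), sub_self]
    intro w hw hne
    rw [mul_smul_comm, horth w (hE1 w hw) z (hE1 z hz) hne, smul_zero]
  refine ⟨δ, ⟨hδ0, hδ2⟩, E, by ext z; simpa using hEmem z, hE1,
    fun z hz hzs => (hEmem z).2 ⟨hzs, by rw [hz]; exact hδ2.le⟩,
    fun z hz => ⟨hA.hasEigenvalue (hEr z hz) ((hEmem z).1 hz).1,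
      hA.finiteDimensional_eigenspace (hEr z hz), fun f hf => ?_⟩, π, R,
    fun z hz => ⟨hππ z (hE1 z hz), hπA' z (hE1 z hz), hRπ z hz, hπR z hz⟩,
    fun z hz w hw hne => horth z (hE1 z hz) w (hE1 w hw) hne, ?_, ?_⟩
  · refine eq_zero_of_pow_bounded hM (hE1 z hz) (f := f) (by simp) ?_
    exact sub_eq_zero.1 (by simpa using hf)
  · intro n hn
    induction n, hn using Nat.le_induction with
    | base => simp [hR]
    | succ n hn ih =>
      have h1 : A = R + ∑ z ∈ E, z • π z := by rw [hR]; abel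
      have h2 : (∑ z ∈ E, z • π z) * R ^ n = 0 := by
        obtain ⟨k, rfl⟩ : ∃ k, n = k + 1 := ⟨n - 1, by omega⟩
        rw [pow_succ', ← mul_assoc, Finset.sum_mul, Finset.sum_eq_zero, zero_mul]
        intro z hz
        rw [smul_mul_assoc, hπR z hz, smul_zero]
      rw [pow_succ' A, ih, mul_add, Finset.mul_sum]
      congr 1
      · refine Finset.sum_congr rfl fun z hz => ?_
        rw [mul_smul_comm, hπA' z (hE1 z hz), smul_smul, pow_succ]
      · nth_rewrite 1 [h1]
        rw [add_mul, h2, add_zero, pow_succ']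
  · have hRq : IsQuasiCompact r R := by
      have hc : IsCompactOperator (-∑ z ∈ E, z • π z : X →L[ℂ] X) := by
        have : (-∑ z ∈ E, z • π z : X →L[ℂ] X) ∈ compactOperator (RingHom.id ℂ) X X :=
          Submodule.neg_mem _ (Submodule.sum_mem _ fun z hz =>
            Submodule.smul_mem _ _ (hπc z (hE1 z hz)))
        exact this
      rw [hR, sub_eq_add_neg]
      exact hA.add_compact hc
    refine exists_pow_le_of_spectrum fun w hw => ?_
    refine lt_of_not_ge fun h1 => ?_
    have hrw : r < ‖w‖ := hr.trans_le h1
    have hw0 : w ≠ 0 := by rintro rfl; simp at h1; linarith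
    obtain ⟨f, hf0, hf⟩ := hasEigenvalue_iff.1 (hRq.hasEigenvalue hrw hw)
    have h2 : ∀ z ∈ E, π z f = 0 := by
      intro z hz
      have h3 : (π z * R) f = 0 := by rw [hπR z hz]; rfl
      rw [mul_apply_eq_comp, hf, map_smul] at h3
      exact (smul_eq_zero.1 h3).resolve_left hw0
    have h3 : A f = w • f := by
      rw [← hf, hR]
      simp only [sub_apply, sum_apply,
        smul_apply]
      rw [Finset.sum_eq_zero fun z hz => by rw [h2 z hz, smul_zero], sub_zero]
    have hwE : w ∈ E := (hEmem w).2 ⟨mem_spectrum_of_eigen hf0 h3, hδ2.le.trans h1⟩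
    exact hf0 (by rw [← hπid w (hE1 w hwE) f h3, h2 w hwE])

end QuasiCompact

namespace BesovGrid

/-! ## Minkowski and Young inequalities for extended nonnegative functions -/

section Minkowski

variable {ι α : Type*}

lemma rpow_one_div_le_iff {p : ℝ} (hp : 0 < p) {a b : ℝ≥0∞} : a ^ (1 / p) ≤ b ↔ a ≤ b ^ p := by
  rw [one_div, ENNReal.rpow_inv_le_iff hp]

lemma lintegral_Lp_sum_le [MeasurableSpace α] {μ : Measure α} {p : ℝ} (hp : 1 ≤ p)
    (u : ι → α → ℝ≥0∞) (hu : ∀ i, AEMeasurable (u i) μ) (t : Finset ι) :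
    (∫⁻ a, (∑ i ∈ t, u i a) ^ p ∂μ) ^ (1 / p) ≤ ∑ i ∈ t, (∫⁻ a, u i a ^ p ∂μ) ^ (1 / p) := by
  classical
  have h0 : 0 < p := by linarith
  induction t using Finset.induction_on with
  | empty => simp [h0]
  | insert i t hi ih =>
    simp_rw [Finset.sum_insert hi]
    refine le_trans ?_ (add_le_add le_rfl ih)
    have := ENNReal.lintegral_Lp_add_le (hu i)
      (g := fun a => ∑ i ∈ t, u i a) (by fun_prop) hp
    simpa using this

lemma lintegral_Lp_tsum_le [Countable ι] [MeasurableSpace α] {μ : Measure α} {p : ℝ} (hp : 1 ≤ p)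
    (u : ι → α → ℝ≥0∞) (hu : ∀ i, AEMeasurable (u i) μ) :
    (∫⁻ a, (∑' i, u i a) ^ p ∂μ) ^ (1 / p) ≤ ∑' i, (∫⁻ a, u i a ^ p ∂μ) ^ (1 / p) := by
  have h0 : 0 < p := by linarith
  rw [rpow_one_div_le_iff h0]
  have e : ∀ a, (∑' i, u i a) ^ p = ⨆ t : Finset ι, (∑ i ∈ t, u i a) ^ p := fun a => by
    rw [ENNReal.tsum_eq_iSup_sum]
    exact (ENNReal.orderIsoRpow p h0).map_iSup _
  simp_rw [e]
  rw [lintegral_iSup_directed (fun t => by fun_prop) ?_]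
  · refine iSup_le fun t => ?_
    rw [← rpow_one_div_le_iff h0]
    exact (lintegral_Lp_sum_le hp u hu t).trans (ENNReal.sum_le_tsum t)
  · exact directed_of_isDirected_le fun s t hst a =>
      ENNReal.rpow_le_rpow (Finset.sum_le_sum_of_subset hst) h0.le

lemma sum_Lp_tsum_le [Countable ι] {p : ℝ} (hp : 1 ≤ p) (S : Finset α) (u : ι → α → ℝ≥0∞) :
    (∑ a ∈ S, (∑' i, u i a) ^ p) ^ (1 / p) ≤ ∑' i, (∑ a ∈ S, u i a ^ p) ^ (1 / p) := by
  let : MeasurableSpace S := ⊤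
  have := lintegral_Lp_tsum_le (μ := (Measure.count : Measure S)) hp
    (fun i a => u i a) (fun i => measurable_from_top.aemeasurable)
  simpa only [lintegral_count, tsum_fintype, Finset.univ_eq_attach,
    Finset.sum_attach S (fun a => (∑' i, u i a) ^ p),
    fun i => Finset.sum_attach S (fun a => u i a ^ p)] using this

lemma ellNorm_tsum_le [Countable ι] {q : ℝ≥0∞} (hq : 1 ≤ q) (u : ι → ℕ → ℝ≥0∞) :
    ellNorm q (fun k => ∑' i, u i k) ≤ ∑' i, ellNorm q (u i) := by
  unfold ellNorm
  split_ifs with h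
  · exact iSup_le fun k => ENNReal.tsum_le_tsum fun i => le_iSup (u i) k
  · have := lintegral_Lp_tsum_le (μ := (Measure.count : Measure ℕ)) (toReal_ge_one hq h) u
      (fun i => (measurable_of_countable _).aemeasurable)
    simpa [lintegral_count] using this

lemma ellNorm_comp_add_le {q : ℝ≥0∞} (u : ℕ → ℝ≥0∞) (n : ℕ) :
    ellNorm q (fun k => u (k + n)) ≤ ellNorm q u := by
  unfold ellNorm
  split_ifs with h
  · exact iSup_le fun k => le_iSup u _
  · exact ENNReal.rpow_le_rpow (ENNReal.tsum_comp_le_tsum_of_injective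
      (add_left_injective n) fun k => u k ^ q.toReal) (by positivity)

lemma sum_add_tsum_add_eq (f : ℕ → ℝ≥0∞) (n : ℕ) :
    ∑ k ∈ Finset.range n, f k + ∑' k, f (k + n) = ∑' k, f k :=
  Summable.sum_add_tsum_nat_add' ENNReal.summable

lemma ellNorm_shift_le {q : ℝ≥0∞} (hq : 1 ≤ q) (u : ℕ → ℝ≥0∞) (n : ℕ) :
    ellNorm q (fun k => if n ≤ k then u (k - n) else 0) ≤ ellNorm q u := by
  unfold ellNorm
  split_ifs with h
  · refine iSup_le fun k => ?_
    dsimp only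
    split_ifs
    · exact le_iSup u _
    · exact zero_le
  · have h1 := toReal_ge_one hq h
    refine ENNReal.rpow_le_rpow ?_ (by positivity)
    rw [← sum_add_tsum_add_eq _ n, Finset.sum_eq_zero, zero_add]
    · simp
    · intro k hk
      have hk' : ¬ n ≤ k := by simpa using hk
      simp only [if_neg hk']
      exact ENNReal.zero_rpow_of_pos (by linarith)

/-- Young's inequality for the convolution with a two-sided geometric sequence. -/
lemma ellNorm_geometric_conv_le {q : ℝ≥0∞} (hq : 1 ≤ q) (x : ℝ≥0∞) (u : ℕ → ℝ≥0∞) :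
    ellNorm q (fun k => ∑' j, x ^ ((k - j) + (j - k)) * u j) ≤ 2 / (1 - x) * ellNorm q u := by
  have hpt : ∀ k, ∑' j, x ^ ((k - j) + (j - k)) * u j ≤
      ∑' n, x ^ n * ((if n ≤ k then u (k - n) else 0) + u (k + n)) := by
    intro k
    rw [← sum_add_tsum_add_eq _ (k + 1), ← Finset.sum_range_reflect]
    simp_rw [mul_add]
    rw [ENNReal.tsum_add]
    refine add_le_add ((Finset.sum_le_sum fun j hj => ?_).trans
      (ENNReal.sum_le_tsum (Finset.range (k + 1)))) ?_
    · have hj' : j ≤ k := by simpa [Nat.lt_succ_iff] using hj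
      rw [if_pos hj', show k + 1 - 1 - j = k - j by omega,
        show k - (k - j) + (k - j - k) = j by omega]
    · rw [← sum_add_tsum_add_eq (fun n => x ^ n * u (k + n)) 1]
      refine le_trans (le_of_eq (tsum_congr fun j => ?_)) le_add_self
      rw [show k - (j + (k + 1)) + (j + (k + 1) - k) = j + 1 by omega,
        show j + (k + 1) = k + (j + 1) by omega]
  calc _ ≤ ellNorm q (fun k => ∑' n, x ^ n * ((if n ≤ k then u (k - n) else 0) + u (k + n))) :=
        ellNorm_mono hpt
    _ ≤ ∑' n, ellNorm q (fun k => x ^ n * ((if n ≤ k then u (k - n) else 0) + u (k + n))) :=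
        ellNorm_tsum_le hq _
    _ ≤ ∑' n, x ^ n * (2 * ellNorm q u) := by
        refine ENNReal.tsum_le_tsum fun n => ?_
        rw [ellNorm_const_mul hq, two_mul]
        gcongr
        refine (ellNorm_add_le hq _ _).trans (add_le_add (ellNorm_shift_le hq u n) ?_)
        simpa only [add_comm] using ellNorm_comp_add_le u n
    _ = _ := by
        rw [ENNReal.tsum_mul_right, ENNReal.tsum_geometric, div_eq_mul_inv]
        ring

end Minkowski

/-! ## Series in `L^p` -/

section Series

variable {X : Type*} [MeasurableSpace X] {m : Measure X}

lemma eLpNorm_ofReal_eq {p : ℝ} (hp : 1 ≤ p) (f : X → ℂ) :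
    eLpNorm f (ENNReal.ofReal p) m = (∫⁻ x, ‖f x‖ₑ ^ p ∂m) ^ (1 / p) := by
  have h0 : 0 < p := by linarith
  rw [eLpNorm_eq_lintegral_rpow_enorm_toReal (by simpa using h0) ENNReal.ofReal_ne_top,
    ENNReal.toReal_ofReal h0.le]

lemma one_le_ofReal {p : ℝ} (hp : 1 ≤ p) : 1 ≤ ENNReal.ofReal p := by
  rwa [ENNReal.one_le_ofReal]

lemma enorm_le_tsum_of_hasSum {ι : Type*} {F : ι → ℂ} {f : ℂ} (h : HasSum F f) :
    ‖f‖ₑ ≤ ∑' i, ‖F i‖ₑ := by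
  rw [← h.tsum_eq]
  exact enorm_tsum_le_tsum_enorm

lemma eLpNorm_le_tsum {ι : Type*} [Countable ι] {p : ℝ} (hp : 1 ≤ p) {F : ι → X → ℂ} {f : X → ℂ}
    (hF : ∀ i, AEStronglyMeasurable (F i) m) (h : ∀ᵐ x ∂m, HasSum (fun i => F i x) (f x)) :
    eLpNorm f (ENNReal.ofReal p) m ≤ ∑' i, eLpNorm (F i) (ENNReal.ofReal p) m := by
  simp_rw [eLpNorm_ofReal_eq hp]
  refine le_trans ?_ (lintegral_Lp_tsum_le hp (fun i x => ‖F i x‖ₑ) fun i => (hF i).enorm)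
  refine ENNReal.rpow_le_rpow (lintegral_mono_ae ?_) (by positivity)
  filter_upwards [h] with x hx
  exact ENNReal.rpow_le_rpow (enorm_le_tsum_of_hasSum hx) (by linarith)

lemma aestronglyMeasurable_of_hasSum {ι : Type*} [Countable ι] {F : ι → X → ℂ} {f : X → ℂ}
    (hF : ∀ i, AEStronglyMeasurable (F i) m) (h : ∀ᵐ x ∂m, HasSum (fun i => F i x) (f x)) :
    AEStronglyMeasurable f m := by
  refine aestronglyMeasurable_of_tendsto_ae (u := (atTop : Filter (Finset ι)))
    (f := fun t x => ∑ i ∈ t, F i x) (fun t => ?_) h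
  exact Finset.aestronglyMeasurable_fun_sum t fun i _ => hF i

lemma Grid.sumsTo_of_hasSum {p : ℝ} (hp : 1 ≤ p) {F : ℕ → X → ℂ} {f : X → ℂ}
    (hF : ∀ k, AEStronglyMeasurable (F k) m)
    (hs : ∑' k, eLpNorm (F k) (ENNReal.ofReal p) m < ∞)
    (h : ∀ᵐ x ∂m, HasSum (fun k => F k x) (f x)) : Grid.SumsTo m p F f := by
  refine ⟨⟨aestronglyMeasurable_of_hasSum hF h, (eLpNorm_le_tsum hp hF h).trans_lt hs⟩, hs, ?_⟩
  refine tendsto_of_tendsto_of_tendsto_of_le_of_le tendsto_const_nhds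
    (ENNReal.tendsto_sum_nat_add (fun k => eLpNorm (F k) (ENNReal.ofReal p) m) hs.ne)
    (fun _ => zero_le) fun n => ?_
  refine eLpNorm_le_tsum hp (fun k => hF (k + n)) ?_
  filter_upwards [h] with x hx
  exact (hasSum_nat_add_iff' n).2 hx

lemma Grid.SumsTo.ae_summable {p : ℝ} (hp : 1 ≤ p) {F : ℕ → X → ℂ} {f : X → ℂ}
    (hF : ∀ k, AEStronglyMeasurable (F k) m) (h : Grid.SumsTo m p F f) :
    ∀ᵐ x ∂m, Summable fun k => ‖F k x‖ :=
  summable_norm_of_tsum_eLpNorm_ne_top (one_le_ofReal hp) hF h.2.1.ne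

lemma Grid.SumsTo.ae_eq {p : ℝ} (hp : 1 ≤ p) {F : ℕ → X → ℂ} {f g : X → ℂ}
    (hF : ∀ k, AEStronglyMeasurable (F k) m) (hf : Grid.SumsTo m p F f)
    (hg : Grid.SumsTo m p F g) : f =ᵐ[m] g := by
  have hS : ∀ n, AEStronglyMeasurable (fun x => ∑ k ∈ Finset.range n, F k x) m := fun n =>
    Finset.aestronglyMeasurable_fun_sum _ fun k _ => hF k
  have hlim := hf.2.2.add hg.2.2
  rw [add_zero] at hlim
  have h0 : eLpNorm (f - g) (ENNReal.ofReal p) m ≤ 0 := by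
    refine ge_of_tendsto' hlim fun n => ?_
    refine le_trans (le_of_eq ?_) ((eLpNorm_sub_le (hf.1.1.sub (hS n)) (hg.1.1.sub (hS n))
      (one_le_ofReal hp)))
    congr 1
    funext x
    simp
  rw [nonpos_iff_eq_zero, eLpNorm_eq_zero_iff (hf.1.1.sub hg.1.1)
    (zero_lt_one.trans_le (one_le_ofReal hp)).ne'] at h0
  filter_upwards [h0] with x hx
  exact sub_eq_zero.1 hx

lemma Grid.SumsTo.ae_hasSum {p : ℝ} (hp : 1 ≤ p) {F : ℕ → X → ℂ} {f : X → ℂ}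
    (hF : ∀ k, AEStronglyMeasurable (F k) m) (h : Grid.SumsTo m p F f) :
    ∀ᵐ x ∂m, HasSum (fun k => F k x) (f x) := by
  have h1 := h.ae_summable hp hF
  have h2 : ∀ᵐ x ∂m, HasSum (fun k => F k x) (∑' k, F k x) := by
    filter_upwards [h1] with x hx using hx.of_norm.hasSum
  have h3 := h.ae_eq hp hF (Grid.sumsTo_of_hasSum hp hF h.2.1 h2)
  filter_upwards [h2, h3] with x hx hx'
  rwa [hx']

/-- Functions supported on disjoint sets are orthogonal for the `p`-th power. -/
lemma lintegral_rpow_sum_of_disjoint {p : ℝ} (hp : 0 < p) (S : Finset (Set X))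
    (hS : ∀ P ∈ S, ∀ Q ∈ S, P ≠ Q → Disjoint P Q) (H : Set X → X → ℝ≥0∞)
    (hH : ∀ W ∈ S, AEMeasurable (H W) m) (hsupp : ∀ W ∈ S, ∀ x ∉ W, H W x = 0) :
    ∫⁻ x, (∑ W ∈ S, H W x) ^ p ∂m = ∑ W ∈ S, ∫⁻ x, H W x ^ p ∂m := by
  rw [← lintegral_finsetSum' _ fun W hW => (hH W hW).pow_const p]
  refine lintegral_congr fun x => ?_
  by_cases hx : ∃ W ∈ S, x ∈ W
  · obtain ⟨W, hW, hxW⟩ := hx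
    have hz : ∀ V ∈ S, V ≠ W → H V x = 0 := fun V hV hne => hsupp V hV x fun hxV =>
      Set.disjoint_left.1 (hS V hV W hW hne) hxV hxW
    rw [Finset.sum_eq_single_of_mem W hW hz, Finset.sum_eq_single_of_mem W hW]
    intro V hV hne
    rw [hz V hV hne, ENNReal.zero_rpow_of_pos hp]
  · push Not at hx
    rw [Finset.sum_eq_zero fun W hW => hsupp W hW x (hx W hW), Finset.sum_eq_zero,
      ENNReal.zero_rpow_of_pos hp]
    intro W hW
    rw [hsupp W hW x (hx W hW), ENNReal.zero_rpow_of_pos hp]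

end Series

end BesovGrid

namespace BesovGrid

/-! ## Geometry of good grids -/

namespace GoodGrid

variable {X : Type*} [MeasurableSpace X] {m : Measure X} [IsProbabilityMeasure m] (P : GoodGrid m)

lemma lam₂_pos : 0 < P.lam₂ := P.lam₁_pos.trans P.lam₁_lt_lam₂

lemma real_pos {k : ℕ} {Q : Set X} (hQ : Q ∈ P.level k) : 0 < m.real Q :=
  ENNReal.toReal_pos (P.pos k Q hQ).ne' (measure_ne_top _ _)

lemma nonempty_of_mem {k : ℕ} {Q : Set X} (hQ : Q ∈ P.level k) : Q.Nonempty :=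
  nonempty_of_measure_ne_zero (P.pos k Q hQ).ne'

lemma eq_of_mem_level {k : ℕ} {Q R : Set X} (hQ : Q ∈ P.level k) (hR : R ∈ P.level k)
    (h : (Q ∩ R).Nonempty) : Q = R := by
  by_contra hne
  obtain ⟨x, hx⟩ := h
  exact Set.disjoint_left.1 (P.disjoint k Q hQ R hR hne) hx.1 hx.2

lemma exists_ancestor (k n : ℕ) : ∀ Q ∈ P.level (k + n),
    ∃ R ∈ P.level k, Q ⊆ R ∧ m.real Q ≤ P.lam₂ ^ n * m.real R := by
  induction n with
  | zero => exact fun Q hQ => ⟨Q, hQ, subset_rfl, by simp⟩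
  | succ n ih =>
    intro Q hQ
    obtain ⟨R, hR, hQR⟩ := P.nested (k + n) Q hQ
    obtain ⟨S, hS, hRS, hle⟩ := ih R hR
    have h := (P.ratio (k + n) Q hQ R hR hQR).2
    rw [div_le_iff₀ (P.real_pos hR)] at h
    refine ⟨S, hS, hQR.trans hRS, h.trans ?_⟩
    rw [pow_succ']
    have := P.lam₂_pos
    rw [mul_assoc]
    gcongr

lemma level_le_of_subset {k l : ℕ} {Q W : Set X} (hQ : Q ∈ P.level k) (hW : W ∈ P.level l)
    (h : Q ⊆ W) : l ≤ k ∧ m.real Q ≤ P.lam₂ ^ (k - l) * m.real W := by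
  obtain ⟨x, hx⟩ := P.nonempty_of_mem hQ
  have hlk : l ≤ k := by
    by_contra! hlt
    obtain ⟨n, rfl⟩ := Nat.exists_eq_add_of_lt hlt
    obtain ⟨R, hR, hWR, hle⟩ := P.exists_ancestor k (n + 1) W hW
    rw [← P.eq_of_mem_level hQ hR ⟨x, hx, hWR (h hx)⟩] at hle
    have h1 : m.real Q ≤ m.real W := measureReal_mono h
    have h2 : P.lam₂ ^ (n + 1) < 1 := pow_lt_one₀ P.lam₂_pos.le P.lam₂_lt_one (by omega)
    nlinarith [P.real_pos hQ]
  refine ⟨hlk, ?_⟩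
  obtain ⟨n, rfl⟩ := Nat.exists_eq_add_of_le hlk
  obtain ⟨R, hR, hQR, hle⟩ := P.exists_ancestor l n Q hQ
  rw [← P.eq_of_mem_level hR hW ⟨x, hQR hx, h hx⟩]
  simpa using hle

lemma level_unique {k l : ℕ} {W : Set X} (hk : W ∈ P.level k) (hl : W ∈ P.level l) : k = l :=
  le_antisymm (P.level_le_of_subset hl hk subset_rfl).1 (P.level_le_of_subset hk hl subset_rfl).1

lemma exists_forall_notMem (P' : Finset (Set X)) (hP' : ∀ Q ∈ P', ∃ k, Q ∈ P.level k) :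
    ∃ K, ∀ k ≥ K, ∀ Q ∈ P.level k, Q ∉ P' := by
  choose! l hl using hP'
  refine ⟨P'.sup l + 1, fun k hk Q hQ hmem => ?_⟩
  have h1 : l Q ≤ P'.sup l := Finset.le_sup hmem
  have := P.level_unique hQ (hl Q hmem)
  omega

lemma univ_mem : Set.univ ∈ P.level 0 := by rw [P.level_zero]; simp

/-! ## Representations -/

lemma aestronglyMeasurable_layer (G : Grid m) (s p : ℝ) (c : Coeff X) (k : ℕ) :
    AEStronglyMeasurable (G.layer s p c k) m := (G.measurable_layer s p c k).aestronglyMeasurable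

/-- The `L^p`-norm of a layer whose atoms have small supports. -/
lemma eLpNorm_layer_le_of_le {s p : ℝ} (hs : 0 < s) (hp : 1 ≤ p) (c : Coeff X) (k : ℕ) {M : ℝ}
    (hM : 0 ≤ M) (h : ∀ Q ∈ P.level k, c k Q ≠ 0 → m.real Q ≤ M) :
    eLpNorm (P.layer s p c k) (ENNReal.ofReal p) m ≤
      ENNReal.ofReal (M ^ s) * P.levelNorm p c k := by
  have h0 : 0 < p := by linarith
  have hmul : ENNReal.ofReal (M ^ s) * P.levelNorm p c k =
      (∑ Q ∈ P.level k, (ENNReal.ofReal (M ^ s) * ‖c k Q‖ₑ) ^ p) ^ (1 / p) := by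
    simp_rw [ENNReal.mul_rpow_of_nonneg _ _ h0.le, ← Finset.mul_sum]
    rw [ENNReal.mul_rpow_of_nonneg _ _ (by positivity), ← ENNReal.rpow_mul,
      mul_one_div_cancel h0.ne', ENNReal.rpow_one]
    rfl
  rw [hmul, eLpNorm_ofReal_eq hp]
  refine ENNReal.rpow_le_rpow ?_ (by positivity)
  calc ∫⁻ x, ‖P.layer s p c k x‖ₑ ^ p ∂m
      ≤ ∫⁻ x, (∑ Q ∈ P.level k, ‖c k Q * P.atom s p Q x‖ₑ) ^ p ∂m := by
        gcongr with x
        exact enorm_sum_le _ _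
    _ = ∑ Q ∈ P.level k, ∫⁻ x, ‖c k Q * P.atom s p Q x‖ₑ ^ p ∂m := by
        refine lintegral_rpow_sum_of_disjoint h0 _ (P.disjoint k)
          (fun Q x => ‖c k Q * P.atom s p Q x‖ₑ) (fun Q hQ => ?_) fun Q hQ x hx => by
            simp [Grid.atom, hx]
        exact ((measurable_const.indicator (P.measurableSet k Q hQ)).const_mul _).enorm.aemeasurable
    _ ≤ _ := Finset.sum_le_sum fun Q hQ => ?_
  have hQ0 := P.real_pos hQ
  by_cases hc : c k Q = 0
  · simp [hc, h0]
  have e1 : ∀ x, ‖c k Q * P.atom s p Q x‖ₑ ^ p = Q.indicator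
      (fun _ => ‖c k Q‖ₑ ^ p * ENNReal.ofReal ((m.real Q ^ (s - 1 / p)) ^ p)) x := by
    intro x
    by_cases hx : x ∈ Q
    · have hn : 0 ≤ m.real Q ^ (s - 1 / p) := by positivity
      simp only [Grid.atom, hx, Set.indicator_of_mem]
      rw [enorm_mul, ENNReal.mul_rpow_of_nonneg _ _ h0.le, ← ofReal_norm (_ : ℂ),
        ← ofReal_norm (_ : ℂ), Complex.norm_real, Real.norm_of_nonneg hn,
        ENNReal.ofReal_rpow_of_nonneg hn h0.le]
    · simp [Grid.atom, hx, h0]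
  simp_rw [e1]
  rw [lintegral_indicator_const (P.measurableSet k Q hQ), mul_comm (ENNReal.ofReal (M ^ s)),
    ENNReal.mul_rpow_of_nonneg _ _ h0.le, mul_assoc]
  gcongr
  have hmQ : m Q = ENNReal.ofReal (m.real Q) := by
    rw [Measure.real, ENNReal.ofReal_toReal (measure_ne_top _ _)]
  rw [hmQ, ← ENNReal.ofReal_mul (by positivity),
    ENNReal.ofReal_rpow_of_nonneg (by positivity) h0.le]
  refine ENNReal.ofReal_le_ofReal ?_
  have e : (m.real Q ^ (s - 1 / p)) ^ p * m.real Q = (m.real Q ^ s) ^ p := by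
    rw [← Real.rpow_mul hQ0.le, ← Real.rpow_mul hQ0.le, ← Real.rpow_add_one hQ0.ne']
    congr 1
    field_simp
    ring
  rw [e]
  gcongr
  exact h Q hQ hc

/-- The sum of the geometric series that bounds the norm of the embedding of `B^s_{p,q}` into
`L^p`. -/
def embConst (s : ℝ) : ℝ≥0∞ := ∑' n : ℕ, ENNReal.ofReal ((P.lam₂ ^ n) ^ s)

lemma embConst_ne_top {s : ℝ} (hs : 0 < s) : P.embConst s ≠ ∞ := by
  have h2 := P.lam₂_pos
  have hs' : Summable fun k : ℕ => (P.lam₂ ^ k) ^ s := by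
    have : ∀ k : ℕ, (P.lam₂ ^ k) ^ s = (P.lam₂ ^ s) ^ k := fun k => by
      rw [← Real.rpow_natCast, ← Real.rpow_natCast, ← Real.rpow_mul h2.le,
        ← Real.rpow_mul h2.le, mul_comm]
    simp_rw [this]
    exact summable_geometric_of_lt_one (by positivity)
      (Real.rpow_lt_one h2.le P.lam₂_lt_one hs)
  exact hs'.tsum_ofReal_ne_top

lemma tsum_eLpNorm_layer_le {s p : ℝ} (hs : 0 < s) (hp : 1 ≤ p) {q : ℝ≥0∞} (hq : 1 ≤ q)
    (c : Coeff X) : ∑' k, eLpNorm (P.layer s p c k) (ENNReal.ofReal p) m ≤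
      P.embConst s * P.cost p q c := by
  rw [embConst, ← ENNReal.tsum_mul_right]
  refine ENNReal.tsum_le_tsum fun k => (P.eLpNorm_layer_le_of_le hs hp c k
    (pow_nonneg P.lam₂_pos.le k) fun Q hQ _ => P.real_le k Q hQ).trans ?_
  gcongr
  exact le_ellNorm hq _ k

lemma isRep_iff {s p : ℝ} (hs : 0 < s) (hp : 1 ≤ p) {q : ℝ≥0∞} (hq : 1 ≤ q)
    {c : Coeff X} {f : X → ℂ} : P.IsRep s p q c f ↔
      (∀ᵐ x ∂m, HasSum (fun k => P.layer s p c k x) (f x)) ∧ P.cost p q c < ∞ := by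
  constructor
  · exact fun h => ⟨h.1.ae_hasSum hp (aestronglyMeasurable_layer _ s p c), h.2⟩
  · rintro ⟨h1, h2⟩
    refine ⟨Grid.sumsTo_of_hasSum hp (aestronglyMeasurable_layer _ s p c) ?_ h1, h2⟩
    exact (P.tsum_eLpNorm_layer_le hs hp hq c).trans_lt
      (ENNReal.mul_lt_top (P.embConst_ne_top hs).lt_top h2)

lemma enorm_coeff_le_cost (G : Grid m) {p : ℝ} (hp : 1 ≤ p) {q : ℝ≥0∞} (hq : 1 ≤ q)
    (c : Coeff X) {k : ℕ} {Q : Set X} (hQ : Q ∈ G.level k) : ‖c k Q‖ₑ ≤ G.cost p q c := by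
  have h0 : 0 < p := by linarith
  refine le_trans ?_ (le_ellNorm hq (G.levelNorm p c) k)
  unfold Grid.levelNorm
  calc ‖c k Q‖ₑ = (‖c k Q‖ₑ ^ p) ^ (1 / p) := by
        rw [← ENNReal.rpow_mul, mul_one_div_cancel h0.ne', ENNReal.rpow_one]
    _ ≤ _ := ENNReal.rpow_le_rpow
      (Finset.single_le_sum (f := fun Q => ‖c k Q‖ₑ ^ p) (fun _ _ => zero_le) hQ) (by positivity)

lemma cost_tsum_le (G : Grid m) {ι : Type*} [Countable ι] {p : ℝ} (hp : 1 ≤ p) {q : ℝ≥0∞}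
    (hq : 1 ≤ q) (c : ι → Coeff X) :
    G.cost p q (fun k Q => ∑' i, c i k Q) ≤ ∑' i, G.cost p q (c i) := by
  refine le_trans (ellNorm_mono fun k => ?_) (ellNorm_tsum_le hq fun i => G.levelNorm p (c i))
  refine le_trans ?_ (sum_Lp_tsum_le hp (G.level k) fun i Q => ‖c i k Q‖ₑ)
  unfold Grid.levelNorm
  gcongr
  exact enorm_tsum_le_tsum_enorm

/-- Representations may be summed. -/
lemma isRep_tsum {ι : Type*} [Countable ι] {s p : ℝ} (hs : 0 < s) (hp : 1 ≤ p) {q : ℝ≥0∞}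
    (hq : 1 ≤ q) {c : ι → Coeff X} {f : ι → X → ℂ} (h : ∀ i, P.IsRep s p q (c i) (f i))
    (hc : ∑' i, P.cost p q (c i) ≠ ∞) {F : X → ℂ}
    (hF : ∀ᵐ x ∂m, HasSum (fun i => f i x) (F x)) :
    P.IsRep s p q (fun k Q => ∑' i, c i k Q) F := by
  refine (P.isRep_iff hs hp hq).2 ⟨?_, (cost_tsum_le _ hp hq c).trans_lt hc.lt_top⟩
  have h1 : ∀ᵐ x ∂m, ∀ i, HasSum (fun k => P.layer s p (c i) k x) (f i x) :=
    ae_all_iff.2 fun i => ((P.isRep_iff hs hp hq).1 (h i)).1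
  have h2 : ∀ᵐ x ∂m, Summable fun ik : ι × ℕ => ‖P.layer s p (c ik.1) ik.2 x‖ := by
    refine summable_norm_of_tsum_eLpNorm_ne_top (one_le_ofReal hp)
      (fun ik => aestronglyMeasurable_layer _ s p (c ik.1) ik.2) ?_
    rw [ENNReal.tsum_prod (f := fun i k => eLpNorm (P.layer s p (c i) k) (ENNReal.ofReal p) m)]
    refine ne_top_of_le_ne_top (b := P.embConst s * ∑' i, P.cost p q (c i))
      (ENNReal.mul_ne_top (P.embConst_ne_top hs) hc) ?_
    rw [← ENNReal.tsum_mul_left]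
    exact ENNReal.tsum_le_tsum fun i => P.tsum_eLpNorm_layer_le hs hp hq (c i)
  have hcs : ∀ k, ∀ Q ∈ P.level k, Summable fun i => c i k Q := by
    intro k Q hQ
    refine Summable.of_norm (tsum_enorm_ne_top_iff_summable_norm.1 (ne_top_of_le_ne_top hc ?_))
    exact ENNReal.tsum_le_tsum fun i => enorm_coeff_le_cost _ hp hq (c i) hQ
  filter_upwards [h1, h2, hF] with x hx1 hx2 hx3
  have hx4 : HasSum (fun ik : ι × ℕ => P.layer s p (c ik.1) ik.2 x) (F x) := by
    have := (hx2.of_norm).hasSum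
    have h5 := this.prod_fiberwise (fun i => hx1 i)
    rwa [hx3.unique h5]
  have hx5 := ((Equiv.prodComm ℕ ι).hasSum_iff (f := fun ik : ι × ℕ =>
    P.layer s p (c ik.1) ik.2 x)).2 hx4
  refine hx5.prod_fiberwise fun k => ?_
  simp only [Function.comp_def, Equiv.prodComm_apply, Prod.swap_prod_mk, Grid.layer]
  exact hasSum_sum fun Q hQ => ((hcs k Q hQ).hasSum).mul_right _

/-- `c` is a representation of `f` that only uses sets contained in `W`. -/
def IsRepOn (s p : ℝ) (q : ℝ≥0∞) (W : Set X) (c : Coeff X) (f : X → ℂ) : Prop :=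
  P.IsRep s p q c f ∧ ∀ k, ∀ Q ∈ P.level k, ¬ Q ⊆ W → c k Q = 0

lemma eBesovNormOn_le {s p : ℝ} {q : ℝ≥0∞} {W : Set X} {c : Coeff X} {f : X → ℂ}
    (h : P.IsRepOn s p q W c f) : P.eBesovNormOn s p q W f ≤ P.cost p q c := iInf₂_le c h

lemma exists_isRepOn {s p : ℝ} {q : ℝ≥0∞} {W : Set X} {f : X → ℂ} {C : ℝ≥0∞}
    (h : P.eBesovNormOn s p q W f < C) : ∃ c, P.IsRepOn s p q W c f ∧ P.cost p q c < C := by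
  unfold Grid.eBesovNormOn at h
  simp only [iInf_lt_iff] at h
  obtain ⟨c, hc, hlt⟩ := h
  exact ⟨c, hc, hlt⟩

lemma exists_isRep {s p : ℝ} {q : ℝ≥0∞} {f : X → ℂ} {C : ℝ≥0∞}
    (h : P.eBesovNorm s p q f < C) : ∃ c, P.IsRep s p q c f ∧ P.cost p q c < C := by
  unfold Grid.eBesovNorm at h
  simp only [iInf_lt_iff] at h
  obtain ⟨c, hc, hlt⟩ := h
  exact ⟨c, hc, hlt⟩

lemma eBesovNormOn_univ (s p : ℝ) (q : ℝ≥0∞) (f : X → ℂ) :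
    P.eBesovNormOn s p q Set.univ f = P.eBesovNorm s p q f := by
  simp [Grid.eBesovNormOn, Grid.eBesovNorm]

lemma eBesovNormOn_tsum_le {ι : Type*} [Countable ι] {s p : ℝ} (hs : 0 < s) (hp : 1 ≤ p)
    {q : ℝ≥0∞} (hq : 1 ≤ q) (W : Set X) {f : ι → X → ℂ} {F : X → ℂ}
    (hF : ∀ᵐ x ∂m, HasSum (fun i => f i x) (F x)) :
    P.eBesovNormOn s p q W F ≤ ∑' i, P.eBesovNormOn s p q W (f i) := by
  refine ENNReal.le_of_forall_pos_le_add fun ε hε hlt => ?_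
  obtain ⟨ε', hε', hsum⟩ := ENNReal.exists_pos_sum_of_countable (ε := (ε : ℝ≥0∞))
    (by exact_mod_cast hε.ne') ι
  have hne : ∀ i, P.eBesovNormOn s p q W (f i) ≠ ∞ := fun i =>
    ((ENNReal.le_tsum i).trans_lt hlt).ne
  choose c hc hcost using fun i => P.exists_isRepOn (ENNReal.lt_add_right (hne i)
    (b := (ε' i : ℝ≥0∞)) (by exact_mod_cast (hε' i).ne'))
  have hle : ∑' i, P.cost p q (c i) ≤ ∑' i, P.eBesovNormOn s p q W (f i) + ε := by
    refine (ENNReal.tsum_le_tsum fun i => (hcost i).le).trans ?_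
    rw [ENNReal.tsum_add]
    gcongr
  refine (P.eBesovNormOn_le (c := fun k Q => ∑' i, c i k Q) ⟨P.isRep_tsum hs hp hq
    (fun i => (hc i).1) (ne_top_of_le_ne_top ?_ hle) hF, fun k Q hQ hQW => ?_⟩).trans
    ((cost_tsum_le _ hp hq c).trans hle)
  · exact ENNReal.add_ne_top.2 ⟨hlt.ne, ENNReal.coe_ne_top⟩
  · simp [(hc _).2 k Q hQ hQW]

lemma eBesovNormOn_smul_le {s p : ℝ} (hp : 1 ≤ p) {q : ℝ≥0∞} (hq : 1 ≤ q) (W : Set X) (a : ℂ)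
    {f : X → ℂ} {C : ℝ≥0∞} (hf : P.eBesovNormOn s p q W f ≤ C) (hC : C ≠ ∞) :
    P.eBesovNormOn s p q W (fun x => a * f x) ≤ ‖a‖ₑ * C := by
  have key : ∀ C' : ℝ≥0∞, C < C' → P.eBesovNormOn s p q W (fun x => a * f x) ≤ ‖a‖ₑ * C' := by
    intro C' hC'
    obtain ⟨c, hc, hlt⟩ := P.exists_isRepOn (hf.trans_lt hC')
    refine (P.eBesovNormOn_le (c := a • c) ⟨Grid.IsRep.smul _ hp hq a hc.1, ?_⟩).trans ?_
    · intro k Q hQ hQW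
      simp [hc.2 k Q hQ hQW]
    · rw [P.cost_smul hp hq]
      gcongr
  have hlim : Tendsto (fun C' => ‖a‖ₑ * C') (𝓝[>] C) (𝓝 (‖a‖ₑ * C)) :=
    (ENNReal.Tendsto.const_mul tendsto_id (Or.inr enorm_ne_top)).mono_left nhdsWithin_le_nhds
  have : (𝓝[>] C).NeBot := nhdsGT_neBot_of_exists_gt ⟨∞, hC.lt_top⟩
  refine ge_of_tendsto hlim ?_
  filter_upwards [self_mem_nhdsWithin] with C' hC' using key C' hC'

/-- The embedding of `B^s_{p,q}(W)` into `L^p`, with the optimal dependence on `W`. -/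
lemma eLpNorm_le_eBesovNormOn {s p : ℝ} (hs : 0 < s) (hp : 1 ≤ p) {q : ℝ≥0∞} (hq : 1 ≤ q)
    {l : ℕ} {W : Set X} (hW : W ∈ P.level l) (f : X → ℂ) :
    eLpNorm f (ENNReal.ofReal p) m ≤
      P.embConst s * ENNReal.ofReal (m.real W ^ s) * P.eBesovNormOn s p q W f := by
  set K := P.embConst s * ENNReal.ofReal (m.real W ^ s) with hK
  have hW0 := P.real_pos hW
  have hKtop : K ≠ ∞ := ENNReal.mul_ne_top (P.embConst_ne_top hs) ENNReal.ofReal_ne_top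
  have key : ∀ c, P.IsRepOn s p q W c f →
      eLpNorm f (ENNReal.ofReal p) m ≤ K * P.cost p q c := by
    intro c hc
    refine (eLpNorm_le_tsum hp (aestronglyMeasurable_layer _ s p c)
      ((P.isRep_iff hs hp hq).1 hc.1).1).trans ?_
    rw [← sum_add_tsum_add_eq _ l, Finset.sum_eq_zero, zero_add]
    · rw [hK, embConst, ← ENNReal.tsum_mul_right, ← ENNReal.tsum_mul_right]
      refine ENNReal.tsum_le_tsum fun k => ?_
      have hlam : 0 ≤ P.lam₂ ^ k := pow_nonneg P.lam₂_pos.le k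
      refine (P.eLpNorm_layer_le_of_le hs hp c (k + l) (M := P.lam₂ ^ k * m.real W)
        (by positivity) fun Q hQ hne => ?_).trans ?_
      · have hQW : Q ⊆ W := by_contra fun h => hne (hc.2 _ Q hQ h)
        simpa using (P.level_le_of_subset hQ hW hQW).2
      · rw [Real.mul_rpow hlam hW0.le, ENNReal.ofReal_mul (by positivity)]
        gcongr
        exact le_ellNorm hq _ _
    · intro k hk
      have hz : ∀ Q ∈ P.level k, c k Q = 0 := fun Q hQ => hc.2 k Q hQ fun hQW => by
        have := (P.level_le_of_subset hQ hW hQW).1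
        have := Finset.mem_range.1 hk
        omega
      have : P.layer s p c k = 0 := by
        funext x
        exact Finset.sum_eq_zero fun Q hQ => by simp [hz Q hQ]
      rw [this, eLpNorm_zero]
  by_cases htop : P.eBesovNormOn s p q W f = ∞
  · rw [htop, ENNReal.mul_top]
    · exact le_top
    · have h1 : P.embConst s ≠ 0 := by
        have : ENNReal.ofReal ((P.lam₂ ^ 0) ^ s) ≤ P.embConst s := ENNReal.le_tsum 0
        intro h
        simp [h] at this
      exact mul_ne_zero h1 (by simpa using by positivity)
  · have hlim : Tendsto (fun C' => K * C') (𝓝[>] (P.eBesovNormOn s p q W f))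
        (𝓝 (K * P.eBesovNormOn s p q W f)) :=
      (ENNReal.Tendsto.const_mul tendsto_id (Or.inr hKtop)).mono_left nhdsWithin_le_nhds
    have : (𝓝[>] (P.eBesovNormOn s p q W f)).NeBot :=
      nhdsGT_neBot_of_exists_gt ⟨∞, lt_top_iff_ne_top.2 htop⟩
    refine ge_of_tendsto hlim ?_
    filter_upwards [self_mem_nhdsWithin] with C' hC'
    obtain ⟨c, hc, hlt⟩ := P.exists_isRepOn hC'
    exact (key c hc).trans (by gcongr)

end GoodGrid

end BesovGrid

namespace BesovGrid

variable {X : Type*} [MeasurableSpace X] {m : Measure X} [IsProbabilityMeasure m]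

namespace GoodGrid

variable (P : GoodGrid m)

lemma isPiSystem_levels : IsPiSystem {Q | ∃ k, Q ∈ P.level k} := by
  have key : ∀ k l Q R, Q ∈ P.level k → R ∈ P.level l → l ≤ k → (Q ∩ R).Nonempty → Q ∩ R = Q := by
    rintro k l Q R hQ hR hlk ⟨x, hxQ, hxR⟩
    obtain ⟨n, rfl⟩ := Nat.exists_eq_add_of_le hlk
    obtain ⟨S, hS, hQS, -⟩ := P.exists_ancestor l n Q hQ
    rw [P.eq_of_mem_level hS hR ⟨x, hQS hxQ, hxR⟩] at hQS
    exact Set.inter_eq_left.2 hQS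
  rintro Q ⟨k, hQ⟩ R ⟨l, hR⟩ hne
  rcases le_total l k with h | h
  · exact ⟨k, by rwa [key k l Q R hQ hR h hne]⟩
  · rw [Set.inter_comm] at hne ⊢
    exact ⟨l, by rwa [key l k R Q hR hQ h hne]⟩

/-- The canonical atoms have a representation of cost one. -/
lemma isRep_single {s p : ℝ} (hs : 0 < s) (hp : 1 ≤ p) {q : ℝ≥0∞} (hq : 1 ≤ q) {k : ℕ} {Q : Set X}
    (hQ : Q ∈ P.level k) : ∃ c : Coeff X, P.IsRepOn s p q Q c (P.atom s p Q) ∧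
      P.cost p q c ≤ 1 ∧ ∀ j R, R ≠ Q → c j R = 0 := by
  classical
  have h0 : 0 < p := by linarith
  set c : Coeff X := fun j R => if j = k ∧ R = Q then 1 else 0 with hc
  have hlev : ∀ j, P.levelNorm p c j = if j = k then 1 else 0 := by
    intro j
    unfold Grid.levelNorm
    split_ifs with hj
    · subst hj
      rw [Finset.sum_eq_single_of_mem Q hQ]
      · simp [hc]
      · intro R _ hne
        simp [hc, hne, h0]
    · rw [Finset.sum_eq_zero, ENNReal.zero_rpow_of_pos (by positivity)]
      intro R _
      simp [hc, hj, h0]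
  have hcost : P.cost p q c ≤ 1 := by
    unfold Grid.cost ellNorm
    simp_rw [hlev]
    split_ifs with h
    · refine iSup_le fun j => ?_
      split_ifs <;> simp
    · have h1 : 0 < q.toReal := by linarith [toReal_ge_one hq h]
      rw [tsum_eq_single k]
      · simp
      · intro j hj
        simp [hj, h1]
  refine ⟨c, ⟨(P.isRep_iff hs hp hq).2 ⟨Eventually.of_forall fun x => ?_,
    hcost.trans_lt ENNReal.one_lt_top⟩, fun j R _ hne => ?_⟩, hcost, fun j R hne => by simp [hc, hne]⟩
  · have h1 : P.layer s p c k x = P.atom s p Q x := by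
      unfold Grid.layer
      rw [Finset.sum_eq_single_of_mem Q hQ]
      · simp [hc]
      · intro R _ hne
        simp [hc, hne]
    rw [← h1]
    refine hasSum_single k fun j hj => ?_
    simp [Grid.layer, hc, hj]
  · have : R ≠ Q := by rintro rfl; exact hne subset_rfl
    simp [hc, this]

lemma convConst_ne_zero {s β p : ℝ} (hs : 0 < s) (hβ : 0 < β) (hp : 1 ≤ p) {q : ℝ≥0∞}
    (hq : 1 ≤ q) : P.convConst s β p q ≠ 0 := by
  have h0 : 0 < p := by linarith
  obtain ⟨c, hc, hcost, hoff⟩ := P.isRep_single hβ hp hq P.univ_mem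
  obtain ⟨d, hd, hdcost, hdoff⟩ := P.isRep_single hs hp hq P.univ_mem
  have hatom : ∀ t : ℝ, P.atom t p Set.univ = fun _ => 1 := fun t => by
    funext x; simp [Grid.atom]
  have hrep : P.IsBesovAtomRep s β p q d (fun k Q x => if Q = Set.univ then 1 else 0)
      (fun _ => 1) := by
    classical
    refine ⟨fun k Q hQ => ?_, ?_, hd.1.2⟩
    · by_cases hQu : Q = Set.univ
      · subst hQu
        have h1 := P.eBesovNormOn_le hc
        rw [hatom] at h1
        simpa [Grid.IsBesovAtom] using h1.trans hcost
      · have h1 := P.eBesovNormOn_le (s := β) (p := p) (q := q) (W := Q) (f := 0) (c := 0)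
          ⟨Grid.IsRep.zero _ hp hq, fun _ _ _ _ => rfl⟩
        have h2 : P.cost p q 0 = 0 := by simpa using P.cost_smul hp hq 0 0
        rw [h2] at h1
        refine le_trans ?_ (h1.trans zero_le)
        simp only [hQu, if_false]
        exact le_rfl
    · have h1 := hd.1.1
      rw [hatom] at h1
      convert h1 using 2 with k
      funext x
      refine Finset.sum_congr rfl fun Q _ => ?_
      by_cases hQu : Q = Set.univ
      · rw [hQu, hatom]; simp
      · simp [hdoff k Q hQu]
  intro hzero
  have hK := P.embConst_ne_top hs
  have hle : ∀ C : ℝ≥0∞, 0 < C → 1 ≤ P.embConst s * C := by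
    intro C hC
    have : P.convConst s β p q < C := by rw [hzero]; exact hC
    obtain ⟨C', hC', hlt⟩ := sInf_lt_iff.1 this
    obtain ⟨z, hz, hzc⟩ := hC' d _ _ hrep
    have h1 := eLpNorm_le_tsum hp (aestronglyMeasurable_layer _ s p z)
      ((P.isRep_iff hs hp hq).1 hz).1
    rw [eLpNorm_const _ (by simpa using h0) (IsProbabilityMeasure.ne_zero m)] at h1
    simp only [enorm_one, measure_univ, ENNReal.one_rpow, mul_one] at h1
    refine h1.trans ((P.tsum_eLpNorm_layer_le hs hp hq z).trans ?_)
    gcongr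
    calc P.cost p q z ≤ C' * P.cost p q d := hzc
      _ ≤ C * 1 := by gcongr
      _ = C := mul_one C
  have hlim : Tendsto (fun C => P.embConst s * C) (𝓝[>] 0) (𝓝 0) := by
    have := ENNReal.Tendsto.const_mul (a := P.embConst s) (tendsto_id (α := ℝ≥0∞) (x := 𝓝 0))
      (Or.inr hK)
    simpa using this.mono_left nhdsWithin_le_nhds
  have := ge_of_tendsto hlim (b := 1) (by
    filter_upwards [self_mem_nhdsWithin] with C hC using hle C hC)
  simp at this

end GoodGrid

/-! ## The Banach space `B^s_{p,q}` inside `L^1` -/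

namespace BesovSpace

variable {P : GoodGrid m} {e : BesovIndex}

lemma exists_of_eBesovNorm_ne_top {f : X → ℂ} (h : P.eBesovNorm e.s e.p e.q f ≠ ∞) :
    ∃ g : BesovSpace P e, g =ᵐ[m] f := by
  obtain ⟨c, hc, -⟩ := P.exists_isRep (lt_top_iff_ne_top.2 h)
  exact ⟨⟨hc.1.1.toLp f, c, Grid.IsRep.congr _ hc hc.1.1.coeFn_toLp.symm⟩, hc.1.1.coeFn_toLp⟩

lemma enorm_eq (f : BesovSpace P e) : ‖f‖ₑ = P.eBesovNorm e.s e.p e.q f := by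
  rw [← ofReal_norm, norm_def, ENNReal.ofReal_toReal f.eBesovNorm_ne_top]

lemma eLpNorm_le (f : BesovSpace P e) :
    eLpNorm f (ENNReal.ofReal e.p) m ≤ P.embConst e.s * ‖f‖ₑ := by
  have := P.eLpNorm_le_eBesovNormOn e.s_pos e.one_le_p e.one_le_q P.univ_mem (f : X → ℂ)
  rw [GoodGrid.eBesovNormOn_univ, ← enorm_eq] at this
  simpa using this

lemma coeFn_sum {ι : Type*} (t : Finset ι) (u : ι → BesovSpace P e) :
    ⇑(∑ i ∈ t, u i) =ᵐ[m] fun x => ∑ i ∈ t, u i x := by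
  classical
  induction t using Finset.induction_on with
  | empty =>
    filter_upwards [Lp.coeFn_zero ℂ (ENNReal.ofReal e.p) m] with x hx
    rw [Finset.sum_empty, Finset.sum_empty]
    exact hx
  | insert i t hi ih =>
    rw [Finset.sum_insert hi]
    filter_upwards [coeFn_add (u i) (∑ i ∈ t, u i), ih] with x hx hx'
    rw [hx, Pi.add_apply, hx', Finset.sum_insert hi]

lemma coeFn_sub (f g : BesovSpace P e) : ⇑(f - g) =ᵐ[m] ⇑f - ⇑g := Lp.coeFn_sub f.toLp g.toLp

instance : CompleteSpace (BesovSpace P e) := by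
  refine NormedAddCommGroup.completeSpace_of_summable_imp_tendsto fun u hu => ?_
  have hu' : ∑' i, ‖u i‖ₑ ≠ ∞ := tsum_enorm_ne_top_iff_summable_norm.2 hu
  have h1 : ∀ᵐ x ∂m, HasSum (fun i => u i x) (∑' i, u i x) := by
    have : ∀ᵐ x ∂m, Summable fun i => ‖u i x‖ := by
      refine summable_norm_of_tsum_eLpNorm_ne_top (one_le_ofReal e.one_le_p)
        (fun i => Lp.aestronglyMeasurable _) (ne_top_of_le_ne_top
          (b := P.embConst e.s * ∑' i, ‖u i‖ₑ) (ENNReal.mul_ne_top (P.embConst_ne_top e.s_pos) hu')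
          ?_)
      rw [← ENNReal.tsum_mul_left]
      exact ENNReal.tsum_le_tsum fun i => (u i).eLpNorm_le
    filter_upwards [this] with x hx using hx.of_norm.hasSum
  have key : ∀ (n : ℕ) (F : X → ℂ), (∀ᵐ x ∂m, HasSum (fun i => u (i + n) x) (F x)) →
      P.eBesovNorm e.s e.p e.q F ≤ ∑' i, ‖u (i + n)‖ₑ := by
    intro n F hF
    simp_rw [enorm_eq, ← GoodGrid.eBesovNormOn_univ]
    exact P.eBesovNormOn_tsum_le e.s_pos e.one_le_p e.one_le_q Set.univ hF
  obtain ⟨g, hg⟩ := exists_of_eBesovNorm_ne_top (ne_top_of_le_ne_top hu' (key 0 _ h1))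
  refine ⟨g, ?_⟩
  rw [tendsto_iff_edist_tendsto_0]
  refine tendsto_of_tendsto_of_tendsto_of_le_of_le tendsto_const_nhds
    (ENNReal.tendsto_sum_nat_add (fun i => ‖u i‖ₑ) hu') (fun _ => zero_le) fun n => ?_
  dsimp only
  rw [edist_comm, edist_eq_enorm_sub, enorm_eq]
  refine key n _ ?_
  filter_upwards [h1, hg, coeFn_sub g (∑ i ∈ Finset.range n, u i),
    coeFn_sum (Finset.range n) u] with x h1 h2 h3 h4
  rw [h3, Pi.sub_apply, h4, h2]
  exact (hasSum_nat_add_iff' n).2 h1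

lemma memLp_one (f : BesovSpace P e) : MemLp f 1 m :=
  (Lp.memLp f.toLp).mono_exponent (one_le_ofReal e.one_le_p)

/-- The inclusion of `B^s_{p,q}` into `L^1`. -/
def inclL1 : BesovSpace P e →L[ℂ] Lp ℂ 1 m :=
  LinearMap.mkContinuous
    { toFun := fun f => f.memLp_one.toLp f
      map_add' := fun f g => Lp.ext <| by
        filter_upwards [(f + g).memLp_one.coeFn_toLp, f.memLp_one.coeFn_toLp,
          g.memLp_one.coeFn_toLp, coeFn_add f g,
          Lp.coeFn_add (f.memLp_one.toLp f) (g.memLp_one.toLp g)] with x h1 h2 h3 h4 h5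
        rw [h1, h5, h4, Pi.add_apply, Pi.add_apply, h2, h3]
      map_smul' := fun a f => Lp.ext <| by
        filter_upwards [(a • f).memLp_one.coeFn_toLp, f.memLp_one.coeFn_toLp, coeFn_smul a f,
          Lp.coeFn_smul a (f.memLp_one.toLp f)] with x h1 h2 h3 h4
        rw [RingHom.id_apply, h1, h4, h3, Pi.smul_apply, Pi.smul_apply, h2] }
    (P.embConst e.s).toReal fun f => by
      have h1 : ‖f.memLp_one.toLp f‖ₑ ≤ P.embConst e.s * ‖f‖ₑ := by
        rw [Lp.enorm_toLp]
        exact (eLpNorm_le_eLpNorm_of_exponent_le (one_le_ofReal e.one_le_p)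
          f.memLp_one.1).trans f.eLpNorm_le
      have h2 := ENNReal.toReal_mono
        (ENNReal.mul_ne_top (P.embConst_ne_top e.s_pos) enorm_ne_top) h1
      simpa [ENNReal.toReal_mul] using h2

lemma coeFn_inclL1 (f : BesovSpace P e) : inclL1 f =ᵐ[m] f := f.memLp_one.coeFn_toLp

lemma inclL1_injective : Function.Injective (inclL1 : BesovSpace P e → Lp ℂ 1 m) := by
  intro f g h
  have h1 : f =ᵐ[m] g := (coeFn_inclL1 f).symm.trans (h ▸ coeFn_inclL1 g)
  exact Subtype.ext (Lp.ext h1)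

/-- The canonical atom of `Q`, as an element of `B^s_{p,q}`. -/
lemma exists_atom {k : ℕ} {Q : Set X} (hQ : Q ∈ P.level k) :
    ∃ g : BesovSpace P e, g =ᵐ[m] P.atom e.s e.p Q := by
  obtain ⟨c, hc, -, -⟩ := P.isRep_single e.s_pos e.one_le_p e.one_le_q hQ
  exact exists_of_eBesovNorm_ne_top ((P.eBesovNorm_le hc.1).trans_lt hc.1.2).ne

lemma exists_indicator {k : ℕ} {Q : Set X} (hQ : Q ∈ P.level k) (a : ℂ) :
    ∃ g : BesovSpace P e, g =ᵐ[m] Q.indicator fun _ => a := by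
  obtain ⟨g, hg⟩ := exists_atom (e := e) hQ
  have hQ0 := P.real_pos hQ
  have hne : ((m.real Q ^ (e.s - 1 / e.p) : ℝ) : ℂ) ≠ 0 := by
    exact_mod_cast (Real.rpow_pos_of_pos hQ0 _).ne'
  refine ⟨(a / ((m.real Q ^ (e.s - 1 / e.p) : ℝ) : ℂ)) • g, ?_⟩
  filter_upwards [coeFn_smul (a / ((m.real Q ^ (e.s - 1 / e.p) : ℝ) : ℂ)) g, hg] with x h1 h2
  rw [h1, Pi.smul_apply, h2, Grid.atom]
  by_cases hx : x ∈ Q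
  · simp only [hx, Set.indicator_of_mem, smul_eq_mul]
    exact div_mul_cancel₀ _ hne
  · simp [hx]

/-- `B^s_{p,q}` is dense in `L^1`. -/
lemma dense_range_inclL1 : DenseRange (inclL1 : BesovSpace P e → Lp ℂ 1 m) := by
  set V : Submodule ℂ (Lp ℂ 1 m) :=
    (LinearMap.range (inclL1 (P := P) (e := e)).toLinearMap).topologicalClosure with hV
  have hVc : IsClosed (V : Set (Lp ℂ 1 m)) := Submodule.isClosed_topologicalClosure _
  have hind : ∀ {k : ℕ} {Q : Set X} (hQ : Q ∈ P.level k) (a : ℂ),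
      indicatorConstLp 1 (P.measurableSet k Q hQ) (measure_ne_top m Q) a ∈ V := by
    intro k Q hQ a
    obtain ⟨g, hg⟩ := exists_indicator (e := e) hQ a
    refine Submodule.le_topologicalClosure _ ⟨g, Lp.ext ?_⟩
    exact (coeFn_inclL1 g).trans (hg.trans indicatorConstLp_coeFn.symm)
  have hall : ∀ (a : ℂ) (A : Set X) (hA : MeasurableSet A),
      indicatorConstLp 1 hA (measure_ne_top m A) a ∈ V := by
    intro a A hA
    induction A, hA using MeasurableSpace.induction_on_inter P.generates.symm
      P.isPiSystem_levels with
    | empty => simp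
    | basic t ht =>
      obtain ⟨k, hk⟩ := ht
      exact hind hk a
    | compl t htm ih =>
      have h1 : indicatorConstLp 1 htm.compl (measure_ne_top m tᶜ) a =
          indicatorConstLp 1 MeasurableSet.univ (measure_ne_top m Set.univ) a -
            indicatorConstLp 1 htm (measure_ne_top m t) a := by
        rw [eq_sub_iff_add_eq, ← indicatorConstLp_disjoint_union htm.compl htm
          (measure_ne_top _ _) (measure_ne_top _ _) disjoint_compl_left]
        congr 1
        exact Set.compl_union_self t
      rw [h1]
      exact V.sub_mem (hind P.univ_mem a) ih
    | iUnion f hd hf ih =>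
      have hacc : ∀ n, MeasurableSet (Set.accumulate f n) := fun n =>
        MeasurableSet.biUnion (Set.to_countable _) fun i _ => hf i
      have h1 : ∀ n, indicatorConstLp 1 (hacc n) (measure_ne_top m _) a ∈ V := by
        intro n
        induction n with
        | zero =>
          convert ih 0 using 2
          simp [Set.accumulate_def]
        | succ n ihn =>
          have h2 : indicatorConstLp 1 (hacc (n + 1)) (measure_ne_top m _) a =
              indicatorConstLp 1 (hacc n) (measure_ne_top m _) a +
              indicatorConstLp 1 (hf (n + 1)) (measure_ne_top m _) a := by
            rw [← indicatorConstLp_disjoint_union (hacc n) (hf (n + 1))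
              (measure_ne_top _ _) (measure_ne_top _ _) (Set.disjoint_accumulate hd n.lt_succ_self)]
            congr 1
            exact Set.accumulate_succ f n
          rw [h2]
          exact V.add_mem ihn (ih (n + 1))
      refine hVc.mem_of_tendsto (tendsto_indicatorConstLp_set (hp₁ := ⟨le_rfl⟩)
        ENNReal.one_ne_top (t := fun n => Set.accumulate f n) (ht := hacc)
        (hμt := fun n => measure_ne_top m _) (l := atTop) ?_) (Eventually.of_forall h1)
      have h3 : Tendsto (fun n => m (⋃ i, f i) - m (Set.accumulate f n)) atTop (𝓝 0) := by
        have h4 : Tendsto (fun n => m (Set.accumulate f n)) atTop (𝓝 (m (⋃ i, f i))) :=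
          tendsto_measure_iUnion_accumulate
        have h5 := ENNReal.Tendsto.sub (tendsto_const_nhds (x := m (⋃ i, f i))) h4
          (Or.inl (measure_ne_top _ _))
        simpa using h5
      refine h3.congr fun n => ?_
      have hsub : Set.accumulate f n ⊆ ⋃ i, f i := by
        rw [← Set.iUnion_accumulate]; exact Set.subset_iUnion (Set.accumulate f) n
      rw [symmDiff_of_le hsub, measure_sdiff hsub (hacc n).nullMeasurableSet (measure_ne_top _ _)]
  have htop : ∀ u : Lp ℂ 1 m, u ∈ V := by
    intro u
    induction u using Lp.induction ENNReal.one_ne_top with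
    | indicatorConst c hs hμs => exact hall c _ hs
    | add hf hg _ h1 h2 => exact V.add_mem h1 h2
    | isClosed => exact hVc
  intro u
  have hu := htop u
  rwa [hV, ← SetLike.mem_coe, Submodule.topologicalClosure_coe, LinearMap.coe_range] at hu

end BesovSpace

end BesovGrid

namespace BesovGrid

variable {X : Type*} [MeasurableSpace X] {m : Measure X} [IsProbabilityMeasure m]

/-! ## The transfer operator on `L^1` -/

namespace Branch

variable {P : GoodGrid m} {s p : ℝ} (B : Branch P P s p)

open Classical in
/-- The map of the branch, extended by the identity. -/
def ext (x : X) : X := if hx : x ∈ B.dom then B.h ⟨x, hx⟩ else x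

lemma ext_of_mem {x : X} (hx : x ∈ B.dom) : B.ext x = B.h ⟨x, hx⟩ := by simp [ext, hx]

lemma ext_mem_ran {x : X} (hx : x ∈ B.dom) : B.ext x ∈ B.ran := by
  rw [B.ext_of_mem hx]; exact (B.h ⟨x, hx⟩).2

lemma measurable_ext : Measurable B.ext := by
  classical
  refine Measurable.dite (s := B.dom) (f := fun x => (B.h x : X)) (g := fun x => (x : X))
    ?_ measurable_subtype_coe B.measurableSet_dom
  exact measurable_subtype_coe.comp B.h.measurable

lemma mem_pre_iff {Q : Set X} {x : X} : x ∈ B.pre Q ↔ x ∈ B.dom ∧ B.ext x ∈ Q := by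
  constructor
  · rintro ⟨hx, hq⟩
    exact ⟨hx, by rwa [B.ext_of_mem hx]⟩
  · rintro ⟨hx, hq⟩
    exact ⟨hx, by rwa [B.ext_of_mem hx] at hq⟩

lemma ae_ext {p : X → Prop} (h : ∀ᵐ y ∂m, p y) : ∀ᵐ x ∂m, x ∈ B.dom → p (B.ext x) := by
  rw [ae_iff] at h ⊢
  set N := toMeasurable m {y | ¬ p y} ∩ B.ran with hN
  have h1 : MeasurableSet N := (measurableSet_toMeasurable _ _).inter B.measurableSet_ran
  have h2 : m N = 0 := measure_mono_null Set.inter_subset_left (by rwa [measure_toMeasurable])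
  refine measure_mono_null (fun x hx => ?_) ((B.null_iff N h1 Set.inter_subset_right).1 h2)
  simp only [Set.mem_ofPred_eq, Classical.not_imp] at hx
  exact B.mem_pre_iff.2 ⟨hx.1, subset_toMeasurable _ _ hx.2, B.ext_mem_ran hx.1⟩

lemma apply_eq (g f : X → ℂ) (x : X) : B.apply g f x = B.dom.indicator g x * f (B.ext x) := by
  by_cases hx : x ∈ B.dom
  · simp [apply, hx, B.ext_of_mem hx]
  · simp [apply, hx]

end Branch

/-- The equality case of the triangle inequality for series with nonnegative weights. -/
lemma hasSum_sgn_zpow {ι : Type*} {w : ι → ℝ} (hw : ∀ i, 0 ≤ w i) {y : ι → ℂ} {y₀ z : ℂ}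
    (hz : ‖z‖ = 1) (h : HasSum (fun i => (w i : ℂ) * y i) (z * y₀))
    (hn : HasSum (fun i => w i * ‖y i‖) ‖y₀‖) (k : ℤ) :
    HasSum (fun i => (w i : ℂ) * ((y i / (‖y i‖ : ℂ)) ^ k * (‖y i‖ : ℂ)))
      (z ^ k * ((y₀ / (‖y₀‖ : ℂ)) ^ k * (‖y₀‖ : ℂ))) := by
  have hz0 : z ≠ 0 := by rintro rfl; simp at hz
  suffices hterm : ∀ i, (w i : ℂ) * ((y i / (‖y i‖ : ℂ)) ^ k * (‖y i‖ : ℂ)) =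
      (z * (y₀ / (‖y₀‖ : ℂ))) ^ k * ((w i * ‖y i‖ : ℝ) : ℂ) by
    simp_rw [hterm]
    rw [← mul_assoc, ← mul_zpow]
    exact ((Complex.hasSum_ofReal (L := SummationFilter.unconditional ι)).2 hn).mul_left _
  by_cases hy : y₀ = 0
  · intro i
    rw [hy, norm_zero] at hn
    have h1 := (hasSum_zero_iff_of_nonneg fun i => mul_nonneg (hw i) (norm_nonneg (y i))).1 hn
    have h2 : w i * ‖y i‖ = 0 := congrFun h1 i
    have h3 : (w i : ℂ) * (‖y i‖ : ℂ) = 0 := by exact_mod_cast h2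
    rw [h2, mul_left_comm, h3]
    simp
  set σ : ℂ := z * (y₀ / (‖y₀‖ : ℂ)) with hσ
  have hσ1 : ‖σ‖ = 1 := by
    rw [hσ, norm_mul, hz, norm_div, Complex.norm_real, norm_norm, one_mul,
      div_self (norm_ne_zero_iff.2 hy)]
  have hσc : (starRingEnd ℂ) σ * σ = 1 := by
    rw [mul_comm, Complex.mul_conj, Complex.normSq_eq_norm_sq, hσ1]; simp
  have hzy : z * y₀ = σ * (‖y₀‖ : ℂ) := by
    have : (‖y₀‖ : ℂ) ≠ 0 := by simpa using hy
    rw [hσ, mul_assoc, div_mul_cancel₀ _ this]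
  have h1 := h.mul_left ((starRingEnd ℂ) σ)
  rw [hzy, ← mul_assoc, hσc, one_mul] at h1
  have h2 := (Complex.hasSum_re h1)
  rw [Complex.ofReal_re] at h2
  have h3 := hn.sub h2
  rw [sub_self] at h3
  have hre : ∀ i, ((starRingEnd ℂ) σ * ((w i : ℂ) * y i)).re =
      w i * ((starRingEnd ℂ) σ * y i).re := fun i => by
    rw [mul_left_comm, Complex.re_ofReal_mul]
  have hnorm : ∀ i, ‖(starRingEnd ℂ) σ * y i‖ = ‖y i‖ := fun i => by
    rw [norm_mul, RCLike.norm_conj, hσ1, one_mul]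
  have h4 := (hasSum_zero_iff_of_nonneg fun i => by
    rw [hre, ← mul_sub]
    refine mul_nonneg (hw i) (sub_nonneg.2 ?_)
    rw [← hnorm]
    exact Complex.re_le_norm _).1 h3
  intro i
  have h5 := congrFun h4 i
  simp only [hre, ← mul_sub, Pi.zero_apply, mul_eq_zero] at h5
  rcases h5 with h5 | h5
  · simp [h5]
  by_cases hyi : y i = 0
  · simp [hyi]
  have h6 : (starRingEnd ℂ) σ * y i = (‖y i‖ : ℂ) := by
    rw [← hnorm i]
    refine Complex.eq_coe_norm_of_nonneg (Complex.re_eq_norm.1 ?_)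
    rw [hnorm]
    linarith
  have h7 : y i / (‖y i‖ : ℂ) = σ := by
    have hne : (‖y i‖ : ℂ) ≠ 0 := by simpa using hyi
    rw [div_eq_iff hne, ← h6, ← mul_assoc, mul_comm σ, hσc, one_mul]
  rw [h7]
  push_cast
  ring

namespace TransferSystem

variable {P : GoodGrid m} {e : BesovIndex} (S : TransferSystem P P e)

/-- The potential of the `r`-th branch, extended by zero. -/
def weight (r : S.Λ) : X → ℂ := (S.branch r).dom.indicator (S.g r)

lemma part_eq (r : S.Λ) (f : X → ℂ) (x : X) :
    S.part r f x = S.weight r x * f ((S.branch r).ext x) := (S.branch r).apply_eq _ _ _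

lemma part_congr {f g : X → ℂ} (h : f =ᵐ[m] g) : ∀ᵐ x ∂m, ∀ r, S.part r f x = S.part r g x := by
  refine ae_all_iff.2 fun r => ?_
  filter_upwards [(S.branch r).ae_ext h] with x hx
  rw [part_eq, part_eq]
  by_cases hxd : x ∈ (S.branch r).dom
  · rw [hx hxd]
  · simp [weight, hxd]

lemma transfer_congr {f g : X → ℂ} (h : f =ᵐ[m] g) : S.transfer f =ᵐ[m] S.transfer g := by
  filter_upwards [S.part_congr h] with x hx
  simp only [transfer, hx]

variable {S}

lemma aestronglyMeasurable_weight (hfam : S.FamilyOK) (r : S.Λ) :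
    AEStronglyMeasurable (S.weight r) m :=
  (aestronglyMeasurable_indicator_iff (S.branch r).measurableSet_dom).2
    (hfam.aestronglyMeasurable r)

lemma aestronglyMeasurable_part (hfam : S.FamilyOK) (r : S.Λ) {f : X → ℂ}
    (hf : AEStronglyMeasurable f m) : AEStronglyMeasurable (S.part r f) m := by
  have h1 : AEStronglyMeasurable (fun x => S.weight r x * hf.mk f ((S.branch r).ext x)) m :=
    (aestronglyMeasurable_weight hfam r).mul
      (hf.stronglyMeasurable_mk.comp_measurable (S.branch r).measurable_ext).aestronglyMeasurable
  refine h1.congr ?_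
  filter_upwards [S.part_congr hf.ae_eq_mk] with x hx
  rw [hx r, part_eq]

lemma weight_eq_norm (hpos : ∀ r, ∀ᵐ x ∂m, x ∈ (S.branch r).dom →
    0 ≤ (S.g r x).re ∧ (S.g r x).im = 0) :
    ∀ᵐ x ∂m, ∀ r, S.weight r x = ((‖S.weight r x‖ : ℝ) : ℂ) := by
  refine ae_all_iff.2 fun r => ?_
  filter_upwards [hpos r] with x hx
  refine Complex.eq_coe_norm_of_nonneg ?_
  by_cases hxd : x ∈ (S.branch r).dom
  · rw [weight, Set.indicator_of_mem hxd, Complex.le_def]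
    exact ⟨(hx hxd).1, by simp [(hx hxd).2]⟩
  · simp [weight, hxd]

/-- The measure identity that expresses that `Φ` preserves integrals. -/
lemma tsum_lintegral_weight_mul (hfam : S.FamilyOK) (hL1 : S.BoundedToL1)
    (hpos : ∀ r, ∀ᵐ x ∂m, x ∈ (S.branch r).dom → 0 ≤ (S.g r x).re ∧ (S.g r x).im = 0)
    (hint : ∀ f : BesovSpace P e, ∫ x, S.transfer f x ∂m = ∫ x, f x ∂m)
    {φ : X → ℝ≥0∞} (hφ : Measurable φ) :
    ∑' r, ∫⁻ x, ‖S.weight r x‖ₑ * φ ((S.branch r).ext x) ∂m = ∫⁻ x, φ x ∂m := by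
  set κ : S.Λ → Measure X := fun r =>
    Measure.map (S.branch r).ext (m.withDensity fun x => ‖S.weight r x‖ₑ) with hκ
  have hν : ∀ φ : X → ℝ≥0∞, Measurable φ → ∫⁻ x, φ x ∂(Measure.sum κ) =
      ∑' r, ∫⁻ x, ‖S.weight r x‖ₑ * φ ((S.branch r).ext x) ∂m := by
    intro φ hφ
    rw [lintegral_sum_measure]
    refine tsum_congr fun r => ?_
    rw [hκ, lintegral_map hφ (S.branch r).measurable_ext,
      lintegral_withDensity_eq_lintegral_mul₀ (g := fun x => φ ((S.branch r).ext x))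
        (aestronglyMeasurable_weight hfam r).enorm
        (hφ.comp (S.branch r).measurable_ext).aemeasurable]
    rfl
  have hlev : ∀ k, ∀ Q ∈ P.level k, m Q = Measure.sum κ Q := by
    intro k Q hQ
    have hQm := P.measurableSet k Q hQ
    set f : X → ℂ := Q.indicator fun _ => 1 with hf
    have hfm : Measurable f := measurable_const.indicator hQm
    have hpm : ∀ r, AEStronglyMeasurable (S.part r f) m := fun r =>
      aestronglyMeasurable_part hfam r hfm.aestronglyMeasurable
    have h1 : Measure.sum κ Q = ∑' r, ∫⁻ x, ‖S.part r f x‖ₑ ∂m := by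
      rw [← lintegral_indicator_one hQm, hν _ (measurable_one.indicator hQm)]
      refine tsum_congr fun r => lintegral_congr fun x => ?_
      rw [part_eq, enorm_mul]
      congr 1
      by_cases hx : (S.branch r).ext x ∈ Q <;> simp [hf, hx]
    have hfin : ∑' r, ∫⁻ x, ‖S.part r f x‖ₑ ∂m ≠ ∞ := by
      obtain ⟨C, hC⟩ := hL1
      have hmem : MemLp f (ENNReal.ofReal S.t₀) m :=
        memLp_indicator_const _ hQm 1 (Or.inr (measure_ne_top _ _))
      have h2 := (hC f hmem).2
      simp_rw [eLpNorm_one_eq_lintegral_enorm] at h2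
      exact ne_top_of_le_ne_top (ENNReal.mul_ne_top ENNReal.coe_ne_top hmem.2.ne) h2
    have hpart : ∀ r, ∫ x, S.part r f x ∂m = (((∫⁻ x, ‖S.part r f x‖ₑ ∂m).toReal : ℝ) : ℂ) := by
      intro r
      rw [← integral_norm_eq_lintegral_enorm (hpm r), ← integral_complex_ofReal]
      refine integral_congr_ae ?_
      filter_upwards [weight_eq_norm hpos] with x hx
      refine Complex.eq_coe_norm_of_nonneg ?_
      rw [part_eq, hx r, hf]
      by_cases hxQ : (S.branch r).ext x ∈ Q <;> simp [hxQ]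
    have h3 : ∫ x, S.transfer f x ∂m =
        (((∑' r, ∫⁻ x, ‖S.part r f x‖ₑ ∂m).toReal : ℝ) : ℂ) := by
      unfold transfer
      rw [integral_tsum hpm hfin, ENNReal.tsum_toReal_eq, Complex.ofReal_tsum]
      · exact tsum_congr hpart
      · exact fun r => ne_top_of_le_ne_top hfin (ENNReal.le_tsum r)
    obtain ⟨g, hg⟩ := BesovSpace.exists_indicator (e := e) hQ 1
    have h4 := hint g
    rw [integral_congr_ae (S.transfer_congr hg), integral_congr_ae hg, h3,
      integral_indicator_const _ hQm] at h4
    have h5 : (∑' r, ∫⁻ x, ‖S.part r f x‖ₑ ∂m).toReal = m.real Q := by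
      have h6 : (((∑' r, ∫⁻ x, ‖S.part r f x‖ₑ ∂m).toReal : ℝ) : ℂ) = ((m.real Q : ℝ) : ℂ) := by
        rw [h4]; simp
      exact_mod_cast h6
    rw [h1, ← ENNReal.ofReal_toReal hfin, h5, Measure.real,
      ENNReal.ofReal_toReal (measure_ne_top _ _)]
  have heq : m = Measure.sum κ := by
    refine ext_of_generate_finite _ P.generates.symm P.isPiSystem_levels ?_ ?_
    · rintro Q ⟨k, hQ⟩
      exact hlev k Q hQ
    · exact hlev 0 _ P.univ_mem
  rw [← hν φ hφ, ← heq]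

variable (S) in
/-- `Φ` preserves integrals of nonnegative functions, and the branches have nonnegative
weights. -/
structure IsMarkov : Prop where
  family : S.FamilyOK
  weight_eq : ∀ᵐ x ∂m, ∀ r, S.weight r x = ((‖S.weight r x‖ : ℝ) : ℂ)
  tsum_lintegral : ∀ {φ : X → ℝ≥0∞}, Measurable φ →
    ∑' r, ∫⁻ x, ‖S.weight r x‖ₑ * φ ((S.branch r).ext x) ∂m = ∫⁻ x, φ x ∂m

namespace IsMarkov

lemma tsum_eLpNorm_part (hS : S.IsMarkov) {f : X → ℂ} (hf : AEStronglyMeasurable f m) :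
    ∑' r, eLpNorm (S.part r f) 1 m = eLpNorm f 1 m := by
  rw [eLpNorm_congr_ae hf.ae_eq_mk, eLpNorm_one_eq_lintegral_enorm,
    ← hS.tsum_lintegral hf.stronglyMeasurable_mk.measurable.enorm]
  refine tsum_congr fun r => ?_
  rw [eLpNorm_one_eq_lintegral_enorm]
  refine lintegral_congr_ae ?_
  filter_upwards [S.part_congr hf.ae_eq_mk] with x hx
  rw [hx, part_eq, enorm_mul]

lemma ae_summable_norm (hS : S.IsMarkov) {f : X → ℂ} (hf : Integrable f m) :
    ∀ᵐ x ∂m, Summable fun r => ‖S.part r f x‖ := by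
  refine summable_norm_of_tsum_eLpNorm_ne_top le_rfl
    (fun r => aestronglyMeasurable_part hS.family r hf.1) ?_
  rw [hS.tsum_eLpNorm_part hf.1]
  exact (memLp_one_iff_integrable.2 hf).2.ne

lemma ae_hasSum (hS : S.IsMarkov) {f : X → ℂ} (hf : Integrable f m) :
    ∀ᵐ x ∂m, HasSum (fun r => S.part r f x) (S.transfer f x) := by
  filter_upwards [hS.ae_summable_norm hf] with x hx using hx.of_norm.hasSum

lemma eLpNorm_transfer_le (hS : S.IsMarkov) {f : X → ℂ} (hf : Integrable f m) :
    eLpNorm (S.transfer f) 1 m ≤ eLpNorm f 1 m := by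
  rw [← hS.tsum_eLpNorm_part hf.1]
  simpa using eLpNorm_le_tsum (p := 1) le_rfl
    (fun r => aestronglyMeasurable_part hS.family r hf.1) (hS.ae_hasSum hf)

lemma memLp_transfer (hS : S.IsMarkov) {f : X → ℂ} (hf : Integrable f m) :
    MemLp (S.transfer f) 1 m :=
  ⟨aestronglyMeasurable_of_hasSum (fun r => aestronglyMeasurable_part hS.family r hf.1)
    (hS.ae_hasSum hf), (hS.eLpNorm_transfer_le hf).trans_lt (memLp_one_iff_integrable.2 hf).2⟩

lemma transfer_add (hS : S.IsMarkov) {f g : X → ℂ} (hf : Integrable f m) (hg : Integrable g m) :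
    S.transfer (f + g) =ᵐ[m] S.transfer f + S.transfer g := by
  filter_upwards [hS.ae_hasSum hf, hS.ae_hasSum hg] with x h1 h2
  refine HasSum.tsum_eq ?_
  have := h1.add h2
  simpa only [part_eq, Pi.add_apply, mul_add] using this

lemma transfer_smul (S : TransferSystem P P e) (a : ℂ) (f : X → ℂ) :
    S.transfer (a • f) = a • S.transfer f := by
  funext x
  simp only [transfer, part_eq, Pi.smul_apply, smul_eq_mul, mul_left_comm _ a, tsum_mul_left]

/-- The transfer operator on `L^1`. -/
def opL1 (hS : S.IsMarkov) : Lp ℂ 1 m →L[ℂ] Lp ℂ 1 m :=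
  LinearMap.mkContinuous
    { toFun := fun u => (hS.memLp_transfer (L1.integrable_coeFn u)).toLp _
      map_add' := fun u v => Lp.ext <| by
        filter_upwards [(hS.memLp_transfer (L1.integrable_coeFn (u + v))).coeFn_toLp,
          (hS.memLp_transfer (L1.integrable_coeFn u)).coeFn_toLp,
          (hS.memLp_transfer (L1.integrable_coeFn v)).coeFn_toLp,
          S.transfer_congr (Lp.coeFn_add u v),
          hS.transfer_add (L1.integrable_coeFn u) (L1.integrable_coeFn v),
          Lp.coeFn_add ((hS.memLp_transfer (L1.integrable_coeFn u)).toLp _)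
            ((hS.memLp_transfer (L1.integrable_coeFn v)).toLp _)] with x h1 h2 h3 h4 h5 h6
        rw [h1, h6, h4, h5, Pi.add_apply, Pi.add_apply, h2, h3]
      map_smul' := fun a u => Lp.ext <| by
        filter_upwards [(hS.memLp_transfer (L1.integrable_coeFn (a • u))).coeFn_toLp,
          (hS.memLp_transfer (L1.integrable_coeFn u)).coeFn_toLp,
          S.transfer_congr (Lp.coeFn_smul a u),
          Lp.coeFn_smul a ((hS.memLp_transfer (L1.integrable_coeFn u)).toLp _)]
          with x h1 h2 h3 h4
        rw [RingHom.id_apply, h1, h3, h4, transfer_smul, Pi.smul_apply, Pi.smul_apply, h2] }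
    1 fun u => by
      rw [one_mul]
      refine (Lp.norm_toLp _ (hS.memLp_transfer (L1.integrable_coeFn u))).trans_le ?_
      rw [Lp.norm_def]
      exact ENNReal.toReal_mono (Lp.eLpNorm_ne_top u)
        (hS.eLpNorm_transfer_le (L1.integrable_coeFn u))

lemma coeFn_opL1 (hS : S.IsMarkov) (u : Lp ℂ 1 m) : hS.opL1 u =ᵐ[m] S.transfer u :=
  (hS.memLp_transfer (L1.integrable_coeFn u)).coeFn_toLp

lemma norm_opL1_le (hS : S.IsMarkov) (u : Lp ℂ 1 m) : ‖hS.opL1 u‖ ≤ ‖u‖ := by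
  rw [Lp.norm_def, Lp.norm_def, eLpNorm_congr_ae (hS.coeFn_opL1 u)]
  exact ENNReal.toReal_mono (Lp.eLpNorm_ne_top u)
    (hS.eLpNorm_transfer_le (L1.integrable_coeFn u))

/-- The powers of the sign of an eigenfunction for an eigenvalue on the unit circle. -/
lemma exists_sgn_zpow (hS : S.IsMarkov) {z : ℂ} (hz : ‖z‖ = 1) {u : Lp ℂ 1 m}
    (hu : hS.opL1 u = z • u) (k : ℤ) : ∃ w : Lp ℂ 1 m,
      (w =ᵐ[m] fun x => (u x / (‖u x‖ : ℂ)) ^ k * (‖u x‖ : ℂ)) ∧ hS.opL1 w = z ^ k • w := by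
  have hui := L1.integrable_coeFn u
  have hum : AEMeasurable u m := hui.1.aemeasurable
  set F : X → ℂ := fun x => (u x / (‖u x‖ : ℂ)) ^ k * (‖u x‖ : ℂ) with hF
  have hFm : AEStronglyMeasurable F m := by
    refine AEMeasurable.aestronglyMeasurable ?_
    have h1 : Measurable fun y : ℂ => (y / (‖y‖ : ℂ)) ^ k * (‖y‖ : ℂ) := by
      have h2 : Measurable fun y : ℂ => (‖y‖ : ℂ) := Complex.measurable_ofReal.comp measurable_norm
      exact ((measurable_id.div h2).pow_const k).mul h2
    exact h1.comp_aemeasurable hum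
  have hFi : MemLp F 1 m := by
    refine (memLp_one_iff_integrable.2 hui).of_le hFm (Eventually.of_forall fun x => ?_)
    by_cases hx : u x = 0
    · simp [hF, hx]
    · simp [hF, hx]
  have hpart : ∀ᵐ x ∂m, HasSum (fun r => S.part r u x) (z * u x) := by
    filter_upwards [hS.ae_hasSum hui, hS.coeFn_opL1 u, Lp.coeFn_smul z u] with x h1 h2 h3
    rw [← h2, hu, h3] at h1
    simpa using h1
  have hle : (fun x => ‖u x‖ₑ) ≤ᵐ[m] fun x => ∑' r, ‖S.part r u x‖ₑ := by
    filter_upwards [hpart] with x hx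
    have h1 := enorm_le_tsum_of_hasSum hx
    rwa [enorm_mul, ← ofReal_norm, hz, ENNReal.ofReal_one, one_mul] at h1
  have hpm : ∀ r, AEStronglyMeasurable (S.part r u) m := fun r =>
    aestronglyMeasurable_part hS.family r hui.1
  have heq : (fun x => ‖u x‖ₑ) =ᵐ[m] fun x => ∑' r, ‖S.part r u x‖ₑ := by
    refine ae_eq_of_ae_le_of_lintegral_le hle ?_ ?_ ?_
    · rw [← eLpNorm_one_eq_lintegral_enorm]
      exact (memLp_one_iff_integrable.2 hui).2.ne
    · exact AEMeasurable.tsum fun r => (hpm r).enorm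
    · rw [lintegral_tsum fun r => (hpm r).enorm]
      simp_rw [← eLpNorm_one_eq_lintegral_enorm]
      exact (hS.tsum_eLpNorm_part hui.1).le
  refine ⟨hFi.toLp F, hFi.coeFn_toLp, Lp.ext ?_⟩
  filter_upwards [hS.coeFn_opL1 (hFi.toLp F), S.transfer_congr hFi.coeFn_toLp,
    Lp.coeFn_smul (z ^ k) (hFi.toLp F), hFi.coeFn_toLp, hpart, heq, hS.ae_summable_norm hui,
    hS.weight_eq] with x h1 h2 h3 h4 h5 h6 h7 h8
  rw [h1, h2, h3, Pi.smul_apply, h4, smul_eq_mul]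
  have h9 : HasSum (fun r => ‖S.part r u x‖) ‖u x‖ := by
    have h10 : ‖u x‖ = ∑' r, ‖S.part r u x‖ := by
      have := congrArg ENNReal.toReal h6
      rw [ENNReal.tsum_toReal_eq fun r => enorm_ne_top] at this
      simpa using this
    rw [h10]
    exact h7.hasSum
  refine HasSum.tsum_eq ?_
  have h11 := hasSum_sgn_zpow (w := fun r => ‖S.weight r x‖)
    (y := fun r => u ((S.branch r).ext x)) (fun r => norm_nonneg _) hz
    (by simpa only [part_eq, ← h8] using h5) (by simpa only [part_eq, norm_mul] using h9) k
  simpa only [part_eq, ← h8] using h11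

end IsMarkov

end TransferSystem

end BesovGrid

namespace BesovGrid

variable {X : Type*} [MeasurableSpace X] {m : Measure X} [IsProbabilityMeasure m]

/-! ## Series of functions indexed by a good grid -/

/-- A countable family of functions, for each element of the grid, with controlled local Besov
norms. -/
structure AtomicFamily (P : GoodGrid m) (s β p : ℝ) (q : ℝ≥0∞) {ι : Type*}
    (α : ι → ℕ → Set X → ℝ≥0∞) (φ : ι → ℕ → Set X → X → ℂ) : Prop where
  aestronglyMeasurable : ∀ i k, ∀ W ∈ P.level k, AEStronglyMeasurable (φ i k W) m
  support : ∀ i k, ∀ W ∈ P.level k, ∀ x ∉ W, φ i k W x = 0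
  norm_le : ∀ i k, ∀ W ∈ P.level k,
    P.eBesovNormOn β p q W (φ i k W) ≤ α i k W * ENNReal.ofReal (m.real W ^ (s - β))

namespace AtomicFamily

variable {P : GoodGrid m} {s β p : ℝ} {q : ℝ≥0∞} {ι : Type*} [Countable ι]
  {α : ι → ℕ → Set X → ℝ≥0∞} {φ : ι → ℕ → Set X → X → ℂ}

/-- The size of the coefficients of level `k`. -/
def levelSize (P : GoodGrid m) (p : ℝ) (α : ι → ℕ → Set X → ℝ≥0∞) (k : ℕ) : ℝ≥0∞ :=
  (∑ W ∈ P.level k, (∑' i, α i k W) ^ p) ^ (1 / p)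

variable (h : AtomicFamily P s β p q α φ)
include h

lemma lintegral_tsum_rpow_le (hβ : 0 < β) (hp : 1 ≤ p) (hq : 1 ≤ q) {k : ℕ} {W : Set X}
    (hW : W ∈ P.level k) : (∫⁻ x, (∑' i, ‖φ i k W x‖ₑ) ^ p ∂m) ^ (1 / p) ≤
      P.embConst β * ENNReal.ofReal (m.real W ^ s) * ∑' i, α i k W := by
  have hW0 := P.real_pos hW
  refine (lintegral_Lp_tsum_le hp (fun i x => ‖φ i k W x‖ₑ)
    fun i => (h.aestronglyMeasurable i k W hW).enorm).trans ?_
  rw [← ENNReal.tsum_mul_left]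
  refine ENNReal.tsum_le_tsum fun i => ?_
  rw [← eLpNorm_ofReal_eq hp]
  refine (P.eLpNorm_le_eBesovNormOn hβ hp hq hW (φ i k W)).trans ?_
  calc P.embConst β * ENNReal.ofReal (m.real W ^ β) * P.eBesovNormOn β p q W (φ i k W)
      ≤ P.embConst β * ENNReal.ofReal (m.real W ^ β) *
          (α i k W * ENNReal.ofReal (m.real W ^ (s - β))) := by
        gcongr
        exact h.norm_le i k W hW
    _ = P.embConst β * (ENNReal.ofReal (m.real W ^ β) * ENNReal.ofReal (m.real W ^ (s - β))) *
          α i k W := by ring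
    _ = _ := by
        rw [← ENNReal.ofReal_mul (by positivity), ← Real.rpow_add hW0]
        congr 4
        ring

lemma lintegral_level_rpow_le (hs : 0 < s) (hβ : 0 < β) (hp : 1 ≤ p) (hq : 1 ≤ q) (k : ℕ) :
    (∫⁻ x, (∑ W ∈ P.level k, ∑' i, ‖φ i k W x‖ₑ) ^ p ∂m) ^ (1 / p) ≤
      P.embConst β * ENNReal.ofReal ((P.lam₂ ^ k) ^ s) * levelSize P p α k := by
  have h0 : 0 < p := by linarith
  rw [lintegral_rpow_sum_of_disjoint h0 _ (P.disjoint k) (fun W x => ∑' i, ‖φ i k W x‖ₑ)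
    (fun W hW => AEMeasurable.tsum fun i => (h.aestronglyMeasurable i k W hW).enorm)
    (fun W hW x hx => by simp [h.support _ k W hW x hx])]
  calc (∑ W ∈ P.level k, ∫⁻ x, (∑' i, ‖φ i k W x‖ₑ) ^ p ∂m) ^ (1 / p)
      ≤ (∑ W ∈ P.level k, (P.embConst β * ENNReal.ofReal ((P.lam₂ ^ k) ^ s) *
          ∑' i, α i k W) ^ p) ^ (1 / p) := by
        refine ENNReal.rpow_le_rpow (Finset.sum_le_sum fun W hW => ?_) (by positivity)
        rw [← rpow_one_div_le_iff h0]
        refine (h.lintegral_tsum_rpow_le hβ hp hq hW).trans ?_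
        gcongr
        exact P.real_le k W hW
    _ = _ := by
        simp_rw [ENNReal.mul_rpow_of_nonneg _ (∑' i, α i k _) h0.le, ← Finset.mul_sum]
        rw [ENNReal.mul_rpow_of_nonneg _ _ (by positivity), ← ENNReal.rpow_mul,
          mul_one_div_cancel h0.ne', ENNReal.rpow_one]
        rfl

lemma tsum_lintegral_level_le (hs : 0 < s) (hβ : 0 < β) (hp : 1 ≤ p) (hq : 1 ≤ q) :
    ∑' k, (∫⁻ x, (∑ W ∈ P.level k, ∑' i, ‖φ i k W x‖ₑ) ^ p ∂m) ^ (1 / p) ≤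
      P.embConst β * P.embConst s * ellNorm q (levelSize P p α) := by
  have e : P.embConst s = ∑' k : ℕ, ENNReal.ofReal ((P.lam₂ ^ k) ^ s) := rfl
  rw [e, ← ENNReal.tsum_mul_left, ← ENNReal.tsum_mul_right]
  refine ENNReal.tsum_le_tsum fun k => (h.lintegral_level_rpow_le hs hβ hp hq k).trans ?_
  gcongr
  exact le_ellNorm hq _ k

lemma tsum_lintegral_level_lt_top (hs : 0 < s) (hβ : 0 < β) (hp : 1 ≤ p) (hq : 1 ≤ q)
    (hfin : ellNorm q (levelSize P p α) < ∞) :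
    ∑' k, (∫⁻ x, (∑ W ∈ P.level k, ∑' i, ‖φ i k W x‖ₑ) ^ p ∂m) ^ (1 / p) < ∞ :=
  (h.tsum_lintegral_level_le hs hβ hp hq).trans_lt (ENNReal.mul_lt_top (ENNReal.mul_lt_top
    (P.embConst_ne_top hβ).lt_top (P.embConst_ne_top hs).lt_top) hfin)

lemma ae_tsum_lt_top (hs : 0 < s) (hβ : 0 < β) (hp : 1 ≤ p) (hq : 1 ≤ q)
    (hfin : ellNorm q (levelSize P p α) < ∞) :
    ∀ᵐ x ∂m, ∑' k, ∑ W ∈ P.level k, ∑' i, ‖φ i k W x‖ₑ < ∞ := by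
  have h0 : 0 < p := by linarith
  have hmeas : ∀ k, AEMeasurable (fun x => ∑ W ∈ P.level k, ∑' i, ‖φ i k W x‖ₑ) m := fun k =>
    Finset.aemeasurable_fun_sum _ fun W hW =>
      AEMeasurable.tsum fun i => (h.aestronglyMeasurable i k W hW).enorm
  have h1 := (lintegral_Lp_tsum_le hp _ hmeas).trans_lt
    (h.tsum_lintegral_level_lt_top hs hβ hp hq hfin)
  have h2 : ∫⁻ x, (∑' k, ∑ W ∈ P.level k, ∑' i, ‖φ i k W x‖ₑ) ^ p ∂m < ∞ := by
    rw [ENNReal.rpow_lt_top_iff_of_pos (by positivity)] at h1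
    exact h1
  filter_upwards [ae_lt_top' ((AEMeasurable.tsum hmeas).pow_const p) h2.ne] with x hx
  rwa [ENNReal.rpow_lt_top_iff_of_pos h0] at hx

/-- The sum of an atomic family has a representation by canonical atoms. -/
theorem exists_isRep (hs : 0 < s) (hβ : 0 < β) (hp : 1 ≤ p) (hq : 1 ≤ q)
    (hfin : ellNorm q (levelSize P p α) < ∞) {F : X → ℂ}
    (hF : ∀ᵐ x ∂m, HasSum (fun k => ∑ W ∈ P.level k, ∑' i, φ i k W x) (F x))
    {C : ℝ≥0∞} (hC : P.convConst s β p q < C) :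
    ∃ z, P.IsRep s p q z F ∧ P.cost p q z ≤ C * ellNorm q (levelSize P p α) := by
  have h0 : 0 < p := by linarith
  set σ : ℕ → Set X → ℝ≥0∞ := fun k W => ∑' i, α i k W with hσ
  have hσtop : ∀ k, ∀ W ∈ P.level k, σ k W ≠ ∞ := by
    intro k W hW
    have h1 : levelSize P p α k < ∞ := (le_ellNorm hq _ k).trans_lt hfin
    unfold levelSize at h1
    rw [ENNReal.rpow_lt_top_iff_of_pos (by positivity)] at h1
    have h2 := (Finset.single_le_sum (f := fun W => σ k W ^ p) (fun _ _ => zero_le) hW).trans_lt h1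
    rw [ENNReal.rpow_lt_top_iff_of_pos h0] at h2
    exact h2.ne
  set d : Coeff X := fun k W => ((σ k W).toReal : ℂ) with hd
  have hdσ : ∀ k, ∀ W ∈ P.level k, ‖d k W‖ₑ = σ k W := by
    intro k W hW
    rw [hd, ← ofReal_norm, Complex.norm_real, Real.norm_of_nonneg ENNReal.toReal_nonneg,
      ENNReal.ofReal_toReal (hσtop k W hW)]
  have hcost : P.cost p q d = ellNorm q (levelSize P p α) := by
    unfold Grid.cost
    congr 1
    funext k
    unfold Grid.levelNorm levelSize
    congr 1
    exact Finset.sum_congr rfl fun W hW => by rw [hdσ k W hW]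
  have hsum : ∀ᵐ x ∂m, ∀ k, ∀ W ∈ P.level k, HasSum (fun i => φ i k W x) (∑' i, φ i k W x) := by
    filter_upwards [h.ae_tsum_lt_top hs hβ hp hq hfin] with x hx k W hW
    refine Summable.hasSum (Summable.of_norm (tsum_enorm_ne_top_iff_summable_norm.1
      (ne_top_of_le_ne_top hx.ne ?_)))
    exact (Finset.single_le_sum (f := fun W => ∑' i, ‖φ i k W x‖ₑ) (fun _ _ => zero_le) hW).trans
      (ENNReal.le_tsum (f := fun k => ∑ W ∈ P.level k, ∑' i, ‖φ i k W x‖ₑ) k)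
  have hbm : ∀ k, ∀ W ∈ P.level k, AEStronglyMeasurable (fun x => ∑' i, φ i k W x) m := by
    intro k W hW
    refine aestronglyMeasurable_of_hasSum (fun i => h.aestronglyMeasurable i k W hW) ?_
    filter_upwards [hsum] with x hx using hx k W hW
  set b : ℕ → Set X → X → ℂ := fun k W x => (d k W)⁻¹ * ∑' i, φ i k W x with hb
  have hdb : ∀ k, ∀ W ∈ P.level k, ∀ᵐ x ∂m, d k W * b k W x = ∑' i, φ i k W x := by
    intro k W hW
    by_cases hd0 : d k W = 0
    · have h1 : σ k W = 0 := by rw [← hdσ k W hW, hd0, enorm_zero]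
      have h2 := h.lintegral_tsum_rpow_le hβ hp hq hW
      rw [show ∑' i, α i k W = 0 from h1, mul_zero, nonpos_iff_eq_zero,
        ENNReal.rpow_eq_zero_iff_of_pos (by positivity), lintegral_eq_zero_iff' ((AEMeasurable.tsum
          fun i => (h.aestronglyMeasurable i k W hW).enorm).pow_const p)] at h2
      filter_upwards [h2] with x hx
      have h3 : ∑' i, ‖φ i k W x‖ₑ = 0 := by
        simpa [ENNReal.rpow_eq_zero_iff_of_pos h0] using hx
      rw [ENNReal.tsum_eq_zero] at h3
      simp only [enorm_eq_zero] at h3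
      simp [hd0, h3]
    · exact Eventually.of_forall fun x => mul_inv_cancel_left₀ hd0 _
  have hrep : P.IsBesovAtomRep s β p q d b F := by
    refine ⟨fun k W hW => ?_, ?_, hcost ▸ hfin⟩
    · have hle : P.eBesovNormOn β p q W (fun x => ∑' i, φ i k W x) ≤
          σ k W * ENNReal.ofReal (m.real W ^ (s - β)) := by
        refine (P.eBesovNormOn_tsum_le hβ hp hq W (f := fun i => φ i k W) ?_).trans ?_
        · filter_upwards [hsum] with x hx using hx k W hW
        · rw [hσ, ← ENNReal.tsum_mul_right]
          exact ENNReal.tsum_le_tsum fun i => h.norm_le i k W hW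
      refine (P.eBesovNormOn_smul_le hp hq W _ hle
        (ENNReal.mul_ne_top (hσtop k W hW) ENNReal.ofReal_ne_top)).trans ?_
      rw [← mul_assoc]
      refine mul_le_of_le_one_left zero_le ?_
      by_cases hd0 : d k W = 0
      · simp [hd0]
      · rw [enorm_inv hd0, hdσ k W hW]
        exact ENNReal.inv_mul_le_one _
    · have hae : ∀ᵐ x ∂m, ∀ k, ∑ W ∈ P.level k, d k W * b k W x =
          ∑ W ∈ P.level k, ∑' i, φ i k W x := by
        refine ae_all_iff.2 fun k => ?_
        have : ∀ᵐ x ∂m, ∀ W ∈ P.level k, d k W * b k W x = ∑' i, φ i k W x :=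
          (Finset.eventually_all (P.level k)).2 (hdb k)
        filter_upwards [this] with x hx using Finset.sum_congr rfl hx
      refine Grid.sumsTo_of_hasSum hp (fun k => ?_) ?_ ?_
      · exact Finset.aestronglyMeasurable_fun_sum _ fun W hW =>
          ((hbm k W hW).const_mul _).const_mul _
      · refine lt_of_le_of_lt (ENNReal.tsum_le_tsum fun k => ?_)
          (h.tsum_lintegral_level_lt_top hs hβ hp hq hfin)
        rw [eLpNorm_ofReal_eq hp]
        refine ENNReal.rpow_le_rpow (lintegral_mono_ae ?_) (by positivity)
        filter_upwards [hae] with x hx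
        rw [hx k]
        refine ENNReal.rpow_le_rpow ((enorm_sum_le _ _).trans ?_) h0.le
        exact Finset.sum_le_sum fun W _ => enorm_tsum_le_tsum_enorm
      · filter_upwards [hae, hF] with x h1 h2
        simpa only [h1] using h2
  obtain ⟨C', hC', hlt⟩ := sInf_lt_iff.1 hC
  obtain ⟨z, hz, hzc⟩ := hC' d b F hrep
  refine ⟨z, hz, hzc.trans ?_⟩
  rw [hcost]
  gcongr

end AtomicFamily

end BesovGrid

namespace BesovGrid

variable {X : Type*} [MeasurableSpace X] {m : Measure X} [IsProbabilityMeasure m]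

/-! ## The action of a branch on canonical atoms -/

namespace Branch

variable {P : GoodGrid m} {s p : ℝ} (B : Branch P P s p)

lemma real_pos {j : ℕ} {Q : Set X} (hQ : Q ∈ B.G.level j) : 0 < m.real Q :=
  ENNReal.toReal_pos (B.G.pos j Q hQ).ne' (measure_ne_top _ _)

lemma real_pre_pos {j : ℕ} {Q : Set X} (hQ : Q ∈ B.G.level j) : 0 < m.real (B.pre Q) := by
  refine ENNReal.toReal_pos (fun h => ?_) (measure_ne_top _ _)
  exact (B.G.pos j Q hQ).ne'
    ((B.null_iff Q (B.G.measurableSet j Q hQ) (B.G_subset j Q hQ)).2 h)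

lemma exists_tiling {j : ℕ} {Q : Set X} (hQ : Q ∈ B.G.level j) :
    ∃ T : ℕ → Finset (Set X), (∀ k, T k ⊆ P.level k) ∧
      (∀ x, x ∈ B.pre Q ↔ ∃ k, ∃ W ∈ T k, x ∈ W) ∧
      (∀ k l, ∀ W ∈ T k, ∀ V ∈ T l, W ≠ V → Disjoint W V) ∧
      (∀ k < P.k₀ (B.pre Q), T k = ∅) ∧
      ∀ k, P.k₀ (B.pre Q) ≤ k → ∑ W ∈ T k, m.real W ^ (1 - s * p) ≤
        B.cGD * B.lamGD ^ (k - P.k₀ (B.pre Q)) * m.real (B.pre Q) ^ (1 - s * p) := by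
  obtain ⟨F, h1, h2, h3, h4⟩ := B.geometric_distortion j Q hQ
  change ∀ k ≥ P.k₀ (B.pre Q), _ at h1
  change B.pre Q = ⋃ k ≥ P.k₀ (B.pre Q), _ at h2
  change ∀ k ≥ P.k₀ (B.pre Q), ∀ l ≥ P.k₀ (B.pre Q), _ at h3
  change ∀ k ≥ P.k₀ (B.pre Q), ∑ W ∈ F k, m.real W ^ (1 - s * p) ≤
        B.cGD * B.lamGD ^ (k - P.k₀ (B.pre Q)) * m.real (B.pre Q) ^ (1 - s * p) at h4
  generalize P.k₀ (B.pre Q) = k₀ at *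
  refine ⟨fun k => if k₀ ≤ k then F k else ∅, fun k => ?_, fun x => ?_, fun k l W hW V hV => ?_,
    fun k hk => if_neg (not_le.2 hk), fun k hk => by
      simp only [if_pos hk]; exact h4 k hk⟩
  · dsimp only
    split_ifs with hk
    · exact h1 k hk
    · simp
  · rw [h2]
    simp only [Set.mem_iUnion, exists_prop]
    refine exists_congr fun k => ?_
    split_ifs with hk <;> simp [hk]
  · dsimp only at hW hV
    split_ifs at hW with hk
    · split_ifs at hV with hl
      · exact h3 k hk l hl W hW V hV
      · simp at hV
    · simp at hW

/-- The size of the contribution of `Q` to the coefficient of `W ⊆ h⁻¹(Q)`. -/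
def coef (cR : ℝ) (Q W : Set X) : ℝ :=
  cR * (m.real Q / m.real (B.pre Q)) ^ B.ε * (m.real W / m.real (B.pre Q)) ^ (1 / p - s)

lemma coef_pos {cR : ℝ} (hc : 0 < cR) {j k : ℕ} {Q W : Set X} (hQ : Q ∈ B.G.level j)
    (hW : W ∈ P.level k) : 0 < B.coef cR Q W := by
  have h1 := B.real_pos hQ
  have h2 := B.real_pre_pos hQ
  have h3 := P.real_pos hW
  unfold coef
  positivity

lemma scaling_rpow_le (hε : 0 < |B.ε|) {j : ℕ} {Q : Set X} (hQ : Q ∈ B.G.level j) :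
    (m.real Q / m.real (B.pre Q)) ^ B.ε ≤
      B.cC ^ |B.ε| * (B.lamC ^ |B.ε|) ^ |(j : ℝ) - P.k₀ (B.pre Q)| := by
  have h1 := B.real_pos hQ
  have h2 := B.real_pre_pos hQ
  have h3 := B.scaling_ratio j Q hQ
  rw [B.G_k₀ j Q hQ] at h3
  change (m.real Q / m.real (B.pre Q)) ^ (B.ε / |B.ε|) ≤
      B.cC * B.lamC ^ |(j : ℝ) - P.k₀ (B.pre Q)| at h3
  have hr : 0 < m.real Q / m.real (B.pre Q) := by positivity
  have hC := B.cC_pos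
  have hl := B.lamC_pos
  calc (m.real Q / m.real (B.pre Q)) ^ B.ε
      = ((m.real Q / m.real (B.pre Q)) ^ (B.ε / |B.ε|)) ^ |B.ε| := by
        rw [← Real.rpow_mul hr.le, div_mul_cancel₀ _ hε.ne']
    _ ≤ (B.cC * B.lamC ^ |(j : ℝ) - P.k₀ (B.pre Q)|) ^ |B.ε| := by gcongr
    _ = _ := by
        rw [Real.mul_rpow hC.le (by positivity), ← Real.rpow_mul hl.le, ← Real.rpow_mul hl.le,
          mul_comm |B.ε|]

lemma sum_coef_rpow_le (hp : 1 ≤ p) {cR γ Λ lam : ℝ} (hc : 0 < cR) (hε : 0 < |B.ε|)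
    (hγ : γ ∈ Set.Icc (0 : ℝ) 1) (hΛ : Λ = max (B.lamC ^ |B.ε|) (B.lamGD ^ (1 / p)))
    (hlam : Λ ≤ lam) (hΛ1 : Λ ≤ 1) {j k : ℕ} {Q : Set X} (hQ : Q ∈ B.G.level j)
    {T : Finset (Set X)} (hk : P.k₀ (B.pre Q) ≤ k)
    (hT : ∑ W ∈ T, m.real W ^ (1 - s * p) ≤
        B.cGD * B.lamGD ^ (k - P.k₀ (B.pre Q)) * m.real (B.pre Q) ^ (1 - s * p)) :
    ∑ W ∈ T, B.coef cR Q W ^ p ≤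
      (B.cC ^ |B.ε| * cR * B.cGD ^ (1 / p) * Λ ^ (B.a * (1 - γ)) *
        (lam ^ γ) ^ ((k - j) + (j - k))) ^ p := by
  have h0 : 0 < p := by linarith
  have hQ0 := B.real_pos hQ
  have hΩ0 := B.real_pre_pos hQ
  have hC := B.cC_pos
  have hG := B.cGD_pos
  have hlC := B.lamC_pos
  have hlG := B.lamGD_pos
  have hΛ0 : 0 < Λ := by
    rw [hΛ]; exact lt_of_lt_of_le (by positivity) (le_max_left _ _)
  set k₀ := P.k₀ (B.pre Q) with hk₀
  set Δ : ℝ := |(j : ℝ) - k₀| with hΔ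
  have haΔ : B.a ≤ Δ := by
    have := B.scaling j Q hQ
    rw [B.G_k₀ j Q hQ] at this
    exact this
  obtain ⟨n, rfl⟩ := Nat.exists_eq_add_of_le hk
  rw [Nat.add_sub_cancel_left] at hT
  set A : ℝ := (m.real Q / m.real (B.pre Q)) ^ B.ε with hA
  have hA0 : 0 < A := by positivity
  have hAle : A ≤ B.cC ^ |B.ε| * Λ ^ Δ := by
    refine (B.scaling_rpow_le hε hQ).trans ?_
    gcongr
    rw [hΛ]; exact le_max_left _ _
  have hsum : ∑ W ∈ T, B.coef cR Q W ^ p ≤ (cR * A) ^ p * (B.cGD * B.lamGD ^ n) := by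
    have e1 : ∀ W, B.coef cR Q W ^ p =
        (cR * A) ^ p / m.real (B.pre Q) ^ (1 - s * p) * m.real W ^ (1 - s * p) := by
      intro W
      have hW : 0 ≤ m.real W := measureReal_nonneg
      unfold coef
      rw [Real.mul_rpow (by positivity) (by positivity), ← Real.rpow_mul (by positivity),
        Real.div_rpow hW hΩ0.le]
      have : (1 / p - s) * p = 1 - s * p := by field_simp
      rw [this]
      ring
    simp_rw [e1, ← Finset.mul_sum]
    calc _ ≤ (cR * A) ^ p / m.real (B.pre Q) ^ (1 - s * p) *
          (B.cGD * B.lamGD ^ n * m.real (B.pre Q) ^ (1 - s * p)) := by gcongr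
      _ = _ := by
        have : m.real (B.pre Q) ^ (1 - s * p) ≠ 0 := by positivity
        field_simp
  refine hsum.trans ?_
  have e2 : B.cGD * B.lamGD ^ n = (B.cGD ^ (1 / p) * (B.lamGD ^ (1 / p)) ^ n) ^ p := by
    rw [Real.mul_rpow (by positivity) (by positivity), ← Real.rpow_mul hG.le,
      one_div_mul_cancel h0.ne', Real.rpow_one, ← Real.rpow_natCast, ← Real.rpow_natCast,
      ← Real.rpow_mul hlG.le, ← Real.rpow_mul hlG.le]
    congr 2
    field_simp
  rw [e2, ← Real.mul_rpow (by positivity) (by positivity)]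
  refine Real.rpow_le_rpow (by positivity) ?_ h0.le
  have hpow : Λ ^ Δ * Λ ^ n ≤ Λ ^ (B.a * (1 - γ)) * (lam ^ γ) ^ ((k₀ + n - j) + (j - (k₀ + n))) := by
    have hdist : (((k₀ + n - j) + (j - (k₀ + n)) : ℕ) : ℝ) ≤ Δ + n := by
      rcases le_total (k₀ + n) j with h | h
      · have h' : ((j - (k₀ + n) : ℕ) : ℝ) = j - (k₀ + n) := by push_cast [h]; ring
        rw [Nat.sub_eq_zero_of_le h, zero_add, h']
        have := le_abs_self ((j : ℝ) - k₀)
        have hn : (0 : ℝ) ≤ n := n.cast_nonneg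
        linarith
      · have h' : ((k₀ + n - j : ℕ) : ℝ) = k₀ + n - j := by push_cast [h]; ring
        rw [Nat.sub_eq_zero_of_le h, add_zero, h']
        have := neg_abs_le ((j : ℝ) - k₀)
        linarith
    set D : ℕ := (k₀ + n - j) + (j - (k₀ + n))
    calc Λ ^ Δ * Λ ^ n = Λ ^ (Δ + n) := by rw [Real.rpow_add hΛ0, Real.rpow_natCast]
      _ ≤ Λ ^ (B.a * (1 - γ) + γ * D) := by
        refine Real.rpow_le_rpow_of_exponent_ge hΛ0 hΛ1 ?_
        have h1 : B.a * (1 - γ) ≤ (Δ + n) * (1 - γ) := by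
          refine mul_le_mul_of_nonneg_right ?_ (by linarith [hγ.2])
          have hn : (0 : ℝ) ≤ n := n.cast_nonneg
          linarith
        have h2 : γ * D ≤ γ * (Δ + n) := mul_le_mul_of_nonneg_left hdist hγ.1
        linarith
      _ = Λ ^ (B.a * (1 - γ)) * (Λ ^ γ) ^ D := by
        rw [Real.rpow_add hΛ0, Real.rpow_mul hΛ0.le γ, Real.rpow_natCast]
      _ ≤ _ := by
        gcongr
        exact hγ.1
  calc cR * A * (B.cGD ^ (1 / p) * (B.lamGD ^ (1 / p)) ^ n)
      ≤ cR * (B.cC ^ |B.ε| * Λ ^ Δ) * (B.cGD ^ (1 / p) * Λ ^ n) := by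
        gcongr
        rw [hΛ]; exact le_max_right _ _
    _ = B.cC ^ |B.ε| * cR * B.cGD ^ (1 / p) * (Λ ^ Δ * Λ ^ n) := by ring
    _ ≤ B.cC ^ |B.ε| * cR * B.cGD ^ (1 / p) * (Λ ^ (B.a * (1 - γ)) *
        (lam ^ γ) ^ ((k₀ + n - j) + (j - (k₀ + n)))) := by gcongr
    _ = _ := by ring

lemma potential_norm_le {β cR : ℝ} {q : ℝ≥0∞} {g : X → ℂ}
    (hg : B.IsRegularPotential β q cR g) (hp : 1 ≤ p) (hq : 1 ≤ q) (hc : 0 < cR) {j k : ℕ}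
    {Q W : Set X} (hQ : Q ∈ B.G.level j) (hW : W ∈ P.level k) (hWQ : W ⊆ B.pre Q) (a : ℂ) :
    P.eBesovNormOn β p q W
      (fun x => a * ((m.real Q ^ (s - 1 / p) : ℝ) : ℂ) * W.indicator g x) ≤
      ‖a‖ₑ * ENNReal.ofReal (B.coef cR Q W) * ENNReal.ofReal (m.real W ^ (s - β)) := by
  have hQ0 := B.real_pos hQ
  have hΩ0 := B.real_pre_pos hQ
  have hW0 := P.real_pos hW
  have hdom : W ⊆ B.dom := fun x hx => (B.mem_pre_iff.1 (hWQ hx)).1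
  refine (P.eBesovNormOn_smul_le hp hq W _ (hg k W hW hdom j Q hQ hWQ)
    ENNReal.ofReal_ne_top).trans (le_of_eq ?_)
  rw [enorm_mul, mul_assoc ‖a‖ₑ, mul_assoc ‖a‖ₑ]
  congr 1
  have hn : 0 ≤ m.real Q ^ (s - 1 / p) := by positivity
  rw [← ofReal_norm, Complex.norm_real, Real.norm_of_nonneg hn, ← ENNReal.ofReal_mul hn,
    ← ENNReal.ofReal_mul (B.coef_pos hc hQ hW).le]
  congr 1
  unfold coef
  have e1 : 1 / p - β = (1 / p - s) + (s - β) := by ring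
  have e2 : s - 1 / p = -(1 / p - s) := by ring
  rw [e1, e2, Real.rpow_add hW0, Real.rpow_add (by positivity), Real.rpow_neg hQ0.le,
    Real.div_rpow hW0.le hΩ0.le (1 / p - s), Real.div_rpow hQ0.le hΩ0.le (1 / p - s)]
  have : m.real Q ^ (1 / p - s) ≠ 0 := by positivity
  field_simp

end Branch

end BesovGrid

namespace BesovGrid

variable {X : Type*} [MeasurableSpace X] {m : Measure X} [IsProbabilityMeasure m]

/-! ## The action of the transfer operator on sliced representations -/

lemma rpow_sum_of_subsingleton_support {ι : Type*} {p : ℝ} (hp : 0 < p) (t : Finset ι)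
    (u : ι → ℝ≥0∞) (h : ∀ a ∈ t, ∀ b ∈ t, a ≠ b → u a = 0 ∨ u b = 0) :
    (∑ a ∈ t, u a) ^ p = ∑ a ∈ t, u a ^ p := by
  by_cases hne : ∃ a ∈ t, u a ≠ 0
  · obtain ⟨a, ha, hua⟩ := hne
    have hz : ∀ b ∈ t, b ≠ a → u b = 0 := fun b hb hba => (h b hb a ha hba).resolve_right hua
    rw [Finset.sum_eq_single_of_mem a ha hz, Finset.sum_eq_single_of_mem a ha]
    intro b hb hba
    rw [hz b hb hba, ENNReal.zero_rpow_of_pos hp]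
  · push Not at hne
    rw [Finset.sum_eq_zero hne, Finset.sum_eq_zero, ENNReal.zero_rpow_of_pos hp]
    intro b hb
    rw [hne b hb, ENNReal.zero_rpow_of_pos hp]

/-- Hölder's inequality for a series with boundedly many nonzero terms. -/
lemma tsum_rpow_le_encard_mul {ι : Type*} {p : ℝ} (hp : 1 ≤ p) (u : ι → ℝ≥0∞) {A : Set ι}
    (hA : ∀ i ∉ A, u i = 0) {N : ℝ≥0∞} (hN : (A.encard : ℝ≥0∞) ≤ N) :
    (∑' i, u i) ^ p ≤ N ^ (p - 1) * ∑' i, u i ^ p := by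
  classical
  have h0 : 0 < p := by linarith
  have h1 : ∀ t : Finset ι, (∑ i ∈ t, u i) ^ p ≤ N ^ (p - 1) * ∑' i, u i ^ p := by
    intro t
    have e : ∑ i ∈ t, u i = ∑ i ∈ t with i ∈ A, u i := by
      rw [Finset.sum_filter]
      exact Finset.sum_congr rfl fun i _ => by
        split_ifs with hi
        · rfl
        · exact hA i hi
    rw [e]
    refine (ENNReal.rpow_sum_le_const_mul_sum_rpow _ _ hp).trans ?_
    gcongr
    · refine le_trans ?_ hN
      have h2 : ((t.filter (· ∈ A) : Finset ι) : Set ι).encard ≤ A.encard :=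
        Set.encard_le_encard fun i hi => by simpa using (Finset.mem_filter.1 hi).2
      rw [Set.encard_coe_eq_coe_finsetCard] at h2
      exact_mod_cast ENat.toENNReal_le.2 h2
    · exact ENNReal.sum_le_tsum _
  have e : (∑' i, u i) ^ p = ⨆ t : Finset ι, (∑ i ∈ t, u i) ^ p := by
    rw [ENNReal.tsum_eq_iSup_sum]
    exact (ENNReal.orderIsoRpow p h0).map_iSup _
  rw [e]
  exact iSup_le h1

namespace TransferSystem

variable {P : GoodGrid m} {e : BesovIndex} (S : TransferSystem P P e)

/-- The elements of all the local grids. -/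
abbrev Index := Σ r : S.Λ, Σ j : ℕ, {Q : Set X // Q ∈ (S.branch r).G.level j}

/-- The decomposition of the preimage of an element of a local grid. -/
def tile (i : S.Index) : ℕ → Finset (Set X) :=
  Classical.choose ((S.branch i.1).exists_tiling i.2.2.2)

lemma tile_subset (i : S.Index) (k : ℕ) : S.tile i k ⊆ P.level k :=
  (Classical.choose_spec ((S.branch i.1).exists_tiling i.2.2.2)).1 k

lemma mem_pre_iff_tile (i : S.Index) (x : X) :
    x ∈ (S.branch i.1).pre i.2.2 ↔ ∃ k, ∃ W ∈ S.tile i k, x ∈ W :=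
  (Classical.choose_spec ((S.branch i.1).exists_tiling i.2.2.2)).2.1 x

lemma tile_disjoint (i : S.Index) {k l : ℕ} {W V : Set X} (hW : W ∈ S.tile i k)
    (hV : V ∈ S.tile i l) (hne : W ≠ V) : Disjoint W V :=
  (Classical.choose_spec ((S.branch i.1).exists_tiling i.2.2.2)).2.2.1 k l W hW V hV hne

lemma tile_eq_empty (i : S.Index) {k : ℕ} (hk : k < P.k₀ ((S.branch i.1).pre i.2.2)) :
    S.tile i k = ∅ :=
  (Classical.choose_spec ((S.branch i.1).exists_tiling i.2.2.2)).2.2.2.1 k hk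

lemma sum_tile_le (i : S.Index) {k : ℕ} (hk : P.k₀ ((S.branch i.1).pre i.2.2) ≤ k) :
    ∑ W ∈ S.tile i k, m.real W ^ (1 - e.s * e.p) ≤
      (S.branch i.1).cGD * (S.branch i.1).lamGD ^ (k - P.k₀ ((S.branch i.1).pre i.2.2)) *
        m.real ((S.branch i.1).pre i.2.2) ^ (1 - e.s * e.p) :=
  (Classical.choose_spec ((S.branch i.1).exists_tiling i.2.2.2)).2.2.2.2 k hk

lemma subset_pre_of_mem_tile {i : S.Index} {k : ℕ} {W : Set X} (hW : W ∈ S.tile i k) :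
    W ⊆ (S.branch i.1).pre i.2.2 := fun x hx => (S.mem_pre_iff_tile i x).2 ⟨k, W, hW, hx⟩

lemma subset_dom_of_mem_tile {i : S.Index} {k : ℕ} {W : Set X} (hW : W ∈ S.tile i k) :
    W ⊆ (S.branch i.1).dom := fun _ hx =>
  ((S.branch i.1).mem_pre_iff.1 (S.subset_pre_of_mem_tile hW hx)).1

open Classical in
/-- The contribution of an element of a local grid to the coefficient of `W`. -/
def size (c : S.Λ → Coeff X) (i : S.Index) (k : ℕ) (W : Set X) : ℝ≥0∞ :=
  if W ∈ S.tile i k then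
    ‖c i.1 i.2.1 i.2.2‖ₑ * ENNReal.ofReal ((S.branch i.1).coef (S.cR i.1) i.2.2 W) else 0

open Classical in
/-- The restriction to `W` of the image of an atom of a local grid. -/
def piece (c : S.Λ → Coeff X) (i : S.Index) (k : ℕ) (W : Set X) : X → ℂ :=
  if W ∈ S.tile i k then fun x => c i.1 i.2.1 i.2.2 *
    ((m.real (i.2.2 : Set X) ^ (e.s - 1 / e.p) : ℝ) : ℂ) * W.indicator (S.weight i.1) x else 0

variable {S}

lemma atomicFamily (hfam : S.FamilyOK) (c : S.Λ → Coeff X) :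
    AtomicFamily P e.s S.β e.p e.q (S.size c) (S.piece c) where
  aestronglyMeasurable i k W hW := by
    unfold piece
    split_ifs
    · exact ((aestronglyMeasurable_weight hfam i.1).indicator (P.measurableSet k W hW)).const_mul _
    · exact aestronglyMeasurable_zero
  support i k W hW x hx := by
    unfold piece
    split_ifs
    · simp [hx]
    · rfl
  norm_le i k W hW := by
    unfold piece size
    split_ifs with h
    · have h1 : W.indicator (S.weight i.1) = W.indicator (S.g i.1) := by
        unfold weight
        rw [Set.indicator_indicator, Set.inter_eq_left.2 (S.subset_dom_of_mem_tile h)]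
      rw [h1]
      exact (S.branch i.1).potential_norm_le (hfam.regular i.1) e.one_le_p e.one_le_q
        (hfam.cR_pos i.1) i.2.2.2 hW (S.subset_pre_of_mem_tile h) _
    · refine (P.eBesovNormOn_le (c := 0)
        ⟨Grid.IsRep.zero _ e.one_le_p e.one_le_q, fun _ _ _ _ => rfl⟩).trans ?_
      have h2 : P.cost e.p e.q 0 = 0 := by simpa using P.cost_smul e.one_le_p e.one_le_q 0 0
      rw [h2]
      exact zero_le

variable (S) in
/-- The contraction rate between levels. -/
def rate : ℝ≥0∞ := ENNReal.ofReal ((⨆ r, S.lam r) ^ S.γ)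

lemma lam_le_iSup (hfam : S.FamilyOK) (r : S.Λ) : S.lam r ≤ ⨆ r, S.lam r :=
  le_ciSup (f := S.lam) ⟨1, by rintro _ ⟨r, rfl⟩; exact (hfam.lam_lt_one r).le⟩ r

lemma lam_pos (S : TransferSystem P P e) (r : S.Λ) : 0 < S.lam r :=
  lt_of_lt_of_le (Real.rpow_pos_of_pos (S.branch r).lamC_pos _) (le_max_left _ _)

lemma Θ_pos (hfam : S.FamilyOK) (r : S.Λ) : 0 < S.Θ r := by
  have h1 := (S.branch r).cC_pos
  have h2 := (S.branch r).cGD_pos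
  have h3 := hfam.cR_pos r
  have h4 := S.lam_pos r
  unfold Θ
  positivity

lemma sum_size_rpow_le (hexp : S.ExponentsOK) (hfam : S.FamilyOK) (c : S.Λ → Coeff X)
    (i : S.Index) (k : ℕ) : ∑ W ∈ P.level k, S.size c i k W ^ e.p ≤
      (ENNReal.ofReal (S.Θ i.1) * S.rate ^ ((k - i.2.1) + (i.2.1 - k))) ^ e.p *
        ‖c i.1 i.2.1 i.2.2‖ₑ ^ e.p := by
  classical
  have hp := e.one_le_p
  have h0 : 0 < e.p := by linarith
  have hsup : ∑ W ∈ P.level k, S.size c i k W ^ e.p = ∑ W ∈ S.tile i k,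
      ENNReal.ofReal ((S.branch i.1).coef (S.cR i.1) i.2.2 W ^ e.p) *
        ‖c i.1 i.2.1 i.2.2‖ₑ ^ e.p := by
    rw [← Finset.sum_subset (S.tile_subset i k)]
    · refine Finset.sum_congr rfl fun W hW => ?_
      have hpos := (S.branch i.1).coef_pos (hfam.cR_pos i.1) i.2.2.2 (S.tile_subset i k hW)
      rw [size, if_pos hW, ENNReal.mul_rpow_of_nonneg _ _ h0.le,
        ENNReal.ofReal_rpow_of_nonneg hpos.le h0.le, mul_comm]
    · intro W _ hW
      rw [size, if_neg hW, ENNReal.zero_rpow_of_pos h0]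
  rw [hsup, ← Finset.sum_mul]
  gcongr
  rcases lt_or_ge k (P.k₀ ((S.branch i.1).pre i.2.2)) with hk | hk
  · simp [S.tile_eq_empty i hk]
  have habs := hfam.abs_ε i.1
  have h1 := (S.branch i.1).sum_coef_rpow_le hp (hfam.cR_pos i.1) (γ := S.γ) (Λ := S.lam i.1)
    (lam := ⨆ r, S.lam r) (by rw [habs]; exact hexp.ε_pos) hexp.γ_mem
    (by rw [habs]; rfl) (lam_le_iSup hfam i.1) (hfam.lam_lt_one i.1).le i.2.2.2 hk
    (S.sum_tile_le i hk)
  rw [habs] at h1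
  have hlam0 : 0 ≤ ⨆ r, S.lam r := (S.lam_pos i.1).le.trans (lam_le_iSup hfam i.1)
  have hΘ := Θ_pos hfam i.1
  rw [rate, ← ENNReal.ofReal_pow (by positivity), ← ENNReal.ofReal_mul hΘ.le,
    ENNReal.ofReal_rpow_of_nonneg (by positivity) h0.le,
    ← ENNReal.ofReal_sum_of_nonneg fun W hW => Real.rpow_nonneg
      ((S.branch i.1).coef_pos (hfam.cR_pos i.1) i.2.2.2 (S.tile_subset i k hW)).le _]
  exact ENNReal.ofReal_le_ofReal h1

/-- The total contribution of the level `j` of the `r`-th local grid. -/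
def levelSum (c : S.Λ → Coeff X) (r : S.Λ) (j k : ℕ) (W : Set X) : ℝ≥0∞ :=
  ∑' Q : {Q : Set X // Q ∈ (S.branch r).G.level j}, S.size c ⟨r, j, Q⟩ k W

lemma sum_levelSum_rpow_le (hexp : S.ExponentsOK) (hfam : S.FamilyOK) (c : S.Λ → Coeff X)
    (r : S.Λ) (j k : ℕ) : ∑ W ∈ P.level k, levelSum c r j k W ^ e.p ≤
      (ENNReal.ofReal (S.Θ r) * S.rate ^ ((k - j) + (j - k))) ^ e.p *
        ∑ Q ∈ (S.branch r).G.level j, ‖c r j Q‖ₑ ^ e.p := by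
  have h0 : 0 < e.p := by linarith [e.one_le_p]
  have h1 : ∀ W ∈ P.level k, levelSum c r j k W ^ e.p =
      ∑ Q : {Q : Set X // Q ∈ (S.branch r).G.level j}, S.size c ⟨r, j, Q⟩ k W ^ e.p := by
    intro W hW
    rw [levelSum, tsum_fintype]
    refine rpow_sum_of_subsingleton_support h0 _ _ fun Q _ R _ hne => ?_
    by_contra! h
    have hQ : W ∈ S.tile ⟨r, j, Q⟩ k := by
      by_contra hn; exact h.1 (if_neg hn)
    have hR : W ∈ S.tile ⟨r, j, R⟩ k := by
      by_contra hn; exact h.2 (if_neg hn)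
    obtain ⟨x, hx⟩ := P.nonempty_of_mem hW
    have hxQ := (S.branch r).mem_pre_iff.1 (S.subset_pre_of_mem_tile hQ hx)
    have hxR := (S.branch r).mem_pre_iff.1 (S.subset_pre_of_mem_tile hR hx)
    exact Set.disjoint_left.1 ((S.branch r).G_disjoint j Q Q.2 R R.2
      fun h => hne (Subtype.ext h)) hxQ.2 hxR.2
  rw [Finset.sum_congr rfl h1, Finset.sum_comm, ← Finset.sum_coe_sort ((S.branch r).G.level j),
    Finset.mul_sum]
  exact Finset.sum_le_sum fun Q _ => sum_size_rpow_le hexp hfam c ⟨r, j, Q⟩ k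

lemma levelNorm_levelSum_le (hexp : S.ExponentsOK) (hfam : S.FamilyOK) (c : S.Λ → Coeff X)
    (r : S.Λ) (j k : ℕ) : (∑ W ∈ P.level k, levelSum c r j k W ^ e.p) ^ (1 / e.p) ≤
      S.rate ^ ((k - j) + (j - k)) * (ENNReal.ofReal (S.Θ r) *
        (∑ Q ∈ (S.branch r).G.level j, ‖c r j Q‖ₑ ^ e.p) ^ (1 / e.p)) := by
  have h0 : 0 < e.p := by linarith [e.one_le_p]
  refine (ENNReal.rpow_le_rpow (sum_levelSum_rpow_le hexp hfam c r j k)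
    (by positivity)).trans (le_of_eq ?_)
  rw [ENNReal.mul_rpow_of_nonneg _ _ (by positivity), ← ENNReal.rpow_mul,
    mul_one_div_cancel h0.ne', ENNReal.rpow_one]
  ring

lemma tsum_size_eq (c : S.Λ → Coeff X) (k : ℕ) (W : Set X) :
    ∑' i, S.size c i k W = ∑' j, ∑' r, levelSum c r j k W := by
  rw [ENNReal.tsum_sigma', ENNReal.tsum_comm]
  refine tsum_congr fun r => ?_
  rw [ENNReal.tsum_sigma']
  rfl

lemma ellNorm_levelSize_le_of_forall {u : ℕ → ℝ≥0∞} {c : S.Λ → Coeff X}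
    (h : ∀ j k, (∑ W ∈ P.level k, (∑' r, levelSum c r j k W) ^ e.p) ^ (1 / e.p) ≤
      S.rate ^ ((k - j) + (j - k)) * u j) :
    ellNorm e.q (AtomicFamily.levelSize P e.p (S.size c)) ≤ S.D * ellNorm e.q u := by
  refine le_trans (ellNorm_mono fun k => ?_) (ellNorm_geometric_conv_le e.one_le_q S.rate u)
  unfold AtomicFamily.levelSize
  simp_rw [tsum_size_eq]
  exact (sum_Lp_tsum_le e.one_le_p _ _).trans (ENNReal.tsum_le_tsum fun j => h j k)

lemma ellNorm_levelSize_le (hexp : S.ExponentsOK) (hfam : S.FamilyOK) (c : S.Λ → Coeff X) :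
    ellNorm e.q (AtomicFamily.levelSize P e.p (S.size c)) ≤ S.D * ellNorm e.q (fun j =>
      ∑' r, ENNReal.ofReal (S.Θ r) *
        (∑ Q ∈ (S.branch r).G.level j, ‖c r j Q‖ₑ ^ e.p) ^ (1 / e.p)) := by
  refine ellNorm_levelSize_le_of_forall fun j k => ?_
  rw [← ENNReal.tsum_mul_left]
  exact (sum_Lp_tsum_le e.one_le_p _ _).trans
    (ENNReal.tsum_le_tsum fun r => levelNorm_levelSum_le hexp hfam c r j k)

lemma ellNorm_levelSize_le' (hexp : S.ExponentsOK) (hfam : S.FamilyOK) (c : S.Λ → Coeff X) :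
    ellNorm e.q (AtomicFamily.levelSize P e.p (S.size c)) ≤ S.D * (S.N ^ (1 - 1 / e.p) *
      ellNorm e.q (fun j => (∑' r, ENNReal.ofReal (S.Θ r) ^ e.p *
        ∑ Q ∈ (S.branch r).G.level j, ‖c r j Q‖ₑ ^ e.p) ^ (1 / e.p))) := by
  have hp := e.one_le_p
  have h0 : 0 < e.p := by linarith
  rw [← ellNorm_const_mul e.one_le_q]
  refine ellNorm_levelSize_le_of_forall fun j k => ?_
  have hN : ∀ W ∈ P.level k, (∑' r, levelSum c r j k W) ^ e.p ≤
      S.N ^ (e.p - 1) * ∑' r, levelSum c r j k W ^ e.p := by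
    intro W hW
    refine tsum_rpow_le_encard_mul hp _ (A := {r | W ⊆ (S.branch r).dom}) (fun r hr => ?_) ?_
    · unfold levelSum
      refine ENNReal.tsum_eq_zero.2 fun Q => if_neg fun hWt => hr ?_
      exact S.subset_dom_of_mem_tile hWt
    · unfold N
      exact le_iSup_of_le k (le_iSup₂_of_le W hW le_rfl)
  set x := S.rate ^ ((k - j) + (j - k)) with hx
  calc (∑ W ∈ P.level k, (∑' r, levelSum c r j k W) ^ e.p) ^ (1 / e.p)
      ≤ (S.N ^ (e.p - 1) * ∑' r, (ENNReal.ofReal (S.Θ r) * x) ^ e.p *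
          ∑ Q ∈ (S.branch r).G.level j, ‖c r j Q‖ₑ ^ e.p) ^ (1 / e.p) := by
        refine ENNReal.rpow_le_rpow ((Finset.sum_le_sum hN).trans ?_) (by positivity)
        rw [← Finset.mul_sum, ← Summable.tsum_finsetSum fun _ _ => ENNReal.summable]
        gcongr with r
        exact sum_levelSum_rpow_le hexp hfam c r j k
    _ = (x ^ e.p * (S.N ^ (e.p - 1) * ∑' r, ENNReal.ofReal (S.Θ r) ^ e.p *
          ∑ Q ∈ (S.branch r).G.level j, ‖c r j Q‖ₑ ^ e.p)) ^ (1 / e.p) := by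
        congr 1
        simp_rw [ENNReal.mul_rpow_of_nonneg _ x h0.le, mul_comm _ (x ^ e.p), mul_assoc,
          ENNReal.tsum_mul_left]
        ring
    _ = _ := by
        rw [ENNReal.mul_rpow_of_nonneg _ _ (by positivity),
          ENNReal.mul_rpow_of_nonneg _ _ (by positivity), ← ENNReal.rpow_mul, ← ENNReal.rpow_mul,
          mul_one_div_cancel h0.ne', ENNReal.rpow_one]
        congr 4
        field_simp

lemma hasSum_piece (c : S.Λ → Coeff X) (i : S.Index) (x : X) :
    HasSum (fun k => ∑ W ∈ P.level k, S.piece c i k W x)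
      (c i.1 i.2.1 i.2.2 * (S.branch i.1).G.atom e.s e.p i.2.2 ((S.branch i.1).ext x) *
        S.weight i.1 x) := by
  by_cases hx : x ∈ (S.branch i.1).pre i.2.2
  · obtain ⟨k, W, hW, hxW⟩ := (S.mem_pre_iff_tile i x).1 hx
    have hother : ∀ l, ∀ V ∈ P.level l, V ≠ W → S.piece c i l V x = 0 := by
      intro l V _ hne
      unfold piece
      split_ifs with hV
      · have : x ∉ V := fun hxV =>
          Set.disjoint_left.1 (S.tile_disjoint i hV hW hne) hxV hxW
        simp [this]
      · rfl
    have hk : ∑ V ∈ P.level k, S.piece c i k V x =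
        c i.1 i.2.1 i.2.2 * (S.branch i.1).G.atom e.s e.p i.2.2 ((S.branch i.1).ext x) *
        S.weight i.1 x := by
      rw [Finset.sum_eq_single_of_mem W (S.tile_subset i k hW) (hother k), piece, if_pos hW]
      have hxQ := ((S.branch i.1).mem_pre_iff.1 hx).2
      simp [Grid.atom, hxQ, hxW]
    rw [← hk]
    refine hasSum_single k fun l hl => Finset.sum_eq_zero fun V hV => hother l V hV ?_
    rintro rfl
    exact hl (P.level_unique hV (S.tile_subset i k hW))
  · have h1 : ∀ k, ∑ W ∈ P.level k, S.piece c i k W x = 0 := by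
      refine fun k => Finset.sum_eq_zero fun W _ => ?_
      unfold piece
      split_ifs with hW
      · have : x ∉ W := fun hxW => hx (S.subset_pre_of_mem_tile hW hxW)
        simp [this]
      · rfl
    have h2 : (S.branch i.1).G.atom e.s e.p i.2.2 ((S.branch i.1).ext x) * S.weight i.1 x = 0 := by
      by_cases hd : x ∈ (S.branch i.1).dom
      · have : (S.branch i.1).ext x ∉ (i.2.2 : Set X) := fun h =>
          hx ((S.branch i.1).mem_pre_iff.2 ⟨hd, h⟩)
        simp [Grid.atom, this]
      · simp [weight, hd]
    simp_rw [h1, mul_assoc, h2, mul_zero]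
    exact hasSum_zero

lemma ae_hasSum_transfer (hexp : S.ExponentsOK) (hfam : S.FamilyOK) {c : S.Λ → Coeff X}
    {f : X → ℂ} (hc : ∀ r, (S.branch r).G.IsRep e.s e.p e.q (c r) ((S.branch r).ran.indicator f))
    (hfin : ellNorm e.q (AtomicFamily.levelSize P e.p (S.size c)) < ∞) :
    ∀ᵐ x ∂m, HasSum (fun k => ∑ W ∈ P.level k, ∑' i, S.piece c i k W x) (S.transfer f x) := by
  have hβ : 0 < S.β := e.s_pos.trans hexp.s_lt_β
  have h1 := (atomicFamily hfam c).ae_tsum_lt_top e.s_pos hβ e.one_le_p e.one_le_q hfin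
  have h2 : ∀ᵐ x ∂m, ∀ r, x ∈ (S.branch r).dom →
      HasSum (fun j => (S.branch r).G.layer e.s e.p (c r) j ((S.branch r).ext x))
        (f ((S.branch r).ext x)) := by
    refine ae_all_iff.2 fun r => ?_
    have := (hc r).1.ae_hasSum e.one_le_p
      (GoodGrid.aestronglyMeasurable_layer (S.branch r).G e.s e.p (c r))
    filter_upwards [(S.branch r).ae_ext this] with x hx hxd
    have h3 := hx hxd
    rwa [Set.indicator_of_mem ((S.branch r).ext_mem_ran hxd)] at h3
  filter_upwards [h1, h2] with x h1 h2
  have hswap : ∑' i, ∑' k, ∑ W ∈ P.level k, ‖S.piece c i k W x‖ₑ < ∞ := by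
    rw [ENNReal.tsum_comm]
    simp_rw [Summable.tsum_finsetSum fun _ _ => ENNReal.summable]
    exact h1
  have hsum : Summable fun ik : S.Index × ℕ => ∑ W ∈ P.level ik.2, S.piece c ik.1 ik.2 W x := by
    refine Summable.of_norm (tsum_enorm_ne_top_iff_summable_norm.1 (ne_top_of_le_ne_top hswap.ne ?_))
    rw [ENNReal.tsum_prod (f := fun i k => ‖∑ W ∈ P.level k, S.piece c i k W x‖ₑ)]
    exact ENNReal.tsum_le_tsum fun i => ENNReal.tsum_le_tsum fun k => enorm_sum_le _ _
  obtain ⟨T, hT⟩ := hsum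
  have hi := hT.prod_fiberwise fun i => hasSum_piece c i x
  have hk : HasSum (fun k => ∑ W ∈ P.level k, ∑' i, S.piece c i k W x) T := by
    have h3 := ((Equiv.prodComm ℕ S.Index).hasSum_iff (f := fun ik : S.Index × ℕ =>
      ∑ W ∈ P.level ik.2, S.piece c ik.1 ik.2 W x)).2 hT
    refine h3.prod_fiberwise fun k => ?_
    simp only [Function.comp_def, Equiv.prodComm_apply, Prod.swap_prod_mk]
    refine hasSum_sum fun W hW => (Summable.of_norm (tsum_enorm_ne_top_iff_summable_norm.1
      (ne_top_of_le_ne_top h1.ne ?_))).hasSum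
    exact (Finset.single_le_sum (f := fun W => ∑' i, ‖S.piece c i k W x‖ₑ)
      (fun _ _ => zero_le) hW).trans
      (ENNReal.le_tsum (f := fun k => ∑ W ∈ P.level k, ∑' i, ‖S.piece c i k W x‖ₑ) k)
  have hr : HasSum (fun r => S.part r f x) T := by
    refine hi.sigma fun r => ?_
    have hsr := hi.summable.sigma_factor r
    have h4 := hsr.hasSum
    have h5 : HasSum (fun j => (S.branch r).G.layer e.s e.p (c r) j ((S.branch r).ext x) *
        S.weight r x) (∑' jQ : (Σ j : ℕ, {Q : Set X // Q ∈ (S.branch r).G.level j}),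
          c r jQ.1 jQ.2 * (S.branch r).G.atom e.s e.p jQ.2 ((S.branch r).ext x) *
            S.weight r x) := by
      refine h4.sigma fun j => ?_
      have h6 : (S.branch r).G.layer e.s e.p (c r) j ((S.branch r).ext x) * S.weight r x =
          ∑ Q : {Q : Set X // Q ∈ (S.branch r).G.level j},
            c r j Q * (S.branch r).G.atom e.s e.p Q ((S.branch r).ext x) * S.weight r x := by
        rw [Grid.layer, Finset.sum_mul, ← Finset.sum_coe_sort ((S.branch r).G.level j)]
      rw [h6]
      exact hasSum_fintype _
    have h7 : HasSum (fun j => (S.branch r).G.layer e.s e.p (c r) j ((S.branch r).ext x) *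
        S.weight r x) (S.part r f x) := by
      rw [part_eq, mul_comm]
      by_cases hxd : x ∈ (S.branch r).dom
      · exact (h2 r hxd).mul_right _
      · simp only [weight, Set.indicator_of_notMem hxd, mul_zero]
        exact hasSum_zero
    rw [h7.unique h5]
    exact h4
  have : S.transfer f x = T := hr.tsum_eq
  rwa [this]

/-- The image of a sliced representation has a representation by canonical atoms. -/
theorem exists_isRep_transfer (hexp : S.ExponentsOK) (hfam : S.FamilyOK) (hD : S.D ≠ ∞)
    {C : ℝ≥0} {d : Coeff X} (h : S.HasRegularSlicing C d) {C' : ℝ≥0∞}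
    (hC' : P.convConst e.s S.β e.p e.q < C') :
    ∃ f : X → ℂ, P.IsRep e.s e.p e.q d f ∧ ∃ z, P.IsRep e.s e.p e.q z (S.transfer f) ∧
      P.cost e.p e.q z ≤ C' * (S.D * (C * P.cost e.p e.q d)) := by
  have hβ : 0 < S.β := e.s_pos.trans hexp.s_lt_β
  obtain ⟨f, hf, c, hc, hle, -⟩ := h
  have hle' : ellNorm e.q (AtomicFamily.levelSize P e.p (S.size c)) ≤
      S.D * (C * P.cost e.p e.q d) := by
    rcases hle with hle | hle
    · exact (ellNorm_levelSize_le hexp hfam c).trans (by gcongr)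
    · exact (ellNorm_levelSize_le' hexp hfam c).trans (by gcongr)
  have hfin := hle'.trans_lt (ENNReal.mul_lt_top hD.lt_top
    (ENNReal.mul_lt_top ENNReal.coe_lt_top hf.2))
  obtain ⟨z, hz, hzc⟩ := (atomicFamily hfam c).exists_isRep e.s_pos hβ e.one_le_p e.one_le_q hfin
    (ae_hasSum_transfer hexp hfam hc hfin) hC'
  exact ⟨f, hf, z, hz, hzc.trans (by gcongr)⟩

end TransferSystem

end BesovGrid

namespace QuasiCompact

/-! ## Operators that extend to contractions of a larger space -/

variable {B L : Type*} [NormedAddCommGroup B] [NormedSpace ℂ B] [NormedAddCommGroup L]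
  [NormedSpace ℂ L] {ι : B →L[ℂ] L} {T : L →L[ℂ] L} {A : B →L[ℂ] B}

lemma map_pow (h : ∀ f, ι (A f) = T (ι f)) (n : ℕ) (f : B) : ι ((A ^ n) f) = (T ^ n) (ι f) := by
  induction n with
  | zero => rfl
  | succ n ih =>
    rw [pow_succ', pow_succ', mul_apply_eq_comp, mul_apply_eq_comp, h, ih]

lemma norm_pow_apply_le_of_contraction (hT : ∀ u, ‖T u‖ ≤ ‖u‖) (n : ℕ) (u : L) :
    ‖(T ^ n) u‖ ≤ ‖u‖ := by
  induction n with
  | zero => rfl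
  | succ n ih =>
    rw [pow_succ', mul_apply_eq_comp]
    exact (hT _).trans ih

/-- A Lasota–Yorke inequality bounds the powers of an operator. -/
lemma exists_norm_pow_le (h : ∀ f, ι (A f) = T (ι f)) (hT : ∀ u, ‖T u‖ ≤ ‖u‖) {θ : ℝ}
    (hθ0 : 0 ≤ θ) (hθ : θ < 1) {G : L →L[ℂ] B} (hG : ‖A - G ∘L ι‖ ≤ θ) :
    ∃ M : ℝ, ∀ n : ℕ, ‖A ^ n‖ ≤ M := by
  set b := ‖G‖ * ‖ι‖ with hb
  have hb0 : 0 ≤ b := by positivity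
  have hM0 : 0 ≤ 1 + b / (1 - θ) := by have := sub_pos.2 hθ; positivity
  refine ⟨1 + b / (1 - θ), fun n => ContinuousLinearMap.opNorm_le_bound _ hM0 fun f => ?_⟩
  induction n with
  | zero =>
    rw [pow_zero, one_apply_eq_self]
    have : 0 ≤ b / (1 - θ) * ‖f‖ := by have := sub_pos.2 hθ; positivity
    linarith
  | succ n ih =>
    have h1 : A ((A ^ n) f) = (A - G ∘L ι) ((A ^ n) f) + G ((T ^ n) (ι f)) := by
      rw [← map_pow h]
      simp
    rw [pow_succ', mul_apply_eq_comp, h1]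
    have h2 : ‖(A - G ∘L ι) ((A ^ n) f)‖ ≤ θ * ((1 + b / (1 - θ)) * ‖f‖) :=
      (ContinuousLinearMap.le_of_opNorm_le _ hG _).trans (by gcongr)
    have h3 : ‖G ((T ^ n) (ι f))‖ ≤ b * ‖f‖ :=
      calc ‖G ((T ^ n) (ι f))‖ ≤ ‖G‖ * ‖(T ^ n) (ι f)‖ := G.le_opNorm _
        _ ≤ ‖G‖ * (‖ι‖ * ‖f‖) := by
          gcongr
          exact (norm_pow_apply_le_of_contraction hT n _).trans (ι.le_opNorm f)
        _ = b * ‖f‖ := by rw [hb, mul_assoc]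
    have h4 : θ * (1 + b / (1 - θ)) + b ≤ 1 + b / (1 - θ) := by
      have h5 := sub_pos.2 hθ
      have h6 : b / (1 - θ) * (1 - θ) = b := div_mul_cancel₀ _ h5.ne'
      nlinarith
    calc ‖(A - G ∘L ι) ((A ^ n) f) + G ((T ^ n) (ι f))‖
        ≤ θ * ((1 + b / (1 - θ)) * ‖f‖) + b * ‖f‖ := (norm_add_le _ _).trans (add_le_add h2 h3)
      _ = (θ * (1 + b / (1 - θ)) + b) * ‖f‖ := by ring
      _ ≤ _ := by gcongr

/-- An eigenvector of a contraction for a unimodular eigenvalue is no closer to a coboundary than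
to zero. -/
lemma norm_le_norm_sub_coboundary (hT : ∀ u, ‖T u‖ ≤ ‖u‖) {z : ℂ} (hz : ‖z‖ = 1) {u : L}
    (hu : T u = z • u) (g : L) : ‖u‖ ≤ ‖u - (T g - z • g)‖ := by
  have hz0 : z ≠ 0 := by rintro rfl; simp at hz
  set v := u - (T g - z • g) with hv
  have key : ∀ n : ℕ, ∃ g' : L, ‖g'‖ ≤ ‖g‖ ∧ ‖(n : ℂ) • u - z • (g' - g)‖ ≤ n * ‖v‖ := by
    intro n
    induction n with
    | zero => exact ⟨g, le_rfl, by simp⟩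
    | succ n ih =>
      obtain ⟨g', h1, h2⟩ := ih
      refine ⟨z⁻¹ • T g', ?_, ?_⟩
      · rw [norm_smul, norm_inv, hz, inv_one, one_mul]
        exact (hT g').trans h1
      · have e : ((n + 1 : ℕ) : ℂ) • u - z • (z⁻¹ • T g' - g) =
            v + z⁻¹ • T ((n : ℂ) • u - z • (g' - g)) := by
          simp only [hv, map_sub, map_smul, hu, smul_sub, smul_smul, mul_inv_cancel₀ hz0,
            inv_mul_cancel₀ hz0, one_smul, mul_comm (n : ℂ) z, inv_mul_cancel_left₀ hz0]
          push_cast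
          module
        rw [e]
        calc _ ≤ ‖v‖ + ‖z⁻¹ • T ((n : ℂ) • u - z • (g' - g))‖ := norm_add_le _ _
          _ ≤ ‖v‖ + n * ‖v‖ := by
            rw [norm_smul, norm_inv, hz, inv_one, one_mul]
            gcongr
            exact (hT _).trans h2
          _ = _ := by push_cast; ring
  have h3 : ∀ n : ℕ, (‖u‖ - ‖v‖) * n ≤ 2 * ‖g‖ := by
    intro n
    obtain ⟨g', h1, h2⟩ := key n
    have h4 : ‖(n : ℂ) • u‖ ≤ n * ‖v‖ + ‖z • (g' - g)‖ := by
      calc ‖(n : ℂ) • u‖ = ‖((n : ℂ) • u - z • (g' - g)) + z • (g' - g)‖ := by rw [sub_add_cancel]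
        _ ≤ _ := (norm_add_le _ _).trans (by gcongr)
    rw [norm_smul, norm_smul, hz, one_mul, Complex.norm_natCast] at h4
    have h5 := norm_sub_le g' g
    linarith
  by_contra! hlt
  obtain ⟨n, hn⟩ := exists_nat_gt (2 * ‖g‖ / (‖u‖ - ‖v‖))
  have h6 := h3 n
  rw [div_lt_iff₀ (sub_pos.2 hlt)] at hn
  linarith

/-- Eigenvectors of a contraction for unimodular eigenvalues belong to a densely embedded space on
which the operator is quasi-compact. -/
lemma IsQuasiCompact.exists_eigenvector [CompleteSpace B] {r M : ℝ} (hr : r < 1)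
    (hA : IsQuasiCompact r A) (hM : ∀ n : ℕ, ‖A ^ n‖ ≤ M) (h : ∀ f, ι (A f) = T (ι f))
    (hι : DenseRange ι) (hT : ∀ u, ‖T u‖ ≤ ‖u‖) {z : ℂ} (hz : ‖z‖ = 1) {u : L}
    (hu : T u = z • u) : ∃ f, ι f = u ∧ A f = z • f := by
  obtain ⟨π, -, hπ, -, -, hdec, -⟩ := hA.exists_proj hr hM hz
  set V := Module.End.eigenspace (A : Module.End ℂ B) z with hV
  have : FiniteDimensional ℂ V := hA.finiteDimensional_eigenspace (by rw [hz]; exact hr)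
  have hcl : IsClosed (V.map ι.toLinearMap : Set L) := Submodule.closed_of_finiteDimensional _
  have hmem : u ∈ V.map ι.toLinearMap := by
    rw [← SetLike.mem_coe, ← hcl.closure_eq, Metric.mem_closure_iff]
    intro ε hε
    obtain ⟨f, hf⟩ := hι.exists_dist_lt u hε
    obtain ⟨g, hg⟩ := hdec f
    refine ⟨ι (π f), ⟨π f, Module.End.mem_eigenspace_iff.2 (hπ f), rfl⟩, ?_⟩
    rw [dist_eq_norm] at hf ⊢
    have h1 : T (u - ι (π f)) = z • (u - ι (π f)) := by
      rw [map_sub, hu, ← h, hπ, map_smul, smul_sub]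
    refine (norm_le_norm_sub_coboundary hT hz h1 (ι g)).trans_lt ?_
    have h2 : u - ι (π f) - (T (ι g) - z • ι g) = u - ι f := by
      conv_rhs => rw [hg]
      rw [map_add, map_sub, map_smul, h]
      abel
    rwa [h2]
  obtain ⟨f, hf, rfl⟩ := hmem
  exact ⟨f, rfl, Module.End.mem_eigenspace_iff.1 hf⟩

end QuasiCompact

namespace BesovGrid

variable {X : Type*} [MeasurableSpace X] {m : Measure X} [IsProbabilityMeasure m]

/-! ## Quasi-compactness of the transfer operator -/

namespace AtomicFamily

variable {P : GoodGrid m} {s β p : ℝ} {q : ℝ≥0∞} {ι : Type*} [Countable ι]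
  {α : ι → ℕ → Set X → ℝ≥0∞} {φ : ι → ℕ → Set X → X → ℂ}

lemma ae_tsum_eq_zero (h : AtomicFamily P s β p q α φ) (hs : 0 < s) (hβ : 0 < β) (hp : 1 ≤ p)
    (hq : 1 ≤ q) (h0 : ellNorm q (levelSize P p α) = 0) :
    ∀ᵐ x ∂m, ∀ k, ∑ W ∈ P.level k, ∑' i, φ i k W x = 0 := by
  have hp0 : 0 < p := by linarith
  have h1 := h.tsum_lintegral_level_le hs hβ hp hq
  rw [h0, mul_zero, nonpos_iff_eq_zero, ENNReal.tsum_eq_zero] at h1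
  refine ae_all_iff.2 fun k => ?_
  have hmeas : AEMeasurable (fun x => ∑ W ∈ P.level k, ∑' i, ‖φ i k W x‖ₑ) m :=
    Finset.aemeasurable_fun_sum _ fun W hW =>
      AEMeasurable.tsum fun i => (h.aestronglyMeasurable i k W hW).enorm
  have h2 := h1 k
  rw [ENNReal.rpow_eq_zero_iff_of_pos (by positivity),
    lintegral_eq_zero_iff' (hmeas.pow_const p)] at h2
  filter_upwards [h2] with x hx
  have h3 : ∑ W ∈ P.level k, ∑' i, ‖φ i k W x‖ₑ = 0 :=
    (ENNReal.rpow_eq_zero_iff_of_pos hp0).1 hx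
  refine Finset.sum_eq_zero fun W hW => ?_
  have h4 := Finset.sum_eq_zero_iff.1 h3 W hW
  rw [ENNReal.tsum_eq_zero] at h4
  simp [fun i => enorm_eq_zero.1 (h4 i)]

end AtomicFamily

namespace TransferSystem

variable {P : GoodGrid m} {e : BesovIndex} {S : TransferSystem P P e}

lemma transfer_ae_eq_zero_of_slicing_zero (hexp : S.ExponentsOK) (hfam : S.FamilyOK)
    {d : Coeff X} (h : S.HasRegularSlicing 0 d) {f : X → ℂ} (hf : P.IsRep e.s e.p e.q d f) :
    S.transfer f =ᵐ[m] 0 := by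
  have hβ : 0 < S.β := e.s_pos.trans hexp.s_lt_β
  obtain ⟨f', hf', c, hc, hle, -⟩ := h
  have h0 : ellNorm e.q (AtomicFamily.levelSize P e.p (S.size c)) = 0 := by
    rw [ENNReal.coe_zero, zero_mul] at hle
    rw [← nonpos_iff_eq_zero, ← mul_zero S.D]
    rcases hle with hle | hle
    · exact (ellNorm_levelSize_le hexp hfam c).trans (by gcongr)
    · exact (ellNorm_levelSize_le' hexp hfam c).trans (by gcongr)
  have hff' : f =ᵐ[m] f' := hf.1.ae_eq e.one_le_p
    (GoodGrid.aestronglyMeasurable_layer _ _ _ _) hf'.1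
  filter_upwards [S.transfer_congr hff', ae_hasSum_transfer hexp hfam hc (h0 ▸ ENNReal.zero_lt_top),
    (atomicFamily hfam c).ae_tsum_eq_zero e.s_pos hβ e.one_le_p e.one_le_q h0] with x h1 h2 h3
  rw [h1]
  simp only [h3] at h2
  exact h2.unique hasSum_zero

lemma ne_zero_of_hasEssentialSlicing (hexp : S.ExponentsOK) (hfam : S.FamilyOK) {CFR CES : ℝ≥0}
    (hslice : S.HasEssentialSlicing CFR CES)
    (hint : ∀ f : BesovSpace P e, ∫ x, S.transfer f x ∂m = ∫ x, f x ∂m) : CES ≠ 0 := by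
  rintro rfl
  obtain ⟨P', hP', h⟩ := hslice
  obtain ⟨K, hK⟩ := P.exists_forall_notMem P' hP'
  have hne : (P.level K).Nonempty := by
    by_contra hemp
    have := P.cover K
    rw [Finset.not_nonempty_iff_eq_empty.1 hemp] at this
    simp at this
  obtain ⟨Q, hQ⟩ := hne
  obtain ⟨d, hd, -, hoff⟩ := P.isRep_single e.s_pos e.one_le_p e.one_le_q hQ
  have hrestr : (fun k => ((P' : Set (Set X))ᶜ).indicator (d k)) = d := by
    funext k R
    by_cases hR : R ∈ P'
    · have hRQ : R ≠ Q := by rintro rfl; exact hK K le_rfl R hQ hR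
      simp [hR, hoff k R hRQ]
    · simp [hR]
  have h1 := (h d _ hd.1).1
  rw [hrestr] at h1
  have h2 := transfer_ae_eq_zero_of_slicing_zero hexp hfam h1 hd.1
  obtain ⟨g, hg⟩ := BesovSpace.exists_atom (e := e) hQ
  have h3 := hint g
  rw [integral_congr_ae ((S.transfer_congr hg).trans h2), integral_congr_ae hg] at h3
  have h4 : ∫ x, P.atom e.s e.p Q x ∂m =
      ((m.real Q * m.real Q ^ (e.s - 1 / e.p) : ℝ) : ℂ) := by
    unfold Grid.atom
    rw [integral_indicator_const _ (P.measurableSet K Q hQ), Complex.real_smul]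
    push_cast
    rfl
  rw [h4] at h3
  have h5 := P.real_pos hQ
  have h6 : 0 < m.real Q * m.real Q ^ (e.s - 1 / e.p) := by positivity
  simp only [Pi.zero_apply, integral_zero] at h3
  exact h6.ne (by exact_mod_cast h3)

lemma D_ne_zero (S : TransferSystem P P e) : S.D ≠ 0 := by
  unfold D
  refine (ENNReal.div_pos two_ne_zero ?_).ne'
  exact ne_top_of_le_ne_top ENNReal.one_ne_top tsub_le_self

lemma one_le_canConst : 1 ≤ P.canConst e.s e.p e.q := le_sInf fun _ h => h.1

/-- The finiteness of the constants, and the contraction condition with strict majorants of the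
constants that are defined as infima. -/
lemma exists_constants (hexp : S.ExponentsOK) {CES : ℝ≥0} (hCES : CES ≠ 0)
    (hcontr : 6 * P.convConst e.s S.β e.p e.q * S.D * CES * P.canConst e.s e.p e.q < 1) :
    S.D ≠ ∞ ∧ ∃ C' C'' : ℝ≥0, P.convConst e.s S.β e.p e.q < C' ∧ P.canConst e.s e.p e.q < C'' ∧
      (C' : ℝ≥0∞) * (S.D * (CES * C'')) < 1 := by
  have hβ : 0 < S.β := e.s_pos.trans hexp.s_lt_β
  have hconv := P.convConst_ne_zero e.s_pos hβ e.one_le_p e.one_le_q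
  have hcan := one_le_canConst (P := P) (e := e)
  have hD := S.D_ne_zero
  set a := P.convConst e.s S.β e.p e.q
  set b := P.canConst e.s e.p e.q
  have hb0 : b ≠ 0 := (zero_lt_one.trans_le hcan).ne'
  have hC0 : (CES : ℝ≥0∞) ≠ 0 := by exact_mod_cast hCES
  have htop := (hcontr.trans ENNReal.one_lt_top).ne
  have hbt : b ≠ ∞ := fun h => htop <| by
    rw [h]; exact ENNReal.mul_top (by positivity)
  have hDt : S.D ≠ ∞ := fun h => htop <| by
    rw [h, ENNReal.mul_top (by positivity), ENNReal.top_mul hC0, ENNReal.top_mul hb0]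
  have hat : a ≠ ∞ := fun h => htop <| by
    rw [h, ENNReal.mul_top (by norm_num), ENNReal.top_mul hD, ENNReal.top_mul hC0,
      ENNReal.top_mul hb0]
  have hlt : ∀ x : ℝ≥0∞, x ≠ 0 → x ≠ ∞ → x < 2 * x := fun x h0 ht => by
    rw [two_mul]; exact ENNReal.lt_add_right ht h0
  refine ⟨hDt, (2 * a).toNNReal, (2 * b).toNNReal, ?_, ?_, ?_⟩
  · rw [ENNReal.coe_toNNReal (by finiteness)]; exact hlt a hconv hat
  · rw [ENNReal.coe_toNNReal (by finiteness)]; exact hlt b hb0 hbt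
  · rw [ENNReal.coe_toNNReal (by finiteness), ENNReal.coe_toNNReal (by finiteness)]
    refine lt_of_le_of_lt ?_ hcontr
    calc 2 * a * (S.D * (CES * (2 * b))) = 4 * a * S.D * CES * b := by ring
      _ ≤ _ := by gcongr; norm_num

/-- The image of a function with a sliced representation belongs to `B^s_{p,q}`. -/
lemma IsMarkov.exists_transfer (hS : S.IsMarkov) (hexp : S.ExponentsOK) (hD : S.D ≠ ∞)
    {C : ℝ≥0} {d : Coeff X} (h : S.HasRegularSlicing C d) {C' : ℝ≥0}
    (hC' : P.convConst e.s S.β e.p e.q < C') {f : BesovSpace P e}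
    (hf : P.IsRep e.s e.p e.q d f) {A : ℝ≥0∞} (hd : P.cost e.p e.q d ≤ A) :
    ∃ g : BesovSpace P e, BesovSpace.inclL1 g = hS.opL1 (BesovSpace.inclL1 f) ∧
      ‖g‖ₑ ≤ C' * (S.D * (C * A)) := by
  obtain ⟨f', hf', z, hz, hzc⟩ := exists_isRep_transfer hexp hS.family hD h hC'
  have hff' : f =ᵐ[m] f' := hf.1.ae_eq e.one_le_p
    (GoodGrid.aestronglyMeasurable_layer _ _ _ _) hf'.1
  have h1 := P.eBesovNorm_le hz
  obtain ⟨g, hg⟩ := BesovSpace.exists_of_eBesovNorm_ne_top (h1.trans_lt hz.2).ne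
  refine ⟨g, Lp.ext ?_, ?_⟩
  · exact (((BesovSpace.coeFn_inclL1 g).trans hg).trans
      (S.transfer_congr (hff'.symm.trans (BesovSpace.coeFn_inclL1 f).symm))).trans
      (hS.coeFn_opL1 _).symm
  · rw [BesovSpace.enorm_eq, P.eBesovNorm_congr hg]
    exact h1.trans (hzc.trans (by gcongr))

end TransferSystem

end BesovGrid

namespace BesovGrid

variable {X : Type*} [MeasurableSpace X] {m : Measure X} [IsProbabilityMeasure m]

open BesovSpace

lemma cost_indicator_le (G : Grid m) {p : ℝ} (hp : 1 ≤ p) (q : ℝ≥0∞) (A : Set (Set X))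
    (d : Coeff X) : G.cost p q (fun k => A.indicator (d k)) ≤ G.cost p q d := by
  refine ellNorm_mono fun k => ?_
  unfold Grid.levelNorm
  gcongr with Q
  exact enorm_indicator_le_enorm_self _ _

namespace TransferSystem

variable {P : GoodGrid m} {e : BesovIndex} {S : TransferSystem P P e}

/-- The part of a canonical representation that uses finitely many atoms. -/
lemma exists_finite_part (P : GoodGrid m) (e : BesovIndex) {P' : Finset (Set X)}
    (hP' : ∀ Q ∈ P', ∃ k, Q ∈ P.level k) (κ : ℕ → Set X → (Lp ℂ 1 m →L[ℂ] ℂ)) :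
    ∃ G : Lp ℂ 1 m →L[ℂ] BesovSpace P e, (∃ V : Submodule ℂ (BesovSpace P e),
      FiniteDimensional ℂ V ∧ ∀ u, G u ∈ V) ∧
      ∀ u, ∀ᵐ x ∂m, HasSum (fun k => P.layer e.s e.p
        (fun k => (P' : Set (Set X)).indicator fun Q => κ k Q u) k x) (G u x) := by
  classical
  obtain ⟨K, hK⟩ := P.exists_forall_notMem P' hP'
  have hb : ∀ k Q, Q ∈ P.level k → ∃ g : BesovSpace P e, g =ᵐ[m] P.atom e.s e.p Q :=
    fun k Q hQ => exists_atom hQ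
  choose! b hb using hb
  set t : Finset (Σ _ : ℕ, Set X) := (Finset.range K).sigma P.level with ht
  set c : Lp ℂ 1 m → Coeff X := fun u k => (P' : Set (Set X)).indicator fun Q => κ k Q u with hc
  set G : Lp ℂ 1 m →L[ℂ] BesovSpace P e :=
    ∑ i ∈ t, if i.2 ∈ P' then (κ i.1 i.2).smulRight (b i.1 i.2) else 0 with hG
  have hGu : ∀ u, G u = ∑ i ∈ t, c u i.1 i.2 • b i.1 i.2 := by
    intro u
    rw [hG, sum_apply]
    refine Finset.sum_congr rfl fun i _ => ?_
    split_ifs with h <;> simp [hc, h]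
  refine ⟨G, ⟨Submodule.span ℂ (t.image fun i => b i.1 i.2 : Finset (BesovSpace P e)),
    inferInstance, fun u => ?_⟩, fun u => ?_⟩
  · rw [hGu]
    refine Submodule.sum_mem _ fun i hi => Submodule.smul_mem _ _ (Submodule.subset_span ?_)
    exact_mod_cast Finset.mem_image_of_mem (fun i : Σ _ : ℕ, Set X => b i.1 i.2) hi
  · have h1 : ∀ᵐ x ∂m, ∀ i ∈ t, (c u i.1 i.2 • b i.1 i.2 : BesovSpace P e) x =
        c u i.1 i.2 * P.atom e.s e.p i.2 x := by
      refine (Finset.eventually_all t).2 fun i hi => ?_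
      filter_upwards [coeFn_smul (c u i.1 i.2) (b i.1 i.2),
        hb i.1 i.2 (Finset.mem_sigma.1 hi).2] with x h2 h3
      rw [h2, Pi.smul_apply, h3, smul_eq_mul]
    filter_upwards [h1, coeFn_sum t fun i => c u i.1 i.2 • b i.1 i.2] with x h2 h3
    have h4 : G u x = ∑ k ∈ Finset.range K, P.layer e.s e.p (c u) k x := by
      rw [hGu, h3, Finset.sum_congr rfl h2, ht, Finset.sum_sigma]
      rfl
    rw [h4]
    refine hasSum_sum_of_ne_finset_zero fun k hk => Finset.sum_eq_zero fun Q hQ => ?_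
    have : Q ∉ P' := hK k (by simpa using hk) Q hQ
    simp [this]

/-- The transfer operator acts on `B^s_{p,q}`, where it is quasi-compact. -/
theorem IsMarkov.exists_op (hS : S.IsMarkov) (hexp : S.ExponentsOK) {CFR CES : ℝ≥0}
    (hslice : S.HasEssentialSlicing CFR CES) (hCES : CES ≠ 0)
    (hcontr : 6 * P.convConst e.s S.β e.p e.q * S.D * CES * P.canConst e.s e.p e.q < 1) :
    ∃ Φ : BesovSpace P e →L[ℂ] BesovSpace P e, (∀ f, inclL1 (Φ f) = hS.opL1 (inclL1 f)) ∧
      ∃ θ : ℝ, 0 ≤ θ ∧ θ < 1 ∧ ∃ G : Lp ℂ 1 m →L[ℂ] BesovSpace P e,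
        IsCompactOperator (G ∘L inclL1 (P := P) (e := e)) ∧ ‖Φ - G ∘L inclL1 (P := P) (e := e)‖ ≤ θ := by
  obtain ⟨hD, C', C'', hC', hC'', hlt⟩ := exists_constants hexp hCES hcontr
  obtain ⟨C, ⟨-, κ, hκ⟩, hC⟩ := sInf_lt_iff.1 hC''
  obtain ⟨P', hP', hsl⟩ := hslice
  obtain ⟨G₀, ⟨V, hVfin, hV⟩, hG₀⟩ := exists_finite_part P e hP' κ
  set d : BesovSpace P e → Coeff X := fun f k Q => κ k Q (inclL1 f) with hd
  have hrep : ∀ f : BesovSpace P e, P.IsRep e.s e.p e.q (d f) f ∧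
      P.cost e.p e.q (d f) ≤ C'' * ‖f‖ₑ := by
    intro f
    obtain ⟨h1, h2⟩ := hκ f (memLp_one_iff_integrable.1 f.memLp_one) f.eBesovNorm_ne_top.lt_top
    refine ⟨h1, h2.trans ?_⟩
    rw [enorm_eq]
    gcongr
  set F : BesovSpace P e →L[ℂ] BesovSpace P e := G₀ ∘L inclL1 with hF
  have hlow : ∀ f, P.IsRep e.s e.p e.q
      (fun k => (P' : Set (Set X)).indicator (d f k)) (F f) := fun f =>
    (P.isRep_iff e.s_pos e.one_le_p e.one_le_q).2 ⟨hG₀ (inclL1 f),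
      (cost_indicator_le _ e.one_le_p _ _ _).trans_lt (hrep f).1.2⟩
  have hhigh : ∀ f, P.IsRep e.s e.p e.q
      (fun k => ((P' : Set (Set X))ᶜ).indicator (d f k)) (f - F f : BesovSpace P e) := by
    intro f
    refine (P.isRep_iff e.s_pos e.one_le_p e.one_le_q).2 ⟨?_,
      (cost_indicator_le _ e.one_le_p _ _ _).trans_lt (hrep f).1.2⟩
    filter_upwards [((P.isRep_iff e.s_pos e.one_le_p e.one_le_q).1 (hrep f).1).1,
      hG₀ (inclL1 f), coeFn_sub f (F f)] with x h1 h2 h3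
    rw [h3, Pi.sub_apply]
    refine (h1.sub h2).congr_fun fun k => ?_
    unfold Grid.layer
    rw [← Finset.sum_sub_distrib]
    refine Finset.sum_congr rfl fun Q _ => ?_
    by_cases hQ : Q ∈ P' <;> simp [hQ, hd]
  set θ' : ℝ≥0∞ := C' * (S.D * (CES * C'')) with hθ'
  set M' : ℝ≥0∞ := C' * (S.D * (CFR * C'')) with hM'
  have hM't : M' ≠ ∞ := by finiteness
  have hθ't : θ' ≠ ∞ := (hlt.trans ENNReal.one_lt_top).ne
  have hex1 : ∀ f : BesovSpace P e, ∃ g : BesovSpace P e,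
      inclL1 g = hS.opL1 (inclL1 (f - F f)) ∧ ‖g‖ₑ ≤ θ' * ‖f‖ₑ := by
    intro f
    obtain ⟨g, hg, hle⟩ := hS.exists_transfer hexp hD (hsl (d f) f (hrep f).1).1 hC' (hhigh f)
      ((cost_indicator_le _ e.one_le_p _ _ _).trans (hrep f).2)
    exact ⟨g, hg, hle.trans (le_of_eq (by rw [hθ']; ring))⟩
  have hex2 : ∀ f : BesovSpace P e, ∃ g : BesovSpace P e,
      inclL1 g = hS.opL1 (inclL1 (F f)) ∧ ‖g‖ₑ ≤ M' * ‖f‖ₑ := by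
    intro f
    obtain ⟨g, hg, hle⟩ := hS.exists_transfer hexp hD (hsl (d f) f (hrep f).1).2 hC' (hlow f)
      ((cost_indicator_le _ e.one_le_p _ _ _).trans (hrep f).2)
    exact ⟨g, hg, hle.trans (le_of_eq (by rw [hM']; ring))⟩
  choose g₁ hg₁ hn₁ using hex1
  choose g₂ hg₂ hn₂ using hex2
  have hreal : ∀ (a : ℝ≥0∞) (f g : BesovSpace P e), a ≠ ∞ → ‖g‖ₑ ≤ a * ‖f‖ₑ →
      ‖g‖ ≤ a.toReal * ‖f‖ := by
    intro a f g ha h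
    have := ENNReal.toReal_mono (ENNReal.mul_ne_top ha enorm_ne_top) h
    rwa [ENNReal.toReal_mul, toReal_enorm, toReal_enorm] at this
  have hsum : ∀ f, inclL1 (g₁ f + g₂ f) = hS.opL1 (inclL1 f) := by
    intro f
    rw [map_add, hg₁, hg₂, ← map_add, ← map_add, sub_add_cancel]
  set Φ : BesovSpace P e →L[ℂ] BesovSpace P e := LinearMap.mkContinuous
    { toFun := fun f => g₁ f + g₂ f
      map_add' := fun f g => inclL1_injective (by
        rw [map_add inclL1 (g₁ f + g₂ f), hsum, hsum, hsum, map_add, map_add])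
      map_smul' := fun a f => inclL1_injective (by
        rw [RingHom.id_apply, map_smul, hsum, hsum, map_smul, map_smul]) }
    (θ'.toReal + M'.toReal) (fun f => by
      rw [add_mul]
      exact (norm_add_le _ _).trans (add_le_add (hreal _ _ _ hθ't (hn₁ f))
        (hreal _ _ _ hM't (hn₂ f)))) with hΦ
  have hΦi : ∀ f, inclL1 (Φ f) = hS.opL1 (inclL1 f) := hsum
  refine ⟨Φ, hΦi, θ'.toReal, ENNReal.toReal_nonneg, ?_, Φ ∘L G₀, ?_, ?_⟩
  · have := (ENNReal.toReal_lt_toReal hθ't ENNReal.one_ne_top).2 hlt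
    simpa using this
  · exact (QuasiCompact.isCompactOperator_of_mapsTo_finiteDimensional (F := F) V
      fun f => hV _).clm_comp Φ
  · refine ContinuousLinearMap.opNorm_le_bound _ ENNReal.toReal_nonneg fun f => ?_
    have : (Φ - (Φ ∘L G₀) ∘L inclL1 (P := P) (e := e)) f = g₁ f := inclL1_injective (by
      rw [hg₁, ← hΦi, map_sub]
      rfl)
    rw [this]
    exact hreal _ _ _ hθ't (hn₁ f)

end TransferSystem

end BesovGrid

namespace BesovGrid

variable {X : Type*} [MeasurableSpace X] {m : Measure X} [IsProbabilityMeasure m]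

open BesovSpace

namespace TransferSystem

variable {P : GoodGrid m} {e : BesovIndex} {S : TransferSystem P P e}

lemma isMarkov (hfam : S.FamilyOK) (hL1 : S.BoundedToL1)
    (hpos : ∀ r, ∀ᵐ x ∂m, x ∈ (S.branch r).dom → 0 ≤ (S.g r x).re ∧ (S.g r x).im = 0)
    (hint : ∀ f : BesovSpace P e, ∫ x, S.transfer f x ∂m = ∫ x, f x ∂m) : S.IsMarkov :=
  ⟨hfam, weight_eq_norm hpos, fun hφ => tsum_lintegral_weight_mul hfam hL1 hpos hint hφ⟩

lemma one_mem_spectrum {Φ : BesovSpace P e →L[ℂ] BesovSpace P e}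
    (hΦ : ∀ f, Φ f =ᵐ[m] S.transfer f)
    (hint : ∀ f : BesovSpace P e, ∫ x, S.transfer f x ∂m = ∫ x, f x ∂m) :
    (1 : ℂ) ∈ spectrum ℂ Φ := by
  intro hu
  obtain ⟨u, hu⟩ := hu
  obtain ⟨g, hg⟩ := exists_indicator (e := e) P.univ_mem 1
  have h1 : (↑u * ↑u⁻¹ : BesovSpace P e →L[ℂ] BesovSpace P e) g = g := by
    rw [Units.mul_inv]; rfl
  rw [mul_apply_eq_comp, hu] at h1
  set f := (↑u⁻¹ : BesovSpace P e →L[ℂ] BesovSpace P e) g with hf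
  have h2 : f - Φ f = g := by
    rw [← h1]; simp
  have h3 : ∫ x, g x ∂m = ∫ x, f x ∂m - ∫ x, Φ f x ∂m := by
    rw [← h2, integral_congr_ae (coeFn_sub f (Φ f))]
    exact integral_sub (memLp_one_iff_integrable.1 f.memLp_one)
      (memLp_one_iff_integrable.1 (Φ f).memLp_one)
  rw [integral_congr_ae (hΦ f), hint, sub_self, integral_congr_ae hg] at h3
  simp at h3

lemma IsMarkov.exists_norm (hS : S.IsMarkov) {z : ℂ} (hz : ‖z‖ = 1) {u : Lp ℂ 1 m}
    (hu : hS.opL1 u = z • u) :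
    ∃ v : Lp ℂ 1 m, (v =ᵐ[m] fun x => (‖u x‖ : ℂ)) ∧ hS.opL1 v = v := by
  obtain ⟨v, hv, h⟩ := hS.exists_sgn_zpow hz hu 0
  exact ⟨v, by simpa using hv, by simpa using h⟩

lemma norm_sgn_zpow (y : ℂ) (k : ℤ) : ‖(y / (‖y‖ : ℂ)) ^ k * (‖y‖ : ℂ)‖ = ‖y‖ := by
  by_cases hy : y = 0
  · simp [hy]
  · have : ‖y‖ ≠ 0 := norm_ne_zero_iff.2 hy
    simp [this]

/-- The normalisation of the modulus of an invariant function. -/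
lemma exists_density {ρ₀ : BesovSpace P e} (hne : ρ₀ ≠ 0) {u : X → ℂ}
    (hρ₀ : ρ₀ =ᵐ[m] fun x => (‖u x‖ : ℂ)) : ∃ a : ℂ,
      (∀ᵐ x ∂m, 0 ≤ ((a • ρ₀ : BesovSpace P e) x).re ∧ ((a • ρ₀ : BesovSpace P e) x).im = 0) ∧
      ∫ x, (a • ρ₀ : BesovSpace P e) x ∂m = 1 := by
  have hi : ∫ x, ρ₀ x ∂m = ((∫ x, ‖u x‖ ∂m : ℝ) : ℂ) := by
    rw [integral_congr_ae hρ₀]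
    exact integral_ofReal
  have hint : Integrable (fun x => ‖u x‖) m := by
    have h1 := ((memLp_one_iff_integrable.1 ρ₀.memLp_one).congr hρ₀).norm
    simpa using h1
  have hpos : 0 < ∫ x, ‖u x‖ ∂m := by
    refine (integral_nonneg fun _ => norm_nonneg _).lt_of_ne' fun h0 => hne ?_
    rw [integral_eq_zero_iff_of_nonneg (fun _ => norm_nonneg _) hint] at h0
    refine inclL1_injective (Lp.ext ?_)
    rw [map_zero]
    filter_upwards [coeFn_inclL1 ρ₀, hρ₀, h0, Lp.coeFn_zero ℂ 1 m] with x h1 h2 h3 h4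
    rw [h1, h2, h4, h3]
    simp
  refine ⟨((∫ x, ‖u x‖ ∂m)⁻¹ : ℝ), ?_, ?_⟩
  · filter_upwards [coeFn_smul (((∫ x, ‖u x‖ ∂m)⁻¹ : ℝ) : ℂ) ρ₀, hρ₀] with x h1 h2
    rw [h1, Pi.smul_apply, h2, smul_eq_mul, ← Complex.ofReal_mul]
    exact ⟨mul_nonneg (inv_nonneg.2 hpos.le) (norm_nonneg _), Complex.ofReal_im _⟩
  · rw [integral_congr_ae (coeFn_smul _ ρ₀)]
    simp only [Pi.smul_apply]
    rw [integral_smul, hi, smul_eq_mul, ← Complex.ofReal_mul, inv_mul_cancel₀ hpos.ne',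
      Complex.ofReal_one]

end TransferSystem

end BesovGrid

end

open TransferSystem BesovSpace QuasiCompact in
theorem mainTheorem4 {I : Type*} [MeasurableSpace I] {m : Measure I} [IsProbabilityMeasure m]
    (P : GoodGrid m) (e : BesovIndex) (S : TransferSystem P P e)
    (hexp : S.ExponentsOK) (hfam : S.FamilyOK) (hL1 : S.BoundedToL1)
    (CFR CES : ℝ≥0) (hslice : S.HasEssentialSlicing CFR CES)
    (hcontr : 6 * P.convConst e.s S.β e.p e.q * S.D * CES * P.canConst e.s e.p e.q < 1)
    (hpos : ∀ r, ∀ᵐ x ∂m, x ∈ (S.branch r).dom → 0 ≤ (S.g r x).re ∧ (S.g r x).im = 0)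
    (hint : ∀ f : BesovSpace P e, ∫ x, S.transfer f x ∂m = ∫ x, f x ∂m) :
    Dense {u : Lp ℂ 1 m | ∃ f : BesovSpace P e, f =ᵐ[m] u} ∧
    ∃ (Φ : BesovSpace P e →L[ℂ] BesovSpace P e) (Φ₁ : Lp ℂ 1 m →L[ℂ] Lp ℂ 1 m),
      (∀ f : BesovSpace P e, Φ f =ᵐ[m] S.transfer f) ∧
      (∀ (f : BesovSpace P e) (u : Lp ℂ 1 m), f =ᵐ[m] u → Φ₁ u =ᵐ[m] Φ f) ∧
      (∃ δ ∈ Set.Ioo (0 : ℝ) 1, ∃ E : Finset ℂ,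
        (E : Set ℂ) = spectrum ℂ Φ ∩ {z | δ ≤ ‖z‖} ∧
        -- A
        E.Nonempty ∧ (∀ z ∈ E, ‖z‖ = 1) ∧
        (∀ z ∈ E, Module.End.HasEigenvalue (Φ : Module.End ℂ (BesovSpace P e)) z ∧
          FiniteDimensional ℂ (Module.End.eigenspace (Φ : Module.End ℂ (BesovSpace P e)) z) ∧
          ∀ f : BesovSpace P e, (Φ - z • 1) ((Φ - z • 1) f) = 0 → (Φ - z • 1) f = 0) ∧
        -- B
        (∃ (π : ℂ → (BesovSpace P e →L[ℂ] BesovSpace P e))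
            (R : BesovSpace P e →L[ℂ] BesovSpace P e),
          (∀ z ∈ E, π z * π z = π z ∧ Φ * π z = z • π z ∧ R * π z = 0 ∧ π z * R = 0) ∧
          (∀ z ∈ E, ∀ w ∈ E, z ≠ w → π w * π z = 0) ∧
          (∀ n : ℕ, 1 ≤ n → Φ ^ n = ∑ z ∈ E, z ^ n • π z + R ^ n) ∧
          (∃ K θ : ℝ, 0 < θ ∧ θ < 1 ∧ ∀ n : ℕ, ‖R ^ n‖ ≤ K * θ ^ n)) ∧
        -- E
        (∀ z ∈ E, ∃ n : ℕ, 0 < n ∧ z ^ n = 1)) ∧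
      (∃ K : ℝ, ∀ n : ℕ, ‖Φ ^ n‖ ≤ K) ∧
      -- C
      (∃ ρ : BesovSpace P e, (∀ᵐ x ∂m, 0 ≤ (ρ x).re ∧ (ρ x).im = 0) ∧
        ∫ x, ρ x ∂m = 1 ∧ Φ ρ = ρ) ∧
      -- D
      (∀ z : ℂ, ‖z‖ = 1 → ∀ u : Lp ℂ 1 m, Φ₁ u = z • u →
        (∃ f : BesovSpace P e, f =ᵐ[m] u) ∧
        (∃ v : Lp ℂ 1 m, (v =ᵐ[m] fun x => (‖u x‖ : ℂ)) ∧ Φ₁ v = v) ∧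
        ∀ k : ℤ, ∃ w : Lp ℂ 1 m,
          (w =ᵐ[m] fun x => (u x / (‖u x‖ : ℂ)) ^ k * (‖u x‖ : ℂ)) ∧ Φ₁ w = z ^ k • w) := by

  have hS : S.IsMarkov := isMarkov hfam hL1 hpos hint
  have hCES := ne_zero_of_hasEssentialSlicing hexp hfam hslice hint
  obtain ⟨Φ, hΦ, θ, hθ0, hθ, G, hG, hΦG⟩ := hS.exists_op hexp hslice hCES hcontr
  have hdense := dense_range_inclL1 (P := P) (e := e)
  have hΦt : ∀ f : BesovSpace P e, Φ f =ᵐ[m] S.transfer f := by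
    intro f
    have h1 := coeFn_inclL1 (Φ f)
    rw [hΦ f] at h1
    exact h1.symm.trans ((hS.coeFn_opL1 _).trans (S.transfer_congr (coeFn_inclL1 f)))
  have hincl : ∀ (f : BesovSpace P e) (u : Lp ℂ 1 m), f =ᵐ[m] u → inclL1 f = u :=
    fun f u h => Lp.ext ((coeFn_inclL1 f).trans h)
  have hQC : IsQuasiCompact θ Φ := ⟨_, _, hΦG, hG, (sub_add_cancel _ _).symm⟩
  obtain ⟨M, hM⟩ := exists_norm_pow_le hΦ hS.norm_opL1_le hθ0 hθ hΦG
  have hD1 : ∀ z : ℂ, ‖z‖ = 1 → ∀ u : Lp ℂ 1 m, hS.opL1 u = z • u →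
      ∃ f, inclL1 f = u ∧ Φ f = z • f := fun z hz u hu =>
    hQC.exists_eigenvector hθ hM hΦ hdense hS.norm_opL1_le hz hu
  obtain ⟨δ, hδ, E, hE, hE1, hE2, hEA, hEB⟩ := hQC.exists_decomposition hθ hM
  have h1E : (1 : ℂ) ∈ E := hE2 1 (by simp) (one_mem_spectrum hΦt hint)
  have heig : ∀ z ∈ E, ∃ f ≠ 0, Φ f = z • f ∧ hS.opL1 (inclL1 f) = z • inclL1 f := by
    intro z hz
    obtain ⟨f, hf, hfz⟩ := hasEigenvalue_iff.1 (hEA z hz).1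
    exact ⟨f, hf, hfz, by rw [← hΦ, hfz, map_smul]⟩
  refine ⟨?_, Φ, hS.opL1, hΦt, ?_, ⟨δ, hδ, E, hE, ⟨1, h1E⟩, hE1, hEA, hEB, ?_⟩, ⟨M, hM⟩, ?_, ?_⟩
  · refine hdense.mono ?_
    rintro _ ⟨f, rfl⟩
    exact ⟨f, (coeFn_inclL1 f).symm⟩
  · intro f u h
    rw [← hincl f u h, ← hΦ]
    exact coeFn_inclL1 (Φ f)
  · intro z hz
    have hz1 := hE1 z hz
    have hz0 : z ≠ 0 := by rintro rfl; simp at hz1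
    obtain ⟨f, hf, -, hfz⟩ := heig z hz
    have hmem : ∀ n : ℕ, z ^ n ∈ E := by
      intro n
      obtain ⟨w, hw, hwz⟩ := hS.exists_sgn_zpow hz1 hfz n
      rw [zpow_natCast] at hwz
      have hzn : ‖z ^ n‖ = 1 := by rw [norm_pow, hz1, one_pow]
      obtain ⟨g, rfl, hg⟩ := hD1 _ hzn w hwz
      refine hE2 _ hzn (mem_spectrum_of_eigen (f := g) ?_ hg)
      rintro rfl
      refine hf (inclL1_injective (Lp.ext ?_))
      rw [map_zero] at hw ⊢
      filter_upwards [hw, Lp.coeFn_zero ℂ 1 m] with x h1 h2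
      rw [h2] at h1 ⊢
      rw [Pi.zero_apply] at h1 ⊢
      rw [← norm_eq_zero, ← norm_sgn_zpow _ (n : ℤ), ← h1, norm_zero]
    obtain ⟨i, j, hij, h⟩ := Finite.exists_ne_map_eq_of_infinite fun n : ℕ => (⟨z ^ n, hmem n⟩ : E)
    have h' : z ^ i = z ^ j := congrArg Subtype.val h
    wlog hlt : i < j generalizing i j
    · exact this j i hij.symm h.symm h'.symm (lt_of_le_of_ne (not_lt.1 hlt) hij.symm)
    refine ⟨j - i, Nat.sub_pos_of_lt hlt, ?_⟩
    have h2 : z ^ i * z ^ (j - i) = z ^ i * 1 := by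
      rw [← pow_add, Nat.add_sub_cancel' hlt.le, mul_one, h']
    exact mul_left_cancel₀ (pow_ne_zero i hz0) h2
  · obtain ⟨f, hf, -, hf1⟩ := heig 1 h1E
    obtain ⟨v, hv, hv1⟩ := hS.exists_norm (by simp) hf1
    obtain ⟨ρ₀, rfl, hρ₀⟩ := hD1 1 (by simp) v (by rw [hv1, one_smul])
    have hne : ρ₀ ≠ 0 := by
      rintro rfl
      refine hf (inclL1_injective (Lp.ext ?_))
      rw [map_zero] at hv ⊢
      filter_upwards [hv, Lp.coeFn_zero ℂ 1 m] with x h1 h2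
      rw [h2] at h1 ⊢
      simpa using h1.symm
    obtain ⟨a, ha, ha1⟩ := exists_density hne ((coeFn_inclL1 ρ₀).symm.trans hv)
    exact ⟨a • ρ₀, ha, ha1, by rw [map_smul, hρ₀, one_smul]⟩
  · intro z hz u hu
    obtain ⟨f, rfl, -⟩ := hD1 z hz u hu
    exact ⟨⟨f, (coeFn_inclL1 f).symm⟩, hS.exists_norm hz hu, hS.exists_sgn_zpow hz hu⟩
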